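/- Let $k$ be a field. All algebras are $k$-algebras with unit, $\otimes=\otimes_k$, $S^\circ$ is the opposite algebra of $S$ and $S^{\mathrm e}=S\otimes S^\circ$; modules are left modules, $S$-bimodules are the same as $S^{\mathrm e}$-modules, $\operatorname{injdim}B$ denotes the injective dimension of a ring $B$ as a left module over itself, and $\operatorname{gldim}$ is the (ungraded) left global dimension. **Definitions.** A connected graded algebra $A=\bigoplus_{i\ge 0}A_i$ with $A_0=k$ is *Artin–Schelter regular* if it has finite graded global dimension and there are integers $n\ge 0$ and $l$ such that: $A$ has graded injective dimension $n$ both as a left and as a right module over itself; $\operatorname{Ext}^i_A(k,A)=\operatorname{Ext}^i_{A^\circ}(k,A)=0$ for all $i\ne n$; and $\operatorname{Ext}^n_A(k,A)\cong\operatorname{Ext}^n_{A^\circ}(k,A)\cong k(l)$. (Here $k=A/A_{>0}$, the groups $\operatorname{Ext}$ are taken in the graded sense, and $(l)$ is the degree shift.) It is not assumed that $A$ is noetherian or of finite Gelfand–Kirillov dimension. A ring is *Goldie prime* if it is prime and is left and right Goldie; its *Goldie quotient ring* $Q(A)$ is then its two-sided ring of quotients with respect to the set of all regular elements. For a simple artinian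 algebra $S$ put $$\operatorname{htr}S=\operatorname{injdim}S^{\mathrm e},\qquad \operatorname{H}_1\operatorname{tr}S=\sup\{i\mid \operatorname{Ext}^i_{S^{\mathrm e}}(S,S^{\mathrm e})\ne 0\},\qquad \operatorname{H}_2\operatorname{tr}S=\sup_U\,\operatorname{injdim}(S\otimes U),$$ where $U$ ranges over all division $k$-algebras. The algebra $S$ is *homologically uniform* if $\operatorname{htr}S=\operatorname{H}_1\operatorname{tr}S=\operatorname{H}_2\operatorname{tr}S<\infty$; it is *smooth* if the $S^{\mathrm e}$-module $S$ has finite projective dimension; and it is *rigid* if there are an integer $n$ and a $k$-algebra automorphism $\sigma$ of $S$ such that $\operatorname{Ext}^i_{S^{\mathrm e}}(S,S^{\mathrm e})=0$ for $i\ne n$ and $\operatorname{Ext}^n_{S^{\mathrm e}}(S,S^{\mathrm e})\cong S^\sigma$ as $S$-bimodules, where $S^\sigma$ is $S$ with the bimodule structure $a*s*b=a\,s\,\sigma(b)$. **Theorem.** Let $A$ be a connected graded Artin–Schelter regular $k$-algebra that is Goldie prime, and let $Q(A)$ be its Goldie quotient ring. Then $Q(A)$ is a simple artinian algebra that is rigid,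 smooth and homologically uniform, and $$\operatorname{htr}Q(A)=\operatorname{injdim}\bigl(Q(A)\otimes Q(A)^\circ\bigr)=\operatorname{gldim}A.$$ -/

import Mathlib

open CategoryTheory CategoryTheory.Limits
open scoped TensorProduct DirectSum

universe u

noncomputable section

namespace HomTrDeg

/-! ### Graded modules over a graded algebra -/

section GradedModules

variable {k A : Type u} [Field k] [Ring A] [Algebra k A]

/-- A `ℤ`-graded left module over the `ℤ`-graded `k`-algebra `A = ⨁ 𝒜 i`. -/
structure GrMod (𝒜 : ℤ → Submodule k A) where
  /-- the underlying (ungraded) left module -/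
  mod : ModuleCat.{u} A
  /-- the homogeneous components -/
  deg : ℤ → AddSubgroup mod
  isInternal : DirectSum.IsInternal deg
  smul_mem : ∀ {i j : ℤ} {a : A} {m : mod}, a ∈ 𝒜 i → m ∈ deg j → a • m ∈ deg (i + j)

/-- A criterion for a family of subgroups to be a grading, by means of projections. -/
theorem isInternal_of_proj {M : Type u} [AddCommGroup M] (D : ℤ → AddSubgroup M)
    (p : ℤ → M →+ M) (hsame : ∀ i, ∀ m ∈ D i, p i m = m)
    (hne : ∀ i j, j ≠ i → ∀ m ∈ D i, p j m = 0)
    (hspan : ∀ m, m ∈ ⨆ i, D i) : DirectSum.IsInternal D := by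
  refine ⟨?_, fun m => ?_⟩
  · rw [injective_iff_map_eq_zero]
    intro x hx
    have key : ∀ (j : ℤ) (y : ⨁ i, D i),
        p j (DirectSum.coeAddMonoidHom D y) = (y j : M) := by
      intro j y
      induction y using DirectSum.induction_on with
      | zero => simp
      | of i z =>
        rw [DirectSum.coeAddMonoidHom_of]
        by_cases h : j = i
        · subst h
          rw [hsame _ _ z.2, DirectSum.of_eq_same]
        · rw [hne _ _ h _ z.2, DirectSum.of_eq_of_ne _ _ _ h]
          rfl
      | add y z hy hz => simp [hy, hz]
    ext j
    rw [← key j x, hx]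
    simp
  · have hle : ⨆ i, D i ≤ (DirectSum.coeAddMonoidHom D).range :=
      iSup_le fun i x hx =>
        ⟨DirectSum.of (fun i => D i) i ⟨x, hx⟩, DirectSum.coeAddMonoidHom_of D i _⟩
    exact hle (hspan m)

namespace GrMod

variable {𝒜 : ℤ → Submodule k A}

/-- The projection of a graded module to its component of degree `i`. -/
def proj (X : GrMod 𝒜) (i : ℤ) : X.mod →+ X.mod :=
  letI := X.isInternal.chooseDecomposition
  { toFun := fun m => (DirectSum.decompose X.deg m i : X.mod)
    map_zero' := by simp
    map_add' := by intro a b; simp }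

theorem proj_mem (X : GrMod 𝒜) (i : ℤ) (m : X.mod) : X.proj i m ∈ X.deg i :=
  let _ := X.isInternal.chooseDecomposition
  (DirectSum.decompose X.deg m i).2

theorem proj_same (X : GrMod 𝒜) {i : ℤ} {m : X.mod} (h : m ∈ X.deg i) : X.proj i m = m :=
  let _ := X.isInternal.chooseDecomposition
  DirectSum.decompose_of_mem_same X.deg h

theorem proj_ne (X : GrMod 𝒜) {i j : ℤ} (hij : j ≠ i) {m : X.mod} (h : m ∈ X.deg i) :
    X.proj j m = 0 :=
  let _ := X.isInternal.chooseDecomposition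
  DirectSum.decompose_of_mem_ne X.deg h hij.symm

theorem sum_proj (X : GrMod 𝒜) (m : X.mod) : ∃ s : Finset ℤ, ∑ i ∈ s, X.proj i m = m := by
  classical
  let _ := X.isInternal.chooseDecomposition
  exact ⟨_, DirectSum.sum_support_decompose X.deg m⟩

theorem mem_iSup (X : GrMod 𝒜) (m : X.mod) : m ∈ ⨆ i, X.deg i := by
  obtain ⟨s, hs⟩ := X.sum_proj m
  rw [← hs]
  exact sum_mem fun i _ => AddSubgroup.mem_iSup_of_mem i (X.proj_mem i m)

theorem eq_zero_of_proj (X : GrMod 𝒜) {m : X.mod} (h : ∀ i, X.proj i m = 0) : m = 0 := by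
  obtain ⟨s, hs⟩ := X.sum_proj m
  rw [← hs]
  exact Finset.sum_eq_zero fun i _ => h i

/-- A submodule of a graded module is homogeneous if it contains all the homogeneous components
of its elements. -/
def IsHomogeneous (X : GrMod 𝒜) (P : Submodule A X.mod) : Prop :=
  ∀ m ∈ P, ∀ i, X.proj i m ∈ P

/-- A homogeneous submodule, with the induced grading. -/
def sub (X : GrMod 𝒜) (P : Submodule A X.mod) (hP : X.IsHomogeneous P) : GrMod 𝒜 where
  mod := ModuleCat.of A P
  deg i := (X.deg i).comap P.subtype.toAddMonoidHom
  isInternal := by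
    refine isInternal_of_proj _
      (fun i => AddMonoidHom.codRestrict ((X.proj i).comp P.subtype.toAddMonoidHom) P
        (fun m => hP _ m.2 i)) ?_ ?_ ?_
    · intro i m hm
      exact Subtype.ext (X.proj_same hm)
    · intro i j hij m hm
      exact Subtype.ext (X.proj_ne hij hm)
    · intro m
      obtain ⟨s, hs⟩ := X.sum_proj (m : X.mod)
      have : m = ∑ i ∈ s, (⟨X.proj i m, hP _ m.2 i⟩ : P) := by
        apply Subtype.ext
        rw [AddSubmonoidClass.coe_finsetSum]
        exact hs.symm
      rw [this]
      exact sum_mem fun i _ => AddSubgroup.mem_iSup_of_mem i (X.proj_mem i _)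
  smul_mem ha hm := X.smul_mem ha hm

/-- The quotient by a homogeneous submodule, with the induced grading. -/
def quot (X : GrMod 𝒜) (P : Submodule A X.mod) (hP : X.IsHomogeneous P) : GrMod 𝒜 where
  mod := ModuleCat.of A (X.mod ⧸ P)
  deg i := (X.deg i).map P.mkQ.toAddMonoidHom
  isInternal := by
    refine isInternal_of_proj _
      (fun i => (QuotientAddGroup.map P.toAddSubgroup P.toAddSubgroup (X.proj i)
        (fun m hm => hP m hm i) : X.mod ⧸ P →+ X.mod ⧸ P)) ?_ ?_ ?_
    · rintro i _ ⟨m, hm, rfl⟩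
      exact congrArg P.mkQ (X.proj_same hm)
    · rintro i j hij _ ⟨m, hm, rfl⟩
      exact (congrArg P.mkQ (X.proj_ne hij hm)).trans (map_zero _)
    · intro m
      obtain ⟨m, rfl⟩ := P.mkQ_surjective m
      obtain ⟨s, hs⟩ := X.sum_proj m
      rw [← hs, map_sum]
      exact sum_mem fun i _ => AddSubgroup.mem_iSup_of_mem i ⟨_, X.proj_mem i m, rfl⟩
  smul_mem := by
    rintro i j a _ ha ⟨m, hm, rfl⟩
    exact ⟨a • m, X.smul_mem ha hm, rfl⟩

/-- The direct sum of two graded modules. -/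
def prod (X Y : GrMod 𝒜) : GrMod 𝒜 where
  mod := ModuleCat.of A (X.mod × Y.mod)
  deg i := (X.deg i).prod (Y.deg i)
  isInternal := by
    refine isInternal_of_proj _ (fun i => (X.proj i).prodMap (Y.proj i)) ?_ ?_ ?_
    · rintro i ⟨a, b⟩ ⟨ha, hb⟩
      exact Prod.ext (X.proj_same ha) (Y.proj_same hb)
    · rintro i j hij ⟨a, b⟩ ⟨ha, hb⟩
      exact Prod.ext (X.proj_ne hij ha) (Y.proj_ne hij hb)
    · rintro ⟨a, b⟩
      have hab : ((a, b) : X.mod × Y.mod) =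
          AddMonoidHom.inl X.mod Y.mod a + AddMonoidHom.inr X.mod Y.mod b := by simp
      rw [hab]
      obtain ⟨s, hs⟩ := X.sum_proj a
      obtain ⟨t, ht⟩ := Y.sum_proj b
      rw [← hs, ← ht, map_sum, map_sum]
      exact add_mem
        (sum_mem fun i _ => AddSubgroup.mem_iSup_of_mem i ⟨X.proj_mem i a, (Y.deg i).zero_mem⟩)
        (sum_mem fun i _ => AddSubgroup.mem_iSup_of_mem i ⟨(X.deg i).zero_mem, Y.proj_mem i b⟩)
  smul_mem ha hm := ⟨X.smul_mem ha hm.1, Y.smul_mem ha hm.2⟩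

/-- The zero graded module. -/
def zero : GrMod 𝒜 where
  mod := ModuleCat.of A PUnit
  deg _ := ⊤
  isInternal := isInternal_of_proj _ (fun _ => 0) (fun _ _ _ => rfl) (fun _ _ _ _ _ => rfl)
    (fun _ => AddSubgroup.mem_iSup_of_mem 0 trivial)
  smul_mem _ _ := trivial

/-- The shift `X(d)`, with `X(d)_i = X_{i+d}`. -/
def shift (X : GrMod 𝒜) (d : ℤ) : GrMod 𝒜 where
  mod := X.mod
  deg i := X.deg (i + d)
  isInternal := by
    refine isInternal_of_proj _ (fun i => X.proj (i + d)) (fun i m hm => X.proj_same hm)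
      (fun i j hij m hm => X.proj_ne (by simpa using hij) hm) (fun m => ?_)
    obtain ⟨s, hs⟩ := X.sum_proj m
    rw [← hs]
    refine sum_mem fun i _ => AddSubgroup.mem_iSup_of_mem (i - d) ?_
    rw [sub_add_cancel]
    exact X.proj_mem i m
  smul_mem {i j a m} ha hm := by
    have := X.smul_mem ha hm
    rwa [← add_assoc] at this

variable [GradedAlgebra 𝒜]

/-- Homomorphisms of graded modules: module homomorphisms preserving degrees. They form a
`k`-subspace of the space of all module homomorphisms. -/
def homs (X Y : GrMod 𝒜) : Submodule k (X.mod ⟶ Y.mod) where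
  carrier := {f | ∀ i, ∀ m ∈ X.deg i, f.hom m ∈ Y.deg i}
  zero_mem' i m _ := (Y.deg i).zero_mem
  add_mem' hf hg i m hm := (Y.deg i).add_mem (hf i m hm) (hg i m hm)
  smul_mem' c f hf i m hm := by
    have h := Y.smul_mem (SetLike.algebraMap_mem_graded 𝒜 c) (hf i m hm)
    rwa [zero_add] at h

/-- The category of graded modules and homomorphisms of degree zero. -/
instance : Category.{u} (GrMod 𝒜) where
  Hom X Y := homs X Y
  id X := ⟨𝟙 X.mod, fun _ _ hm => hm⟩
  comp f g := ⟨f.1 ≫ g.1, fun i m hm => g.2 i _ (f.2 i m hm)⟩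

/-- The homomorphism of graded modules given by a degree-preserving linear map. -/
def mkHom {X Y : GrMod 𝒜} (f : X.mod →ₗ[A] Y.mod) (hf : ∀ i, ∀ m ∈ X.deg i, f m ∈ Y.deg i) :
    X ⟶ Y :=
  ⟨ModuleCat.ofHom f, hf⟩

/-- The underlying linear map of a homomorphism of graded modules. -/
def lin {X Y : GrMod 𝒜} (f : X ⟶ Y) : X.mod →ₗ[A] Y.mod := f.1.hom

theorem lin_mem {X Y : GrMod 𝒜} (f : X ⟶ Y) {i : ℤ} {m : X.mod} (hm : m ∈ X.deg i) :
    lin f m ∈ Y.deg i := f.2 i m hm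

theorem hom_ext {X Y : GrMod 𝒜} {f g : X ⟶ Y} (h : ∀ m, lin f m = lin g m) : f = g :=
  Subtype.ext (ModuleCat.hom_ext (LinearMap.ext h))

@[simp] theorem lin_comp {X Y Z : GrMod 𝒜} (f : X ⟶ Y) (g : Y ⟶ Z) (m : X.mod) :
    lin (f ≫ g) m = lin g (lin f m) := rfl

@[simp] theorem lin_id (X : GrMod 𝒜) (m : X.mod) : lin (𝟙 X) m = m := rfl

@[simp] theorem lin_mkHom {X Y : GrMod 𝒜} (f : X.mod →ₗ[A] Y.mod)
    (hf : ∀ i, ∀ m ∈ X.deg i, f m ∈ Y.deg i) (m : X.mod) : lin (mkHom f hf) m = f m := rfl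

instance : Preadditive (GrMod 𝒜) where
  homGroup X Y := inferInstanceAs (AddCommGroup (homs X Y))
  add_comp _ _ _ f f' g := Subtype.ext (Preadditive.add_comp _ _ _ f.1 f'.1 g.1)
  comp_add _ _ _ f g g' := Subtype.ext (Preadditive.comp_add _ _ _ f.1 g.1 g'.1)

instance : Linear k (GrMod 𝒜) where
  homModule X Y := inferInstanceAs (Module k (homs X Y))
  smul_comp _ _ _ r f g := Subtype.ext (Linear.smul_comp _ _ _ r f.1 g.1)
  comp_smul _ _ _ f r g := Subtype.ext (Linear.comp_smul _ _ _ f.1 r g.1)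

@[simp] theorem lin_zero {X Y : GrMod 𝒜} (m : X.mod) : lin (0 : X ⟶ Y) m = 0 := rfl

@[simp] theorem lin_add {X Y : GrMod 𝒜} (f g : X ⟶ Y) (m : X.mod) :
    lin (f + g) m = lin f m + lin g m := rfl

theorem lin_proj {X Y : GrMod 𝒜} (f : X ⟶ Y) (i : ℤ) (m : X.mod) :
    lin f (X.proj i m) = Y.proj i (lin f m) := by
  obtain ⟨s, hs⟩ := X.sum_proj m
  conv_rhs => rw [← hs]
  conv_lhs => rw [← hs]
  simp only [map_sum]
  refine Finset.sum_congr rfl fun j _ => ?_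
  by_cases h : i = j
  · subst h
    rw [X.proj_same (X.proj_mem i m), Y.proj_same (lin_mem f (X.proj_mem i m))]
  · rw [X.proj_ne h (X.proj_mem j m), Y.proj_ne h (lin_mem f (X.proj_mem j m)), map_zero]

/-! The category of graded modules is abelian. -/

theorem ker_homogeneous {X Y : GrMod 𝒜} (f : X ⟶ Y) : X.IsHomogeneous (LinearMap.ker (lin f)) := by
  intro m hm i
  rw [LinearMap.mem_ker] at hm ⊢
  rw [lin_proj, hm, map_zero]

theorem range_homogeneous {X Y : GrMod 𝒜} (f : X ⟶ Y) :
    Y.IsHomogeneous (LinearMap.range (lin f)) := by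
  rintro _ ⟨m, rfl⟩ i
  exact ⟨X.proj i m, lin_proj f i m⟩

/-- The inclusion of a homogeneous submodule. -/
def subι (X : GrMod 𝒜) (P : Submodule A X.mod) (hP : X.IsHomogeneous P) : X.sub P hP ⟶ X :=
  mkHom P.subtype fun _ _ hm => hm

/-- The projection to the quotient by a homogeneous submodule. -/
def quotπ (X : GrMod 𝒜) (P : Submodule A X.mod) (hP : X.IsHomogeneous P) : X ⟶ X.quot P hP :=
  mkHom P.mkQ fun _ m hm => ⟨m, hm, rfl⟩

theorem subι_injective (X : GrMod 𝒜) (P : Submodule A X.mod) (hP : X.IsHomogeneous P) :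
    Function.Injective (lin (X.subι P hP)) := Subtype.val_injective

theorem quotπ_surjective (X : GrMod 𝒜) (P : Submodule A X.mod) (hP : X.IsHomogeneous P) :
    Function.Surjective (lin (X.quotπ P hP)) := P.mkQ_surjective

theorem mem_deg_of_injective {X Y : GrMod 𝒜} (f : X ⟶ Y) (hf : Function.Injective (lin f))
    {i : ℤ} {m : X.mod} (hm : lin f m ∈ Y.deg i) : m ∈ X.deg i := by
  have h : X.proj i m = m := hf (by rw [lin_proj, Y.proj_same hm])
  rw [← h]
  exact X.proj_mem i m

/-- An injective homomorphism with the right image is a kernel. -/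
def isLimitOfInjective {X Y Z : GrMod 𝒜} (f : X ⟶ Y) (g : Y ⟶ Z) (w : f ≫ g = 0)
    (hf : Function.Injective (lin f)) (hfg : ∀ y, lin g y = 0 → ∃ x, lin f x = y) :
    IsLimit (KernelFork.ofι f w) :=
  KernelFork.IsLimit.ofι f w
    (fun {W} s hs =>
      have hx : ∀ m : W.mod, ∃ x, lin f x = lin s m := fun m =>
        hfg _ (by rw [← lin_comp, hs, lin_zero])
      mkHom
        { toFun := fun m => (hx m).choose
          map_add' := fun a b => hf <| (hx (a + b)).choose_spec.trans <| by
            rw [map_add, map_add, (hx a).choose_spec, (hx b).choose_spec]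
          map_smul' := fun a b => hf <| (hx (a • b)).choose_spec.trans <| by
            rw [map_smul, map_smul, RingHom.id_apply, (hx b).choose_spec] }
        (fun i m hm => mem_deg_of_injective f hf (by
          have := lin_mem s hm
          rwa [← (hx m).choose_spec] at this)))
    (fun {W} s hs => hom_ext fun m =>
      (hfg (lin s m) (by rw [← lin_comp, hs, lin_zero])).choose_spec)
    (fun {W} s hs t ht => hom_ext fun m => hf (by
      rw [← lin_comp, ht]
      exact (hfg (lin s m) (by rw [← lin_comp, hs, lin_zero])).choose_spec.symm))

/-- A surjective homomorphism with the right kernel is a cokernel. -/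
def isColimitOfSurjective {X Y Z : GrMod 𝒜} (f : X ⟶ Y) (g : Y ⟶ Z) (w : f ≫ g = 0)
    (hg : Function.Surjective (lin g)) (hfg : ∀ y, lin g y = 0 → ∃ x, lin f x = y) :
    IsColimit (CokernelCofork.ofπ g w) :=
  have key : ∀ {W : GrMod 𝒜} (s : Y ⟶ W), f ≫ s = 0 →
      ∀ a b, lin g a = lin g b → lin s a = lin s b := by
    intro W s hs a b hab
    obtain ⟨x, hx⟩ := hfg (a - b) (by rw [map_sub, hab, sub_self])
    rw [← sub_eq_zero, ← map_sub, ← hx, ← lin_comp, hs, lin_zero]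
  CokernelCofork.IsColimit.ofπ g w
    (fun {W} s hs => mkHom
        { toFun := fun m => lin s (hg m).choose
          map_add' := fun a b => by
            rw [← map_add]
            refine key s hs _ _ ?_
            rw [map_add, (hg (a + b)).choose_spec, (hg a).choose_spec, (hg b).choose_spec]
          map_smul' := fun a b => by
            rw [RingHom.id_apply, ← map_smul]
            refine key s hs _ _ ?_
            rw [map_smul, (hg (a • b)).choose_spec, (hg b).choose_spec] }
        (fun i m hm => by
          have h : lin s (hg m).choose = lin s (Y.proj i (hg m).choose) := key s hs _ _ (by
            rw [lin_proj, (hg m).choose_spec, Z.proj_same hm])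
          change lin s (hg m).choose ∈ W.deg i
          rw [h]
          exact lin_mem s (Y.proj_mem i _)))
    (fun {W} s hs => hom_ext fun m => key s hs _ _ (hg (lin g m)).choose_spec)
    (fun {W} s hs t ht => hom_ext fun m => by
      obtain ⟨y, rfl⟩ := hg m
      rw [← lin_comp, ht]
      exact (key s hs _ _ (hg (lin g y)).choose_spec).symm)

theorem subι_comp {X Y : GrMod 𝒜} (f : X ⟶ Y) : X.subι _ (ker_homogeneous f) ≫ f = 0 :=
  hom_ext fun m => m.2

theorem comp_quotπ {X Y : GrMod 𝒜} (f : X ⟶ Y) : f ≫ Y.quotπ _ (range_homogeneous f) = 0 :=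
  hom_ext fun m => (Submodule.Quotient.mk_eq_zero _).2 ⟨m, rfl⟩

theorem injective_of_mono {X Y : GrMod 𝒜} (f : X ⟶ Y) [Mono f] : Function.Injective (lin f) := by
  rw [injective_iff_map_eq_zero]
  intro m hm
  have h : X.subι _ (ker_homogeneous f) = 0 := by
    rw [← cancel_mono f, subι_comp, zero_comp]
  exact congrArg (fun φ => lin φ (⟨m, hm⟩ : LinearMap.ker (lin f))) h

theorem surjective_of_epi {X Y : GrMod 𝒜} (f : X ⟶ Y) [Epi f] : Function.Surjective (lin f) := by
  intro m
  have h : Y.quotπ _ (range_homogeneous f) = 0 := by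
    rw [← cancel_epi f, comp_quotπ, comp_zero]
  exact (Submodule.Quotient.mk_eq_zero _).1 (congrArg (fun φ => lin φ m) h)

instance : HasZeroObject (GrMod 𝒜) :=
  ⟨zero, (IsZero.iff_id_eq_zero _).2 (hom_ext fun _ => rfl)⟩

instance : HasBinaryBiproducts (GrMod 𝒜) where
  has_binary_biproduct X Y := hasBinaryBiproduct_of_total
    { pt := X.prod Y
      fst := mkHom (LinearMap.fst A X.mod Y.mod) fun _ _ hm => hm.1
      snd := mkHom (LinearMap.snd A X.mod Y.mod) fun _ _ hm => hm.2
      inl := mkHom (LinearMap.inl A X.mod Y.mod) fun i _ hm => ⟨hm, (Y.deg i).zero_mem⟩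
      inr := mkHom (LinearMap.inr A X.mod Y.mod) fun i _ hm => ⟨(X.deg i).zero_mem, hm⟩
      inl_fst := hom_ext fun _ => rfl
      inl_snd := hom_ext fun _ => rfl
      inr_fst := hom_ext fun _ => rfl
      inr_snd := hom_ext fun _ => rfl }
    (hom_ext fun m => Prod.ext (add_zero m.1) (zero_add m.2))

instance : Abelian (GrMod 𝒜) where
  has_finite_products :=
    have : HasTerminal (GrMod 𝒜) := HasZeroObject.hasTerminal
    have : HasBinaryProducts (GrMod 𝒜) := inferInstance
    hasFiniteProducts_of_has_binary_and_terminal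
  has_kernels := ⟨fun f => ⟨⟨_, isLimitOfInjective _ f (subι_comp f) (subι_injective _ _ _)
    fun y hy => ⟨⟨y, hy⟩, rfl⟩⟩⟩⟩
  has_cokernels := ⟨fun f => ⟨⟨_, isColimitOfSurjective f _ (comp_quotπ f) (quotπ_surjective _ _ _)
    fun _ hy => (Submodule.Quotient.mk_eq_zero _).1 hy⟩⟩⟩
  normalMonoOfMono f _ := ⟨
    { Z := _
      g := quotπ _ _ (range_homogeneous f)
      w := comp_quotπ f
      isLimit := isLimitOfInjective f _ _ (injective_of_mono f)
        fun _ hy => (Submodule.Quotient.mk_eq_zero _).1 hy }⟩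
  normalEpiOfEpi f _ := ⟨
    { W := _
      g := subι _ _ (ker_homogeneous f)
      w := subι_comp f
      isColimit := isColimitOfSurjective _ f _ (surjective_of_epi f)
        fun y hy => ⟨⟨y, hy⟩, rfl⟩ }⟩

/-! ### Standard graded modules -/

variable (𝒜)

/-- `A` as a graded left module over itself. -/
def self : GrMod 𝒜 where
  mod := ModuleCat.of A A
  deg i := (𝒜 i).toAddSubgroup
  isInternal := by
    refine isInternal_of_proj _ (fun i => GradedRing.proj 𝒜 i)
      (fun i m hm => DirectSum.decompose_of_mem_same 𝒜 hm)
      (fun i j hij m hm => DirectSum.decompose_of_mem_ne 𝒜 hm hij.symm) (fun m => ?_)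
    classical
    rw [← DirectSum.sum_support_decompose 𝒜 m]
    exact sum_mem fun i _ => AddSubgroup.mem_iSup_of_mem i (SetLike.coe_mem _)
  smul_mem ha hm := SetLike.mul_mem_graded ha hm

/-- The left ideal generated by the homogeneous elements of positive degree; it is `A_{>0}` if
`A` is concentrated in nonnegative degrees. -/
def augIdeal : Submodule A A := Ideal.span {a | ∃ i > 0, a ∈ 𝒜 i}

theorem augIdeal_homogeneous : (self 𝒜).IsHomogeneous (augIdeal 𝒜) := by
  have h : Ideal.IsHomogeneous 𝒜 (augIdeal 𝒜) :=
    Ideal.homogeneous_span 𝒜 _ (by rintro a ⟨i, -, ha⟩; exact ⟨i, ha⟩)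
  intro m hm i
  let p : A →+ A := (self 𝒜).proj i
  have hp : ∀ a : A, p a = (DirectSum.decompose 𝒜 a i : A) := by
    intro a
    classical
    conv_lhs => rw [← DirectSum.sum_support_decompose 𝒜 a, map_sum]
    have hj : ∀ j, p (DirectSum.decompose 𝒜 a j : A) =
        if j = i then (DirectSum.decompose 𝒜 a i : A) else 0 := by
      intro j
      split_ifs with hji
      · subst hji
        exact (self 𝒜).proj_same (SetLike.coe_mem _)
      · exact (self 𝒜).proj_ne (Ne.symm hji) (i := j) (SetLike.coe_mem _)
    rw [Finset.sum_congr rfl fun j _ => hj j, Finset.sum_ite_eq']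
    split_ifs with hi
    · rfl
    · rw [DFinsupp.notMem_support_iff.1 hi]
      rfl
  have hm' : (DirectSum.decompose 𝒜 (show A from m) i : A) ∈ augIdeal 𝒜 := h i hm
  exact (hp m).symm ▸ hm'

/-- The trivial graded module `A / A_{>0}`, which is `k` in degree `0` if `A` is connected. -/
def triv : GrMod 𝒜 := (self 𝒜).quot (augIdeal 𝒜) (augIdeal_homogeneous 𝒜)

end GrMod

/-! ### Artin–Schelter regular algebras -/

/-- The opposite algebra of a graded algebra, with the same homogeneous components. Graded right
`A`-modules are graded left modules over it. -/
def opGrading (𝒜 : ℤ → Submodule k A) (i : ℤ) : Submodule k Aᵐᵒᵖ :=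
  (𝒜 i).map (MulOpposite.opLinearEquiv k).toLinearMap

instance (𝒜 : ℤ → Submodule k A) [GradedAlgebra 𝒜] : GradedAlgebra (opGrading 𝒜) where
  one_mem := ⟨1, SetLike.one_mem_graded 𝒜, rfl⟩
  mul_mem := by
    rintro i j _ _ ⟨a, ha, rfl⟩ ⟨b, hb, rfl⟩
    exact ⟨b * a, add_comm j i ▸ SetLike.mul_mem_graded hb ha, rfl⟩
  toDecomposition := DirectSum.IsInternal.chooseDecomposition _ (by
    refine isInternal_of_proj (fun i => (opGrading 𝒜 i).toAddSubgroup)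
      (fun i => (MulOpposite.opAddEquiv.toAddMonoidHom.comp (GradedRing.proj 𝒜 i)).comp
        MulOpposite.opAddEquiv.symm.toAddMonoidHom) ?_ ?_ ?_
    · rintro i _ ⟨a, ha, rfl⟩
      exact congrArg MulOpposite.op (DirectSum.decompose_of_mem_same 𝒜 ha)
    · rintro i j hij _ ⟨a, ha, rfl⟩
      exact congrArg MulOpposite.op (DirectSum.decompose_of_mem_ne 𝒜 ha hij.symm)
    · intro m
      classical
      obtain ⟨a, rfl⟩ := MulOpposite.op_surjective m
      rw [← DirectSum.sum_support_decompose 𝒜 a, Finset.op_sum]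
      exact sum_mem fun i _ => AddSubgroup.mem_iSup_of_mem i ⟨_, SetLike.coe_mem _, rfl⟩)

variable (𝒜 : ℤ → Submodule k A) [GradedAlgebra 𝒜]

/-- `A` is connected graded: `A = k ⊕ A₁ ⊕ A₂ ⊕ ⋯`. -/
structure IsConnectedGraded : Prop where
  algebraMap_injective : Function.Injective (algebraMap k A)
  deg_neg : ∀ i < 0, 𝒜 i = ⊥
  deg_zero : 𝒜 0 = 1

/-- The component of degree `d` of the graded `Ext^i_A(k, A)`, namely `Ext^i(k, A(d))` in the
category of graded left modules. -/
abbrev GrExt (i : ℕ) (d : ℤ) : Type (u + 1) :=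
  letI := HasExt.standard (GrMod 𝒜)
  Abelian.Ext (GrMod.triv 𝒜) ((GrMod.self 𝒜).shift d) i

/-- The one-sided (left) Gorenstein condition with parameters `n` and `l`: the graded injective
dimension of `A` is `n`, `Ext^i_A(k, A) = 0` for `i ≠ n`, and `Ext^n_A(k, A) ≅ k(l)`. As
`k(l)` is concentrated in degree `-l`, where it is one-dimensional, and there is exactly one
module structure over a connected graded algebra on such a graded vector space, the last
condition only involves the dimensions of the components. -/
structure IsLeftGorenstein (n : ℕ) (l : ℤ) : Prop where
  injDim : injectiveDimension (GrMod.self 𝒜) = n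
  ext_ne : ∀ i ≠ n, ∀ d, Subsingleton (GrExt 𝒜 i d)
  ext_eq : Nonempty (GrExt 𝒜 n (-l) ≃ₗ[k] k)
  ext_eq_zero : ∀ d ≠ -l, Subsingleton (GrExt 𝒜 n d)

/-- Artin–Schelter Gorenstein algebras. -/
def IsASGorenstein : Prop :=
  IsConnectedGraded 𝒜 ∧ ∃ (n : ℕ) (l : ℤ),
    IsLeftGorenstein 𝒜 n l ∧ IsLeftGorenstein (opGrading 𝒜) n l

/-- Artin–Schelter regular algebras: Artin–Schelter Gorenstein of finite graded global
dimension. -/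
def IsASRegular : Prop :=
  IsASGorenstein 𝒜 ∧ ∃ N : ℕ, ∀ M : GrMod 𝒜, projectiveDimension M ≤ N

end GradedModules

/-! ### Goldie prime rings and their quotient rings -/

section Goldie

/-- Prime rings. -/
def IsPrimeRing (R : Type u) [Ring R] : Prop :=
  Nontrivial R ∧ ∀ a b : R, (∀ r, a * r * b = 0) → a = 0 ∨ b = 0

/-- The left annihilator of a subset. -/
def leftAnnihilator {R : Type u} [Ring R] (X : Set R) : Set R := {a | ∀ x ∈ X, a * x = 0}

/-- Left Goldie rings: there is no infinite direct sum of nonzero left ideals, and left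
annihilators satisfy the ascending chain condition. -/
def IsLeftGoldie (R : Type u) [Ring R] : Prop :=
  (∀ I : ℕ → Submodule R R, iSupIndep I → ∃ n, I n = ⊥) ∧
  ∀ X : ℕ → Set R, Monotone (fun n => leftAnnihilator (X n)) →
    ∃ n, ∀ m ≥ n, leftAnnihilator (X m) = leftAnnihilator (X n)

/-- Goldie prime rings: prime, left Goldie and right Goldie. -/
def IsGoldiePrime (R : Type u) [Ring R] : Prop :=
  IsPrimeRing R ∧ IsLeftGoldie R ∧ IsLeftGoldie Rᵐᵒᵖ

variable {k A Q : Type u} [Field k] [Ring A] [Algebra k A] [Ring Q] [Algebra k Q]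

/-- `ι : A → Q` exhibits `Q` as the two-sided ring of quotients `Q(A) = S⁻¹A = AS⁻¹` of `A` with
respect to the set `S` of all regular elements. This determines `Q` up to a unique isomorphism;
`Q` is called the Goldie quotient ring if `A` is Goldie prime. -/
structure IsGoldieQuotientRing (ι : A →ₐ[k] Q) : Prop where
  injective : Function.Injective ι
  isUnit : ∀ s, IsRegular s → IsUnit (ι s)
  exists_left : ∀ q, ∃ s a, IsRegular s ∧ ι s * q = ι a
  exists_right : ∀ q, ∃ s a, IsRegular s ∧ q * ι s = ι a

end Goldie

/-! ### Homological transcendence degree -/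

section Htr

/-- The injective dimension of a ring as a left module over itself. -/
def selfInjDim (B : Type u) [Ring B] : WithBot ℕ∞ := injectiveDimension (ModuleCat.of B B)

/-- The (left) global dimension of a ring. -/
def gldim (B : Type u) [Ring B] : WithBot ℕ∞ := ⨆ M : ModuleCat.{u} B, projectiveDimension M

variable (k S : Type u) [Field k] [Ring S] [Algebra k S]

/-- The enveloping algebra `S ⊗ S°`. -/
abbrev Env : Type u := S ⊗[k] Sᵐᵒᵖ

/-- `S` as a left module over `S ⊗ S°`, with `(a ⊗ b) • s = a s b`. -/
def bimod : ModuleCat.{u} (Env k S) :=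
  letI : Module (Env k S) S := instModuleTensorProductMop k S
  ModuleCat.of (Env k S) S

/-- `Ext^i_{S ⊗ S°}(S, S ⊗ S°)`. -/
abbrev ExtEnv (i : ℕ) : Type u :=
  Abelian.Ext (bimod k S) (ModuleCat.of (Env k S) (Env k S)) i

/-- Right multiplication by `b`, as an endomorphism of the left module `B`. -/
def rightMul {B : Type u} [Ring B] (b : B) : ModuleCat.of B B ⟶ ModuleCat.of B B :=
  ModuleCat.ofHom (LinearMap.toSpanSingleton B B b)

variable {k S} in
/-- The `S`-bimodule structure of `Ext^i_{S ⊗ S°}(S, S ⊗ S°)`: the right `S ⊗ S°`-module structure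
of the second argument, where `s * x * t = x · (t ⊗ s)`. -/
def bimodAct {i : ℕ} (s : S) (x : ExtEnv k S i) (t : S) : ExtEnv k S i :=
  x.comp (Abelian.Ext.mk₀ (rightMul (B := Env k S) (t ⊗ₜ[k] MulOpposite.op s))) (add_zero i)

/-- The homological transcendence degree. -/
def htr : WithBot ℕ∞ := selfInjDim (Env k S)

/-- The first modification of `htr`: `sup {i | Ext^i_{S ⊗ S°}(S, S ⊗ S°) ≠ 0}`. -/
def fhtr : WithBot ℕ∞ := ⨆ (i : ℕ) (_ : Nontrivial (ExtEnv k S i)), (i : WithBot ℕ∞)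

/-- The second modification of `htr`: the supremum of the injective dimensions of `S ⊗ U`, for
all division `k`-algebras `U`. -/
def shtr : WithBot ℕ∞ :=
  sSup {d | ∃ (U : Type u) (_ : DivisionRing U) (_ : Algebra k U), d = selfInjDim (S ⊗[k] U)}

/-- Simple artinian rings. -/
def IsSimpleArtinian (R : Type u) [Ring R] : Prop := IsSimpleRing R ∧ IsArtinianRing R

/-- A simple artinian algebra is homologically uniform if its three invariants are equal
and finite. -/
def IsHomologicallyUniform : Prop :=
  IsSimpleArtinian S ∧ htr k S = fhtr k S ∧ fhtr k S = shtr k S ∧ shtr k S < ⊤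

/-- A simple artinian algebra is smooth if the projective dimension of the `S ⊗ S°`-module `S` is
finite. -/
def IsSmooth : Prop := IsSimpleArtinian S ∧ projectiveDimension (bimod k S) < ⊤

/-- A simple artinian algebra is rigid if, for some `n` and some automorphism `σ`,
`Ext^n_{S ⊗ S°}(S, S ⊗ S°)` is isomorphic as a bimodule to `S` with the bimodule structure
`s * x * t = s x σ(t)`, and `Ext^i_{S ⊗ S°}(S, S ⊗ S°) = 0` for `i ≠ n`. -/
def IsRigid : Prop :=
  IsSimpleArtinian S ∧ ∃ (n : ℕ) (σ : S ≃ₐ[k] S),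
    (∀ i ≠ n, Subsingleton (ExtEnv k S i)) ∧
    ∃ e : ExtEnv k S n ≃+ S, ∀ s x t, e (bimodAct s x t) = s * e x * σ t

end Htr

end HomTrDeg

end

noncomputable section

namespace HomTrDeg

/-! ### Ext from a projective resolution -/

section AbelianResolution

universe w v u₁
variable {C : Type u₁} [Category.{v} C] [Abelian C]

/-! Everything is read off one object, a minimal graded free resolution `P` of `A` as a bimodule. It
exists without finiteness assumptions (`IsConnectedGraded.nonempty_minRes`), because homogeneous
submodules of graded free modules on generators of nonnegative degree have minimal generators. Since
`P → A` splits as a complex of right modules, `P ⊗_A k` is a minimal resolution of the trivial left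
module `k` on the same generators. By minimality every coboundary has zero augmentation, so a
generator which is a cocycle has a nonzero class. Together with the Gorenstein condition this shows
that `P` has length exactly `n`, that its last term has rank one and is generated in degree `l`, and
that all its terms have finite rank (`MinRes.top_eq`, `MinRes.deg_top`, `MinRes.subsingleton_top`,
`MinRes.finite_X`).

The dual complex `Hom(P, A ⊗ A°)` consists of columns with entries in `A ⊗ A°`. Filter it by the
degree in the second factor: on lowest components its differential is that of `Hom_A(P ⊗_A k, A) ⊗
A°`. Hence it is exact below degree `n`, and its cohomology in degree `n` is `(A ⊗ A°)/I` for a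
right ideal `I` complementary to `1 ⊗ A°`. The same argument for `A°` shows that `I` is
complementary to `A ⊗ 1`. Such an ideal is the kernel of `x ⊗ y ↦ σ(y)x` for an automorphism `σ`
(`IsTwistIdeal.exists_twistProj`).

Now `Q ⊗ Q°` is a ring of fractions of `A ⊗ A°` with respect to the tensors of regular elements.
Clearing denominators carries the resolution, the exactness of its dual and the twist over to `Q`
(`MinRes.isTwistedDual`). Rigidity, smoothness and `H₁tr Q = n` follow. For semisimple `U` and a
module `N` over `Q ⊗ U`, tensoring the resolution with `N` over `Q` gives terms that are sums of
copies of `Q ⊗ N`. These are projective since `N` is projective over `U`, so the injective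
dimensions in question are at most `n` (`hasProjectiveDimensionLT_of_freeRes`). Equality holds for
`htr` because `Ext^n(Q, Q ⊗ Q°) ≠ 0`, and for `H₂tr` because `Q = M_r(D)` gives `Q ⊗ Q° = M_r(Q ⊗
D°)`. With `A` in place of `Q` and `U = k` the bound reads `gldim A ≤ n`, and minimality gives
`Ext^n_A(k, k) ≠ 0`.

That `Q` is simple artinian is Goldie's theorem: an essential left ideal of `A` contains a regular
element (`exists_isRegular_mem`), so left ideals of `Q` have complements. -/

theorem eq_zero_of_extMk_eq_zero [HasExt.{w} C] {Y N : C} (R : ProjectiveResolution Y)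
    (f : R.complex.X 0 ⟶ N) (hf : R.complex.d 1 0 ≫ f = 0) (h : R.extMk f 1 rfl hf = 0) :
    f = 0 := by
  have h' := congrArg R.extEquivCohomologyClass h
  rw [ProjectiveResolution.extEquivCohomologyClass_extMk,
    ProjectiveResolution.extEquivCohomologyClass_zero,
    CochainComplex.HomComplex.CohomologyClass.mk_eq_zero_iff,
    CochainComplex.HomComplex.Cocycle.toSingleMk_mem_coboundaries_iff _ _ _ _ _ 1
      (by simp)] at h'
  obtain ⟨g, hg⟩ := h'
  -- A coboundary of degree zero factors through the cochain term of index `1`, which is zero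
  -- because a resolution lives in nonpositive cochain degrees.
  have hz : IsZero (R.cochainComplex.X 1) :=
    CochainComplex.isZero_of_isStrictlyLE _ 0 1 (by simp)
  rw [hz.eq_of_src g 0, comp_zero] at hg
  rw [← cancel_epi (R.cochainComplexXIso (-(0 : ℕ)) 0 rfl).hom, comp_zero]
  exact hg.symm

/-- A projective resolution of `Y`, given by its terms, its differentials and its augmentation. -/
structure ProjRes (Y : C) where
  P : ℕ → C
  d : ∀ i, P (i + 1) ⟶ P i
  aug : P 0 ⟶ Y
  projective : ∀ i, Projective (P i)
  epi_aug : Epi aug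
  d_aug : d 0 ≫ aug = 0
  d_d : ∀ i, d (i + 1) ≫ d i = 0
  exact_zero : (ShortComplex.mk _ _ d_aug).Exact
  exact_succ : ∀ i, (ShortComplex.mk _ _ (d_d i)).Exact

namespace ProjRes

variable {Y : C} (R : ProjRes Y)

/-- The resolution as a chain complex. -/
def complex : ChainComplex C ℕ := ChainComplex.of R.P R.d R.d_d

theorem complex_d (i : ℕ) : R.complex.d (i + 1) i = R.d i := ChainComplex.of_d ..

theorem exactAt_succ (n : ℕ) : R.complex.ExactAt (n + 1) := by
  rw [HomologicalComplex.exactAt_iff' _ (n + 1 + 1) (n + 1) n (by simp) (by simp)]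
  refine (ShortComplex.exact_iff_of_iso ?_).2 (R.exact_succ n)
  exact ShortComplex.isoMk (Iso.refl _) (Iso.refl _) (Iso.refl _)
    ((Category.id_comp _).trans ((R.complex_d (n + 1)).symm.trans (Category.comp_id _).symm))
    ((Category.id_comp _).trans ((R.complex_d n).symm.trans (Category.comp_id _).symm))

/-- The augmentation as a morphism of complexes. -/
def π : R.complex ⟶ (ChainComplex.single₀ C).obj Y :=
  (ChainComplex.toSingle₀Equiv _ _).symm ⟨R.aug,
    (congrArg (fun φ => φ ≫ R.aug) (R.complex_d 0)).trans R.d_aug⟩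

theorem π_f_zero : R.π.f 0 = R.aug := ChainComplex.toSingle₀Equiv_symm_apply_f_zero ..

theorem quasiIsoAt_zero : QuasiIsoAt R.π 0 := by
  rw [ChainComplex.quasiIsoAt₀_iff, ShortComplex.quasiIso_iff_of_zeros' _ rfl rfl rfl]
  refine (ShortComplex.exact_and_epi_g_iff_of_iso ?_).2 ⟨R.exact_zero, R.epi_aug⟩
  exact ShortComplex.isoMk (Iso.refl _) (Iso.refl _) (Iso.refl _)
    ((Category.id_comp _).trans ((R.complex_d 0).symm.trans (Category.comp_id _).symm))
    ((Category.id_comp _).trans (R.π_f_zero.symm.trans (Category.comp_id _).symm))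

/-- The resolution as a `ProjectiveResolution`. -/
def toProjectiveResolution : ProjectiveResolution Y where
  complex := R.complex
  projective i := R.projective i
  π := R.π
  quasiIso := ⟨fun n => by
    cases n with
    | zero => exact R.quasiIsoAt_zero
    | succ n =>
      rw [quasiIsoAt_iff_exactAt']
      · exact R.exactAt_succ n
      · exact ChainComplex.exactAt_succ_single_obj ..⟩

variable [HasExt.{w} C] {N : C}

/-- Coboundaries of the complex of homomorphisms to `N`. -/
def IsCob (R : ProjRes Y) : ∀ {i : ℕ}, (R.P i ⟶ N) → Prop
  | 0, f => f = 0
  | p + 1, f => ∃ g : R.P p ⟶ N, R.d p ≫ g = f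

/-- The class in `Ext` of a cocycle. -/
def ext {i : ℕ} (f : R.P i ⟶ N) (hf : R.d i ≫ f = 0) : Abelian.Ext Y N i :=
  R.toProjectiveResolution.extMk f (i + 1) rfl
    ((congrArg (fun φ => φ ≫ f) (R.complex_d i)).trans hf)

theorem ext_add {i : ℕ} (f g : R.P i ⟶ N) (hf : R.d i ≫ f = 0) (hg : R.d i ≫ g = 0) :
    R.ext (f + g) (by rw [Preadditive.comp_add, hf, hg, add_zero]) = R.ext f hf + R.ext g hg :=
  (R.toProjectiveResolution.add_extMk f g _ rfl _ _).symm

theorem ext_surjective {i : ℕ} (α : Abelian.Ext Y N i) : ∃ f hf, R.ext f hf = α := by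
  obtain ⟨f, hf, h⟩ := R.toProjectiveResolution.extMk_surjective α (i + 1) rfl
  exact ⟨f, (congrArg (fun φ => φ ≫ f) (R.complex_d i)).symm.trans hf, h⟩

theorem ext_comp {i : ℕ} {N' : C} (f : R.P i ⟶ N) (hf : R.d i ≫ f = 0) (g : N ⟶ N') :
    (R.ext f hf).comp (Abelian.Ext.mk₀ g) (add_zero i) =
      R.ext (f ≫ g) (by rw [← Category.assoc, hf, zero_comp]) :=
  R.toProjectiveResolution.extMk_comp_mk₀ f _ rfl _ g

theorem ext_eq_zero_iff {i : ℕ} (f : R.P i ⟶ N) (hf : R.d i ≫ f = 0) :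
    R.ext f hf = 0 ↔ R.IsCob f := by
  cases i with
  | succ p =>
    refine (R.toProjectiveResolution.extMk_eq_zero_iff f (p + 1 + 1) rfl _ p rfl).trans ?_
    refine exists_congr fun g => ?_
    have h := congrArg (fun φ => φ ≫ g) (R.complex_d p)
    exact ⟨fun h' => h.symm.trans h', fun h' => h.trans h'⟩
  | zero =>
    refine ⟨fun h => ?_, fun h => ?_⟩
    · exact eq_zero_of_extMk_eq_zero R.toProjectiveResolution f _ h
    · change f = 0 at h
      subst h
      exact R.toProjectiveResolution.extMk_zero _ rfl

theorem isCob_of_subsingleton {i : ℕ} (h : Subsingleton (Abelian.Ext Y N i)) (f : R.P i ⟶ N)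
    (hf : R.d i ≫ f = 0) : R.IsCob f :=
  (R.ext_eq_zero_iff f hf).1 (Subsingleton.elim _ _)

end ProjRes

theorem hasProjectiveDimensionLT_of_isZero {Y : C} (R : ProjRes Y) (n : ℕ)
    (h : ∀ i ≥ n, IsZero (R.P i)) : HasProjectiveDimensionLT Y n := by
  let _ := HasExt.standard C
  rw [hasProjectiveDimensionLT_iff]
  intro i hi N e
  obtain ⟨f, hf, rfl⟩ := R.ext_surjective e
  refine (R.ext_eq_zero_iff f hf).2 ?_
  rw [(h i hi).eq_of_src f 0]
  cases i with
  | zero => rfl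
  | succ p => exact ⟨0, comp_zero⟩

end AbelianResolution

/-! ### Goldie's theorem for prime rings -/

section GoldieTheorem

variable {R : Type u} [Ring R]

/-- A left ideal is essential if it meets every nonzero left ideal. -/
def IsEssentialIdeal (L : Submodule R R) : Prop := ∀ K : Submodule R R, L ⊓ K = ⊥ → K = ⊥

/-- Padding a finite family by zeros turns it into an initial segment, so that independence can be
proved by induction on the length. -/
theorem iSupIndep_nat_of_sum {p : ℕ → Submodule R R}
    (h : ∀ (N : ℕ) (v : ℕ → R), (∀ i, v i ∈ p i) → ∑ i ∈ Finset.range N, v i = 0 →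
      ∀ i < N, v i = 0) : iSupIndep p := by
  classical
  rw [iSupIndep_iff_finsetSum_eq_zero_imp_eq_zero]
  intro s v hv hs i hi
  have hsum : ∑ j ∈ Finset.range (s.sup id + 1), (if j ∈ s then v j else 0) = 0 := by
    rw [← Finset.sum_filter]
    refine Eq.trans ?_ hs
    refine Finset.sum_congr (Finset.ext fun j => ?_) fun _ _ => rfl
    simp only [Finset.mem_filter, Finset.mem_range, and_iff_right_iff_imp]
    exact fun hj => Nat.lt_succ_of_le (Finset.le_sup (f := id) hj)
  have := h _ (fun j => if j ∈ s then v j else 0) (fun j => by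
    by_cases hj : j ∈ s
    · simpa [hj] using hv j hj
    · simp [hj]) hsum i (Nat.lt_succ_of_le (Finset.le_sup (f := id) hi))
  simpa [hi] using this

/-- Otherwise a strictly larger annihilator can always be chosen, and iterating the choice
contradicts the ascending chain condition. -/
theorem exists_maximal_leftAnnihilator (hR : IsLeftGoldie R) (P : R → Prop) (hP : ∃ a, P a) :
    ∃ a, P a ∧ ∀ b, P b → leftAnnihilator {a} ⊆ leftAnnihilator {b} →
      leftAnnihilator {b} = leftAnnihilator {a} := by
  by_contra! hcon
  choose f hf using fun a : {a // P a} => hcon a.1 a.2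
  obtain ⟨a₀, ha₀⟩ := hP
  let s : ℕ → {a // P a} := fun n => (fun a => ⟨f a, (hf a).1⟩)^[n] ⟨a₀, ha₀⟩
  have hs : ∀ n, (s (n + 1) : R) = f (s n) := fun n => by
    simp only [s, Function.iterate_succ_apply']
  obtain ⟨n, hn⟩ := hR.2 (fun n => {(s n : R)}) (monotone_nat_of_le_succ fun n => by
    rw [hs]; exact (hf (s n)).2.1)
  refine (hf (s n)).2.2 ?_
  rw [← hs]
  exact hn (n + 1) (Nat.le_succ n)

theorem mem_leftAnnihilator_singleton {a x : R} : x ∈ leftAnnihilator {a} ↔ x * a = 0 := by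
  simp [leftAnnihilator]

theorem mul_pow_mul_comm (x a : R) (n : ℕ) : (a * x) ^ n * a = a * (x * a) ^ n := by
  induction n with
  | zero => simp
  | succ n ih => rw [pow_succ, mul_assoc, mul_assoc a x a, ← mul_assoc, ih, mul_assoc, ← pow_succ]

/-- Let `a ≠ 0` in `N` have maximal left annihilator. For any `x`, the last nonzero element of the
form `(ax)^j a = a(xa)^j` has an annihilator containing that of `a`, hence equal to it, and it is
annihilated by `ax`. So `axa = 0` for all `x`, against primeness. -/
theorem eq_bot_of_isNilpotent (hp : IsPrimeRing R) (hR : IsLeftGoldie R) (N : Submodule R R)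
    (hN : ∀ a ∈ N, IsNilpotent a) : N = ⊥ := by
  classical
  by_contra hne
  obtain ⟨a₀, ha₀, ha₀'⟩ := N.ne_bot_iff.1 hne
  obtain ⟨a, ⟨haN, ha⟩, hmax⟩ := exists_maximal_leftAnnihilator hR (fun a => a ∈ N ∧ a ≠ 0)
    ⟨a₀, ha₀, ha₀'⟩
  refine (hp.2 a a fun x => ?_).elim ha ha
  have hex : ∃ j, (a * x) ^ j * a = 0 := by
    obtain ⟨m, hm⟩ := hN (x * a) (N.smul_mem x haN)
    exact ⟨m, by rw [mul_pow_mul_comm, hm, mul_zero]⟩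
  obtain ⟨j, hj⟩ : ∃ j, Nat.find hex = j + 1 := Nat.exists_eq_succ_of_ne_zero fun h0 => by
    have := Nat.find_spec hex
    rw [h0] at this
    exact ha (by simpa using this)
  have hb : (a * x) ^ j * a ≠ 0 := Nat.find_min hex (by omega)
  have hb' : (a * x) ^ (j + 1) * a = 0 := hj ▸ Nat.find_spec hex
  have hann := hmax ((a * x) ^ j * a) ⟨N.smul_mem _ haN, hb⟩ (fun y hy => by
    rw [mem_leftAnnihilator_singleton] at hy ⊢
    rw [mul_pow_mul_comm, ← mul_assoc, hy, zero_mul])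
  have : a * x ∈ leftAnnihilator {(a * x) ^ j * a} := by
    rw [mem_leftAnnihilator_singleton, ← mul_assoc, ← pow_succ', hb']
  rwa [hann, mem_leftAnnihilator_singleton] at this

theorem exists_pow_leftAnnihilator (hR : IsLeftGoldie R) (x : R) :
    ∃ m, 1 ≤ m ∧ ∀ y, y * (x ^ m * x ^ m) = 0 → y * x ^ m = 0 := by
  obtain ⟨n, hn⟩ := hR.2 (fun n => {x ^ (n + 1)}) (monotone_nat_of_le_succ fun n y hy => by
    rw [mem_leftAnnihilator_singleton] at hy ⊢
    rw [pow_succ, ← mul_assoc, hy, zero_mul])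
  refine ⟨n + 1, by omega, fun y hy => ?_⟩
  have h := hn (n + 1 + n) (by omega)
  rw [← mem_leftAnnihilator_singleton, ← h, mem_leftAnnihilator_singleton]
  rwa [show n + 1 + n + 1 = n + 1 + (n + 1) by omega, pow_add]

/-- The left ideal of all elements annihilated by `x` from the right. -/
def annIdeal (x : R) : Submodule R R := LinearMap.ker (LinearMap.toSpanSingleton R R x)

theorem mem_annIdeal {x y : R} : y ∈ annIdeal x ↔ y * x = 0 := Iff.rfl

/-- If `Rc ∩ K = 0`, the sum of the left ideals `K c^n` is direct. By the Goldie condition one of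
them vanishes, and then `K = 0` since right multiplication by `c` is injective. -/
theorem isEssentialIdeal_span_singleton (hR : IsLeftGoldie R) {c : R}
    (hc : ∀ y, y * c = 0 → y = 0) :
    IsEssentialIdeal (LinearMap.range (LinearMap.toSpanSingleton R R c)) := by
  intro K hK
  have hpow : ∀ n : ℕ, ∀ y, y * c ^ n = 0 → y = 0 := by
    intro n
    induction n with
    | zero => simp
    | succ n ih => exact fun y hy => ih y (hc _ (by rwa [mul_assoc, ← pow_succ]))
  have key : ∀ (N : ℕ) (k : ℕ → R), (∀ i, k i ∈ K) →
      ∑ i ∈ Finset.range N, k i * c ^ i = 0 → ∀ i < N, k i = 0 := by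
    intro N
    induction N with
    | zero => intro _ _ _ i hi; omega
    | succ N ih =>
      intro k hk hsum
      have hs : ∑ i ∈ Finset.range N, k (i + 1) * c ^ (i + 1) =
          (∑ i ∈ Finset.range N, k (i + 1) * c ^ i) * c := by
        rw [Finset.sum_mul]
        exact Finset.sum_congr rfl fun i _ => by rw [mul_assoc, ← pow_succ]
      rw [Finset.sum_range_succ', hs, pow_zero, mul_one] at hsum
      have h0 : k 0 = 0 := by
        have : k 0 ∈ LinearMap.range (LinearMap.toSpanSingleton R R c) ⊓ K :=
          ⟨⟨-∑ i ∈ Finset.range N, k (i + 1) * c ^ i, by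
            rw [LinearMap.toSpanSingleton_apply, smul_eq_mul, neg_mul]
            exact neg_eq_of_add_eq_zero_right hsum⟩, hk 0⟩
        rwa [hK] at this
      rw [h0, add_zero] at hsum
      have := ih (fun i => k (i + 1)) (fun i => hk _) (hc _ hsum)
      intro i hi
      cases i with
      | zero => exact h0
      | succ i => exact this i (by omega)
  obtain ⟨n, hn⟩ := hR.1 (fun n => K.map (LinearMap.toSpanSingleton R R (c ^ n)))
    (iSupIndep_nat_of_sum fun N v hv hsum i hi => by
      choose k hk hkv using hv
      have hkv' : ∀ i, v i = k i * c ^ i := fun i => (hkv i).symm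
      simp only [hkv'] at hsum ⊢
      rw [key N k hk hsum i hi, zero_mul])
  refine (Submodule.eq_bot_iff _).2 fun y hy => hpow n y ?_
  have : y * c ^ n ∈ K.map (LinearMap.toSpanSingleton R R (c ^ n)) := ⟨y, hy, rfl⟩
  rwa [hn] at this

/-- The left ideal `Rx` is nil. Otherwise some power `w ≠ 0` of some `rx` has the same left
annihilator as `w²`. As `Rc` is essential, there is `z` with `zw ≠ 0` and either `wr = 0` or `zwr ∈
Rc`. In both cases `zwrx = 0` because `cx = 0`, so `zw² = 0` and then `zw = 0`, a contradiction. -/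
theorem eq_zero_of_mul_eq_zero (hp : IsPrimeRing R) (hR : IsLeftGoldie R) {c : R}
    (hc : ∀ y, y * c = 0 → y = 0) {x : R} (hx : c * x = 0) : x = 0 := by
  have hess := isEssentialIdeal_span_singleton hR hc
  have hspan : LinearMap.range (LinearMap.toSpanSingleton R R x) = ⊥ := by
    refine eq_bot_of_isNilpotent hp hR _ ?_
    rintro _ ⟨r, rfl⟩
    rw [LinearMap.toSpanSingleton_apply, smul_eq_mul]
    obtain ⟨m, hm, hann⟩ := exists_pow_leftAnnihilator hR (r * x)
    refine ⟨m, ?_⟩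
    by_contra hne
    set w := (r * x) ^ m with hw
    obtain ⟨z, hz, hz'⟩ : ∃ z, z * w ≠ 0 ∧ z * w * (r * x) = 0 := by
      by_cases h0 : w * r = 0
      · exact ⟨1, by simpa using hne, by rw [one_mul, ← mul_assoc, h0, zero_mul]⟩
      · have hK : LinearMap.range (LinearMap.toSpanSingleton R R c) ⊓
            LinearMap.range (LinearMap.toSpanSingleton R R (w * r)) ≠ ⊥ := fun h => by
          have := hess _ h
          have hmem : w * r ∈ LinearMap.range (LinearMap.toSpanSingleton R R (w * r)) :=
            ⟨1, by simp⟩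
          rw [this] at hmem
          exact h0 hmem
        obtain ⟨_, ⟨⟨y, hy⟩, ⟨z, rfl⟩⟩, hne'⟩ := (Submodule.ne_bot_iff _).1 hK
        rw [LinearMap.toSpanSingleton_apply, LinearMap.toSpanSingleton_apply, smul_eq_mul,
          smul_eq_mul] at hy
        rw [LinearMap.toSpanSingleton_apply, smul_eq_mul] at hne'
        refine ⟨z, fun h => hne' (by rw [← mul_assoc, h, zero_mul]), ?_⟩
        rw [mul_assoc, ← mul_assoc w, ← mul_assoc, ← hy, mul_assoc, hx, mul_zero]
    refine hz (hann z ?_)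
    obtain ⟨m', rfl⟩ : ∃ m', m = m' + 1 := ⟨m - 1, by omega⟩
    rw [← mul_assoc]
    nth_rw 2 [hw]
    rw [pow_succ', ← mul_assoc, hz', zero_mul]
  have hmem : x ∈ LinearMap.range (LinearMap.toSpanSingleton R R x) := ⟨1, by simp⟩
  rw [hspan] at hmem
  exact hmem

/-- Every essential left ideal of a prime left Goldie ring contains a regular element. -/
theorem exists_isRegular_mem (hp : IsPrimeRing R) (hR : IsLeftGoldie R) (L : Submodule R R)
    (hL : IsEssentialIdeal L) : ∃ c ∈ L, IsRegular c := by
  classical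
  -- A nonzero left ideal is not nil, so it contains a nonzero `a` such that `a` and `a²` have the
  -- same left annihilator.
  have hstep : ∀ N : Submodule R R, ∃ a ∈ N, (∀ y, y * (a * a) = 0 → y * a = 0) ∧
      (a = 0 → N = ⊥) := by
    intro N
    by_cases hN : N = ⊥
    · exact ⟨0, N.zero_mem, by simp, fun _ => hN⟩
    · obtain ⟨x, hx, hnil⟩ : ∃ x ∈ N, ¬ IsNilpotent x := by
        by_contra! h
        exact hN (eq_bot_of_isNilpotent hp hR N h)
      obtain ⟨m, hm, hann⟩ := exists_pow_leftAnnihilator hR x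
      obtain ⟨m', rfl⟩ : ∃ m', m = m' + 1 := ⟨m - 1, by omega⟩
      refine ⟨x ^ (m' + 1), ?_, hann, fun h => (hnil ⟨_, h⟩).elim⟩
      rw [pow_succ]
      exact N.smul_mem _ hx
  choose f hfN hfann hf0 using hstep
  -- With `a_n` chosen in `I_n` and `I_{n+1} = I_n ∩ ann(a_n)`, one has `a_j a_i = 0` for `i < j`.
  -- Multiplying a relation on the right by its first `a_i` isolates its first term, so the sum of
  -- the `R a_n` is direct and some `a_n`, hence `I_n`, is zero.
  let I : ℕ → Submodule R R := fun n => (fun N => N ⊓ annIdeal (f N))^[n] L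
  have hI : ∀ n, I (n + 1) = I n ⊓ annIdeal (f (I n)) := fun n => by
    simp only [I, Function.iterate_succ_apply']
  have hmono : Antitone I := antitone_nat_of_succ_le fun n => by rw [hI]; exact inf_le_left
  let a : ℕ → R := fun n => f (I n)
  have haI : ∀ n, a n ∈ I n := fun n => hfN _
  have hmul : ∀ i j, i < j → a j * a i = 0 := fun i j hij => by
    have h1 := hmono (Nat.succ_le_of_lt hij) (haI j)
    rw [Nat.succ_eq_add_one, hI] at h1
    exact h1.2
  have key : ∀ (N m : ℕ) (r : ℕ → R), ∑ i ∈ Finset.range N, r i * a (m + i) = 0 →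
      ∀ i < N, r i * a (m + i) = 0 := by
    intro N
    induction N with
    | zero => intro _ _ _ i hi; omega
    | succ N ih =>
      intro m r hsum
      rw [Finset.sum_range_succ'] at hsum
      have h0 : r 0 * a (m + 0) = 0 := by
        refine hfann _ _ ?_
        have := congrArg (fun z => z * a (m + 0)) hsum
        simp only [add_mul, zero_mul, Finset.sum_mul] at this
        rw [Finset.sum_eq_zero, zero_add] at this
        · rw [← mul_assoc]; exact this
        · intro i _
          rw [mul_assoc, hmul _ _ (by omega), mul_zero]
      rw [h0, add_zero] at hsum
      have := ih (m + 1) (fun i => r (i + 1)) (by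
        rw [← hsum]
        exact Finset.sum_congr rfl fun i _ => by rw [add_right_comm, add_assoc])
      intro i hi
      cases i with
      | zero => exact h0
      | succ i =>
        have := this i (by omega)
        rwa [add_right_comm, add_assoc] at this
  obtain ⟨n, hn⟩ := hR.1 (fun n => LinearMap.range (LinearMap.toSpanSingleton R R (a n)))
    (iSupIndep_nat_of_sum fun N v hv hsum i hi => by
      choose r hr using hv
      have hr' : ∀ i, v i = r i * a (0 + i) := fun i => by rw [zero_add]; exact (hr i).symm
      simp only [hr'] at hsum ⊢
      exact key N 0 r hsum i hi)
  have han : a n = 0 := by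
    have hmem : a n ∈ LinearMap.range (LinearMap.toSpanSingleton R R (a n)) := ⟨1, by simp⟩
    rw [hn] at hmem
    exact hmem
  have hIn : I n = ⊥ := hf0 _ han
  let T : ℕ → Submodule R R := fun m => ⨅ i ∈ Finset.range m, annIdeal (a i)
  have hIT : ∀ m, I m = L ⊓ T m := by
    intro m
    induction m with
    | zero => simp [I, T]
    | succ m ih =>
      rw [hI, ih, inf_assoc]
      congr 1
      simp only [T, Finset.range_add_one, Finset.iInf_insert]
      rw [inf_comm, ← ih]
  -- Essentiality of `L` makes the intersection of the annihilators zero. Since the sum of the `R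
  -- a_i` is direct, the element `∑ a_i` then has zero left annihilator.
  have hT : T n = ⊥ := hL _ (by rw [← hIT, hIn])
  have hleft : ∀ y, y * (∑ i ∈ Finset.range n, a i) = 0 → y = 0 := by
    intro y hy
    rw [Finset.mul_sum] at hy
    have h := key n 0 (fun _ => y) (by simpa using hy)
    have : y ∈ T n := by
      simp only [T, Submodule.mem_iInf, Finset.mem_range]
      exact fun i hi => by simpa [mem_annIdeal] using h i hi
    rwa [hT] at this
  refine ⟨∑ i ∈ Finset.range n, a i, sum_mem fun i _ => hmono (Nat.zero_le i) (haI i),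
    isRegular_iff.2 ⟨isLeftRegular_of_non_zero_divisor _ fun x hx =>
      eq_zero_of_mul_eq_zero hp hR hleft hx, isRightRegular_of_non_zero_divisor _ hleft⟩⟩

end GoldieTheorem

/-! ### The Goldie quotient ring is simple artinian -/

section QuotientRing

variable {k A Q : Type u} [Field k] [Ring A] [Algebra k A] [Ring Q] [Algebra k Q]
  {ι : A →ₐ[k] Q}

theorem IsGoldieQuotientRing.exists_left_mul (hQ : IsGoldieQuotientRing ι) (q : Q) {s : A}
    (hs : IsRegular s) :
    ∃ t a, IsRegular t ∧ ι t * q = ι a * ι s := by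
  obtain ⟨u, hu⟩ := hQ.isUnit s hs
  obtain ⟨t, a, ht, h⟩ := hQ.exists_left (q * ↑u⁻¹)
  refine ⟨t, a, ht, ?_⟩
  rw [← h, ← hu, mul_assoc, mul_assoc, Units.inv_mul, mul_one]

theorem IsGoldieQuotientRing.mul_eq_zero_left (hQ : IsGoldieQuotientRing ι) {s : A}
    (hs : IsRegular s) {q : Q}
    (h : ι s * q = 0) : q = 0 := (hQ.isUnit s hs).mul_right_eq_zero.1 h

theorem IsGoldieQuotientRing.mul_eq_zero_right (hQ : IsGoldieQuotientRing ι) {s : A}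
    (hs : IsRegular s) {q : Q}
    (h : q * ι s = 0) : q = 0 := (hQ.isUnit s hs).mul_left_eq_zero.1 h

/-- Common left denominators bring sums and multiples of elements of `K` to the form `s⁻¹a` with `a
∈ K`. -/
theorem exists_mul_mem_of_mem_span (hQ : IsGoldieQuotientRing ι) (K : Submodule A A) {q : Q}
    (hq : q ∈ Submodule.span Q (ι '' K)) : ∃ s, IsRegular s ∧ ∃ a ∈ K, ι s * q = ι a := by
  induction hq using Submodule.span_induction with
  | mem q hq =>
    obtain ⟨a, ha, rfl⟩ := hq
    exact ⟨1, isRegular_one, a, ha, by simp⟩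
  | zero => exact ⟨1, isRegular_one, 0, K.zero_mem, by simp⟩
  | add q₁ q₂ _ _ h₁ h₂ =>
    obtain ⟨s, hs, a, ha, h1⟩ := h₁
    obtain ⟨t, ht, b, hb, h2⟩ := h₂
    obtain ⟨u, v, hu, h3⟩ := hQ.exists_left_mul (ι s) ht
    refine ⟨u * s, hu.mul hs, u * a + v * b, K.add_mem (K.smul_mem u ha) (K.smul_mem v hb), ?_⟩
    rw [map_mul, map_add, map_mul, map_mul, mul_add, mul_assoc, h1, h3, mul_assoc, h2]
  | smul q q₁ _ h₁ =>
    obtain ⟨s, hs, a, ha, h1⟩ := h₁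
    obtain ⟨u, v, hu, h3⟩ := hQ.exists_left_mul q hs
    refine ⟨u, hu, v * a, K.smul_mem v ha, ?_⟩
    rw [smul_eq_mul, ← mul_assoc, h3, mul_assoc, h1, map_mul]

theorem isPrimeRing_quotient (hQ : IsGoldieQuotientRing ι) (hp : IsPrimeRing A) :
    IsPrimeRing Q := by
  obtain ⟨_, hp⟩ := hp
  refine ⟨hQ.injective.nontrivial, fun q₁ q₂ h => ?_⟩
  obtain ⟨s, a, hs, h1⟩ := hQ.exists_right q₁
  obtain ⟨t, b, ht, h2⟩ := hQ.exists_left q₂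
  refine (hp a b fun r => ?_).imp (fun h => ?_) fun h => ?_
  · apply hQ.injective
    rw [map_mul, map_mul, map_zero, ← h1, ← h2, mul_assoc, mul_assoc, ← mul_assoc, ← mul_assoc,
      ← mul_assoc, mul_assoc q₁, mul_assoc q₁, h]
  · exact hQ.mul_eq_zero_right hs (by rw [h1, h, map_zero])
  · exact hQ.mul_eq_zero_left ht (by rw [h2, h, map_zero])

/-- Take `K` maximal among the left ideals meeting `J` in zero. By maximality the elements of `A`
lying in `J ⊕ K` form an essential left ideal of `A`. It contains a regular element, which is a unit
of `Q`. -/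
theorem exists_isCompl_quotient (hQ : IsGoldieQuotientRing ι) (hp : IsPrimeRing A)
    (hA : IsLeftGoldie A)
    (J : Submodule Q Q) : ∃ K, IsCompl J K := by
  obtain ⟨K, hK⟩ : ∃ K : Submodule Q Q, Maximal (Disjoint J) K := by
    refine zorn_le₀ {K | Disjoint J K} fun c hc hchain => ?_
    refine ⟨sSup c, ?_, fun K hK => le_sSup hK⟩
    exact (hchain.directedOn.disjoint_sSup_right).2 fun K hK => hc hK
  refine ⟨K, hK.prop, codisjoint_iff.2 ?_⟩
  let L : Submodule A A :=
    { carrier := {a | ι a ∈ J ⊔ K}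
      add_mem' := fun ha hb => by
        rw [Set.mem_ofPred_eq, map_add]; exact add_mem ha hb
      zero_mem' := by rw [Set.mem_ofPred_eq, map_zero]; exact zero_mem _
      smul_mem' := fun r a ha => by
        rw [Set.mem_ofPred_eq, smul_eq_mul, map_mul]; exact (J ⊔ K).smul_mem (ι r) ha }
  obtain ⟨c, hc, hreg⟩ := exists_isRegular_mem hp hA L (fun M hM => by
    have hd : Disjoint (J ⊔ K) (Submodule.span Q (ι '' M)) := by
      rw [Submodule.disjoint_def]
      intro q hq hq'
      obtain ⟨s, hs, a, ha, h⟩ := exists_mul_mem_of_mem_span hQ M hq'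
      have : a ∈ L ⊓ M := ⟨by
        change ι a ∈ J ⊔ K
        rw [← h]; exact (J ⊔ K).smul_mem _ hq, ha⟩
      rw [hM, Submodule.mem_bot] at this
      exact hQ.mul_eq_zero_left hs (by rw [h, this, map_zero])
    have hle := hK.le_of_ge (y := K ⊔ Submodule.span Q (ι '' M))
      (hK.prop.disjoint_sup_right_of_disjoint_sup_left hd) le_sup_left
    refine (Submodule.eq_bot_iff _).2 fun a ha => hQ.injective ?_
    rw [map_zero]
    have hmem : ι a ∈ Submodule.span Q (ι '' M) := Submodule.subset_span ⟨a, ha, rfl⟩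
    exact Submodule.disjoint_def.1 hd _ (le_sup_right (a := J) (hle (le_sup_right (a := K) hmem)))
      hmem)
  exact Ideal.eq_top_of_isUnit_mem _ hc (hQ.isUnit c hreg)

/-- A complement `K` of a nonzero two-sided ideal `I` satisfies `IK ⊆ I ∩ K = 0`, so `K = 0` by
primeness. Complements of all left ideals make `Q` semisimple, hence artinian. -/
theorem isSimpleArtinian_quotient (hQ : IsGoldieQuotientRing ι) (hA : IsGoldiePrime A) :
    IsSimpleArtinian Q := by
  have hcompl := exists_isCompl_quotient hQ hA.1 hA.2.1
  have hprime := isPrimeRing_quotient hQ hA.1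
  refine ⟨isSimpleRing_iff_isTwoSided_imp.2 ⟨hprime.1, fun I hI => ?_⟩, ?_⟩
  · by_cases h : I = ⊥
    · exact Or.inl h
    right
    obtain ⟨x, hx, hx0⟩ := I.ne_bot_iff.1 h
    obtain ⟨K, hK⟩ := hcompl I
    have hKbot : K = ⊥ := (Submodule.eq_bot_iff _).2 fun y hy => by
      refine (hprime.2 x y fun r => ?_).resolve_left hx0
      refine Submodule.disjoint_def.1 hK.disjoint _ ?_ (K.smul_mem (x * r) hy)
      exact I.mul_mem_right _ (I.mul_mem_right _ hx)
    rw [← hK.sup_eq_top, hKbot, sup_bot_eq]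
  · have : ComplementedLattice (Submodule Q Q) := ⟨hcompl⟩
    have : IsSemisimpleRing Q := { }
    infer_instance

end QuotientRing

/-! ### Free resolutions given by row-finite matrices -/

section FreeResolutions

variable {B : Type u} [Ring B]

theorem moduleCat_exact {M₁ M₂ M₃ : Type u} [AddCommGroup M₁] [AddCommGroup M₂] [AddCommGroup M₃]
    [Module B M₁] [Module B M₂] [Module B M₃] {f : M₁ →ₗ[B] M₂} {g : M₂ →ₗ[B] M₃}
    (h : Function.Exact f g) (w : ModuleCat.ofHom f ≫ ModuleCat.ofHom g = 0) :
    (ShortComplex.mk (ModuleCat.ofHom f) (ModuleCat.ofHom g) w).Exact :=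
  (ShortComplex.ShortExact.moduleCat_exact_iff_function_exact _).2 h

/-- A projective resolution given by modules and linear maps. -/
def ProjRes.ofModules {Y : ModuleCat.{u} B} (P : ℕ → Type u) [∀ i, AddCommGroup (P i)]
    [∀ i, Module B (P i)] [∀ i, Module.Projective B (P i)] (d : ∀ i, P (i + 1) →ₗ[B] P i)
    (aug : P 0 →ₗ[B] Y) (hsurj : Function.Surjective aug) (h0 : Function.Exact (d 0) aug)
    (hd : ∀ i, Function.Exact (d (i + 1)) (d i)) : ProjRes Y where
  P i := ModuleCat.of B (P i)
  d i := ModuleCat.ofHom (d i)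
  aug := ModuleCat.ofHom aug
  projective i := (IsProjective.iff_projective (P i)).1 inferInstance
  epi_aug := (ModuleCat.epi_iff_surjective _).2 hsurj
  d_aug := ModuleCat.hom_ext h0.linearMap_comp_eq_zero
  d_d i := ModuleCat.hom_ext (hd i).linearMap_comp_eq_zero
  exact_zero := moduleCat_exact h0 _
  exact_succ i := moduleCat_exact (hd i) _

variable {X : ℕ → Type u}

/-- The linear map between free modules given by a row-finite matrix. -/
abbrev rowMap (M : ∀ i, X (i + 1) → X i →₀ B) (i : ℕ) : (X (i + 1) →₀ B) →ₗ[B] (X i →₀ B) :=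
  Finsupp.linearCombination B (M i)

section Columns

variable {N : Type*} [AddCommGroup N] [Module B N]

/-- The differential of the complex of homomorphisms to `N`. -/
def cob (M : ∀ i, X (i + 1) → X i →₀ B) (i : ℕ) (v : X i → N) : X (i + 1) → N :=
  fun x => Finsupp.linearCombination B v (M i x)

/-- Coboundaries of the complex of homomorphisms to `N`. -/
def IsCobdry (M : ∀ i, X (i + 1) → X i →₀ B) : ∀ {i : ℕ}, (X i → N) → Prop
  | 0, v => v = 0
  | p + 1, v => ∃ w, cob M p w = v

theorem linearCombination_comp_rowMap (M : ∀ i, X (i + 1) → X i →₀ B) (i : ℕ) (v : X i → N) :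
    Finsupp.linearCombination B v ∘ₗ rowMap M i = Finsupp.linearCombination B (cob M i v) :=
  Finsupp.lhom_ext' fun x => LinearMap.ext_ring (by simp [cob])

theorem linearCombination_injective {X : Type*} {v w : X → N}
    (h : Finsupp.linearCombination B v = Finsupp.linearCombination B w) : v = w :=
  funext fun x => by simpa using LinearMap.congr_fun h (Finsupp.single x 1)

theorem exists_eq_linearCombination {X : Type*} (f : (X →₀ B) →ₗ[B] N) :
    ∃ v, f = Finsupp.linearCombination B v :=
  ⟨fun x => f (Finsupp.single x 1), Finsupp.lhom_ext' fun x => LinearMap.ext_ring (by simp)⟩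

theorem cob_zero (M : ∀ i, X (i + 1) → X i →₀ B) (i : ℕ) : cob M i (0 : X i → N) = 0 := by
  funext x
  simp [cob]

theorem cob_add (M : ∀ i, X (i + 1) → X i →₀ B) (i : ℕ) (v w : X i → N) :
    cob M i (v + w) = cob M i v + cob M i w := by
  funext x
  simp [cob, Finsupp.linearCombination_apply, Finsupp.sum_add]

theorem cob_sum (M : ∀ i, X (i + 1) → X i →₀ B) (i : ℕ) {J : Type*} (s : Finset J)
    (v : J → X i → N) : cob M i (∑ j ∈ s, v j) = ∑ j ∈ s, cob M i (v j) := by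
  classical
  induction s using Finset.induction_on with
  | empty => simp [cob_zero]
  | insert j s hj ih => rw [Finset.sum_insert hj, Finset.sum_insert hj, cob_add, ih]

end Columns

/-- A free resolution of a module, given by row-finite matrices. -/
structure FreeRes (Y : ModuleCat.{u} B) where
  X : ℕ → Type u
  M : ∀ i, X (i + 1) → X i →₀ B
  aug : (X 0 →₀ B) →ₗ[B] Y
  surjective : Function.Surjective aug
  exact_zero : Function.Exact (rowMap M 0) aug
  exact_succ : ∀ i, Function.Exact (rowMap M (i + 1)) (rowMap M i)

namespace FreeRes

variable {Y : ModuleCat.{u} B} (R : FreeRes Y)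

/-- The projective resolution given by a free resolution. -/
def toProjRes : ProjRes Y :=
  ProjRes.ofModules (fun i => R.X i →₀ B) (rowMap R.M) R.aug R.surjective R.exact_zero R.exact_succ

/-- The homomorphism given by a column. -/
def colHom {N : ModuleCat.{u} B} {i : ℕ} (v : R.X i → N) : R.toProjRes.P i ⟶ N :=
  ModuleCat.ofHom (Finsupp.linearCombination B v)

variable {R}

theorem d_colHom {N : ModuleCat.{u} B} {i : ℕ} (v : R.X i → N) :
    R.toProjRes.d i ≫ R.colHom v = R.colHom (cob R.M i v) :=
  ModuleCat.hom_ext (linearCombination_comp_rowMap R.M i v)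

theorem colHom_zero {N : ModuleCat.{u} B} {i : ℕ} : R.colHom (0 : R.X i → N) = 0 :=
  ModuleCat.hom_ext (Finsupp.linearCombination_zero _ _ _)

theorem colHom_injective {N : ModuleCat.{u} B} {i : ℕ} {v w : R.X i → N}
    (h : R.colHom v = R.colHom w) : v = w :=
  linearCombination_injective (congrArg ModuleCat.Hom.hom h)

theorem colHom_surjective {N : ModuleCat.{u} B} {i : ℕ} (f : R.toProjRes.P i ⟶ N) :
    ∃ v, f = R.colHom v := by
  obtain ⟨v, hv⟩ := exists_eq_linearCombination (X := R.X i) f.hom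
  exact ⟨v, ModuleCat.hom_ext hv⟩

theorem isCob_colHom_iff {N : ModuleCat.{u} B} {i : ℕ} (v : R.X i → N) :
    R.toProjRes.IsCob (R.colHom v) ↔ IsCobdry R.M v := by
  cases i with
  | zero =>
    exact ⟨fun h => colHom_injective (Eq.trans h colHom_zero.symm), fun h => by
      rw [show v = 0 from h]; exact colHom_zero⟩
  | succ p =>
    constructor
    · rintro ⟨g, hg⟩
      obtain ⟨w, rfl⟩ := colHom_surjective g
      exact ⟨w, colHom_injective ((d_colHom w).symm.trans hg)⟩
    · rintro ⟨w, rfl⟩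
      exact ⟨R.colHom w, d_colHom w⟩

variable (R) in
/-- The class in `Ext` of a column that is a cocycle. -/
def ext {N : ModuleCat.{u} B} {i : ℕ} (v : R.X i → N) (hv : cob R.M i v = 0) :
    Abelian.Ext Y N i :=
  R.toProjRes.ext (R.colHom v) (by rw [d_colHom, hv, colHom_zero])

theorem ext_add {N : ModuleCat.{u} B} {i : ℕ} (v w : R.X i → N) (hv : cob R.M i v = 0)
    (hw : cob R.M i w = 0) :
    R.ext (v + w) (by rw [cob_add, hv, hw, add_zero]) = R.ext v hv + R.ext w hw := by
  refine Eq.trans ?_ (R.toProjRes.ext_add _ _ _ _)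
  have h : R.colHom (v + w) = R.colHom v + R.colHom w :=
    ModuleCat.hom_ext (show Finsupp.linearCombination B (v + w) =
        Finsupp.linearCombination B v + Finsupp.linearCombination B w from
      Finsupp.lhom_ext' fun x => LinearMap.ext_ring (by simp))
  unfold ext
  congr 1

theorem ext_surjective {N : ModuleCat.{u} B} {i : ℕ} (α : Abelian.Ext Y N i) :
    ∃ v hv, R.ext v hv = α := by
  obtain ⟨f, hf, h⟩ := R.toProjRes.ext_surjective α
  obtain ⟨v, rfl⟩ := colHom_surjective f
  rw [d_colHom] at hf
  exact ⟨v, colHom_injective (hf.trans colHom_zero.symm), h⟩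

theorem ext_eq_zero_iff {N : ModuleCat.{u} B} {i : ℕ} (v : R.X i → N) (hv : cob R.M i v = 0) :
    R.ext v hv = 0 ↔ IsCobdry R.M v :=
  (R.toProjRes.ext_eq_zero_iff _ _).trans (isCob_colHom_iff v)

theorem cob_comp (M : ∀ i, X (i + 1) → X i →₀ B) {N N' : ModuleCat.{u} B} {i : ℕ} (v : X i → N)
    (g : N ⟶ N') : cob M i (fun x => g.hom (v x)) = fun x => g.hom (cob M i v x) := by
  funext x
  rw [cob, cob, Finsupp.linearCombination_apply, Finsupp.linearCombination_apply, map_finsuppSum]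
  simp only [map_smul]

theorem ext_comp {N N' : ModuleCat.{u} B} {i : ℕ} (v : R.X i → N) (hv : cob R.M i v = 0)
    (g : N ⟶ N') : (R.ext v hv).comp (Abelian.Ext.mk₀ g) (add_zero i) =
      R.ext (fun x => g.hom (v x)) (by
        rw [cob_comp, hv]; exact funext fun _ => map_zero g.hom) := by
  refine (R.toProjRes.ext_comp _ _ g).trans ?_
  have h : R.colHom v ≫ g = R.colHom (fun x => g.hom (v x)) :=
    ModuleCat.hom_ext (show g.hom ∘ₗ Finsupp.linearCombination B v =
        Finsupp.linearCombination B (fun x => g.hom (v x)) from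
      Finsupp.lhom_ext' fun x => LinearMap.ext_ring (by simp))
  unfold ext
  congr 1

end FreeRes

end FreeResolutions

/-! ### Tensoring a resolution of bimodules with a module -/

section Contraction

variable {k S : Type u} [Field k] [Ring S] [Algebra k S]

/-- The element `1 ⊗ y` of the enveloping algebra, for `y` in the opposite algebra. -/
abbrev rt (y : Sᵐᵒᵖ) : Env k S := (1 : S) ⊗ₜ[k] y

theorem bimod_smul (a b : S) (s : bimod k S) :
    (a ⊗ₜ[k] MulOpposite.op b : Env k S) • s = (a * (show S from s) * b : S) := by
  change a • ((show S from s) * b) = _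
  rw [smul_eq_mul, mul_assoc]

theorem bimod_smul' (a : S) (b : Sᵐᵒᵖ) (s : bimod k S) :
    (a ⊗ₜ[k] b : Env k S) • s = (a * (show S from s) * b.unop : S) :=
  bimod_smul a b.unop s

section

variable {X X' X'' : Type u} {F F' : Type u} [AddCommMonoid F] [Module k F] [Module (Env k S) F]
  [IsScalarTower k (Env k S) F] [AddCommMonoid F'] [Module k F'] [Module (Env k S) F']

variable (S) in
/-- Right `S`-linear maps, on modules over the enveloping algebra. -/
def IsRightLinear (g : F →ₗ[k] F') : Prop :=
  ∀ (y : Sᵐᵒᵖ) (f : F), g (rt (k := k) y • f) = rt (k := k) y • g f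

/-- The right `S`-linear map on a free module over the enveloping algebra with given values. -/
def rightLift (h : X → S →ₗ[k] F) : (X →₀ Env k S) →ₗ[k] F :=
  Finsupp.lsum k fun x => TensorProduct.lift <| LinearMap.mk₂ k
    (fun s y => rt (k := k) y • h x s)
    (fun s s' y => by rw [map_add, smul_add])
    (fun c s y => by rw [map_smul, smul_comm])
    (fun s y y' => by rw [rt, TensorProduct.tmul_add, add_smul])
    (fun c s y => by rw [rt, TensorProduct.tmul_smul, smul_assoc])

theorem rightLift_single (h : X → S →ₗ[k] F) (x : X) (s : S) (y : Sᵐᵒᵖ) :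
    rightLift h (Finsupp.single x (s ⊗ₜ[k] y)) = rt (k := k) y • h x s := by
  simp [rightLift]

theorem env_finsupp_induction {P : (X →₀ Env k S) → Prop} (f : X →₀ Env k S) (h0 : P 0)
    (hadd : ∀ f g, P f → P g → P (f + g)) (h : ∀ x s y, P (Finsupp.single x (s ⊗ₜ[k] y))) :
    P f := by
  induction f using Finsupp.induction_linear with
  | zero => exact h0
  | add f g hf hg => exact hadd f g hf hg
  | single x b =>
    induction b using TensorProduct.induction_on with
    | zero => rw [Finsupp.single_zero]; exact h0
    | tmul s y => exact h x s y
    | add b c hb hc => rw [Finsupp.single_add]; exact hadd _ _ hb hc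

theorem single_tmul (x : X) (s : S) (y : Sᵐᵒᵖ) :
    Finsupp.single x (s ⊗ₜ[k] y : Env k S) =
      rt (k := k) y • Finsupp.single x (s ⊗ₜ[k] (1 : Sᵐᵒᵖ)) := by
  rw [Finsupp.smul_single, smul_eq_mul, Algebra.TensorProduct.tmul_mul_tmul, one_mul, mul_one]

theorem rt_smul_smul {F : Type u} [AddCommMonoid F] [Module (Env k S) F] (y z : Sᵐᵒᵖ) (f : F) :
    rt (k := k) y • rt (k := k) z • f = rt (k := k) (y * z) • f := by
  rw [← mul_smul, rt, rt, Algebra.TensorProduct.tmul_mul_tmul, one_mul]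

theorem isRightLinear_rightLift (h : X → S →ₗ[k] F) : IsRightLinear S (rightLift h) := by
  intro y f
  induction f using env_finsupp_induction with
  | h0 => simp
  | hadd f g hf hg => rw [smul_add, map_add, map_add, smul_add, hf, hg]
  | h x s z =>
    rw [rightLift_single, Finsupp.smul_single, smul_eq_mul,
      Algebra.TensorProduct.tmul_mul_tmul, one_mul, rightLift_single, rt_smul_smul]

theorem IsRightLinear.ext {g g' : (X →₀ Env k S) →ₗ[k] F} (hg : IsRightLinear S g)
    (hg' : IsRightLinear S g')
    (h : ∀ x s, g (Finsupp.single x (s ⊗ₜ[k] 1)) = g' (Finsupp.single x (s ⊗ₜ[k] 1))) :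
    g = g' := by
  refine LinearMap.ext fun f => ?_
  induction f using env_finsupp_induction with
  | h0 => simp
  | hadd f f' hf hf' => rw [map_add, map_add, hf, hf']
  | h x s y => rw [single_tmul, hg, hg', h]

/-- The modules here only carry the structure of additive monoids and of vector spaces over `k`, so
differences are written with the scalar `-1`. -/
theorem add_neg_one_smul {F : Type u} [AddCommMonoid F] [Module k F] (x : F) :
    x + (-1 : k) • x = 0 := by
  conv_lhs => rw [← one_smul k x, smul_smul, ← add_smul]
  simp

theorem exists_linear_section {F F' : Type u} [AddCommMonoid F] [Module k F] [AddCommMonoid F']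
    [Module k F'] (p : F →ₗ[k] F') :
    ∃ σ : F' →ₗ[k] F, ∀ f ∈ LinearMap.range p, p (σ f) = f := by
  let _ : AddCommGroup F := Module.addCommMonoidToAddCommGroup k
  let _ : AddCommGroup F' := Module.addCommMonoidToAddCommGroup k
  obtain ⟨σ, hσ⟩ := p.rangeRestrict.exists_rightInverse_of_surjective
    (LinearMap.range_eq_top.2 p.surjective_rangeRestrict)
  obtain ⟨τ, hτ⟩ := σ.exists_extend
  refine ⟨τ, fun f hf => ?_⟩
  have h1 : τ f = σ ⟨f, hf⟩ := LinearMap.congr_fun hτ ⟨f, hf⟩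
  have h2 := LinearMap.congr_fun hσ ⟨f, hf⟩
  rw [h1]
  exact congrArg Subtype.val h2

/-- As a right `S`-module, `X →₀ S ⊗ S°` is induced from the vector space `X →₀ S`. So it is enough
to lift `k`-linearly on the elements `s ⊗ 1`, which is possible over a field. -/
theorem exists_rightLinear_lift (p : (X' →₀ Env k S) →ₗ[k] (X'' →₀ Env k S))
    (hp : IsRightLinear S p) (g : (X →₀ Env k S) →ₗ[k] (X'' →₀ Env k S)) (hg : IsRightLinear S g)
    (hr : ∀ f, ∃ f', p f' = g f) :
    ∃ h : (X →₀ Env k S) →ₗ[k] (X' →₀ Env k S), IsRightLinear S h ∧ ∀ f, p (h f) = g f := by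
  obtain ⟨σ, hσ⟩ := exists_linear_section p
  refine ⟨rightLift fun x => σ ∘ₗ g ∘ₗ Finsupp.lsingle x ∘ₗ
    (TensorProduct.mk k S Sᵐᵒᵖ).flip 1, isRightLinear_rightLift _, fun f => ?_⟩
  refine LinearMap.congr_fun (f := p ∘ₗ rightLift _) (IsRightLinear.ext ?_ hg fun x s => ?_) f
  · intro y f
    rw [LinearMap.comp_apply, isRightLinear_rightLift, hp]
    rfl
  · rw [LinearMap.comp_apply, rightLift_single, rt, ← Algebra.TensorProduct.one_def, one_smul]
    exact hσ _ (hr _)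

end

/-! ### The functor `- ⊗_S N` on free bimodules -/

section Eval

variable {N : Type u} [AddCommGroup N] [Module k N] (ρ : S →ₐ[k] Module.End k N)

/-- Evaluation at an element of a left module, from the enveloping algebra `S ⊗ S°` to
`S ⊗ N = (S ⊗ S°) ⊗_S N`. -/
def ev : N →ₗ[k] Env k S →ₗ[k] S ⊗[k] N :=
  LinearMap.lTensorHom S ∘ₗ (ρ.toLinearMap ∘ₗ (MulOpposite.opLinearEquiv k).symm.toLinearMap).flip

theorem ev_tmul (n : N) (s : S) (y : Sᵐᵒᵖ) : ev ρ n (s ⊗ₜ[k] y) = s ⊗ₜ[k] ρ y.unop n := by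
  simp [ev]

theorem ev_rt_mul (n : N) (y : Sᵐᵒᵖ) (b : Env k S) : ev ρ n (rt y * b) = ev ρ (ρ y.unop n) b := by
  induction b using TensorProduct.induction_on with
  | zero => simp
  | tmul s z => simp [ev_tmul]
  | add b c hb hc => rw [mul_add, map_add, map_add, hb, hc]

variable {X X' : Type u}

/-- Evaluation on free modules. -/
def evF (n : N) : (X →₀ Env k S) →ₗ[k] (X →₀ S ⊗[k] N) := Finsupp.mapRange.linearMap (ev ρ n)

theorem evF_single (n : N) (x : X) (b : Env k S) :
    evF ρ n (Finsupp.single x b) = Finsupp.single x (ev ρ n b) := by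
  simp [evF]

theorem evF_add (n n' : N) (f : X →₀ Env k S) : evF ρ (n + n') f = evF ρ n f + evF ρ n' f := by
  ext x
  simp [evF]

theorem evF_smul (c : k) (n : N) (f : X →₀ Env k S) : evF ρ (c • n) f = c • evF ρ n f := by
  ext x
  simp [evF]

theorem evF_rt_smul (n : N) (y : Sᵐᵒᵖ) (f : X →₀ Env k S) :
    evF ρ n (rt (k := k) y • f) = evF ρ (ρ y.unop n) f := by
  ext x
  simp [evF, ev_rt_mul]

/-- The element `evF ρ n f` stands for `f ⊗ n` in `F ⊗_S N`, where `F` is the free bimodule on `X`.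
Such elements generate, so identities can be checked on them. -/
theorem tensor_finsupp_induction {P : (X →₀ S ⊗[k] N) → Prop} (f : X →₀ S ⊗[k] N)
    (hadd : ∀ f g, P f → P g → P (f + g)) (h : ∀ n f, P (evF ρ n f)) : P f := by
  have h0 : P 0 := by simpa using h 0 0
  induction f using Finsupp.induction_linear with
  | zero => exact h0
  | add f g hf hg => exact hadd f g hf hg
  | single x b =>
    induction b using TensorProduct.induction_on with
    | zero => rw [Finsupp.single_zero]; exact h0
    | tmul s n =>
      have := h n (Finsupp.single x (s ⊗ₜ[k] 1))
      rwa [evF_single, ev_tmul, MulOpposite.unop_one, map_one, Module.End.one_apply] at this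
    | add b c hb hc => rw [Finsupp.single_add]; exact hadd _ _ hb hc

/-- The map induced on `X →₀ S ⊗ N` by a right `S`-linear map of free bimodules. -/
def tensorMap (h : (X →₀ Env k S) →ₗ[k] (X' →₀ Env k S)) :
    (X →₀ S ⊗[k] N) →ₗ[k] (X' →₀ S ⊗[k] N) :=
  Finsupp.lsum k fun x => TensorProduct.lift <| LinearMap.mk₂ k
    (fun s n => evF ρ n (h (Finsupp.single x (s ⊗ₜ[k] 1))))
    (fun s s' n => by rw [TensorProduct.add_tmul, Finsupp.single_add, map_add, map_add])
    (fun c s n => by rw [← TensorProduct.smul_tmul', ← Finsupp.smul_single, map_smul, map_smul])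
    (fun s n n' => evF_add ρ n n' _)
    (fun c s n => evF_smul ρ c n _)

theorem tensorMap_single (h : (X →₀ Env k S) →ₗ[k] (X' →₀ Env k S)) (x : X) (s : S) (n : N) :
    tensorMap ρ h (Finsupp.single x (s ⊗ₜ[k] n)) =
      evF ρ n (h (Finsupp.single x (s ⊗ₜ[k] 1))) := by
  simp [tensorMap]

/-- Right linearity of `h` is exactly what lets `h ⊗ N` be computed as `f ⊗ n ↦ h f ⊗ n`. -/
theorem tensorMap_evF {h : (X →₀ Env k S) →ₗ[k] (X' →₀ Env k S)} (hh : IsRightLinear S h) (n : N)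
    (f : X →₀ Env k S) : tensorMap ρ h (evF ρ n f) = evF ρ n (h f) := by
  induction f using env_finsupp_induction with
  | h0 => simp
  | hadd f g hf hg => rw [map_add, map_add, hf, hg, map_add, map_add]
  | h x s y =>
    rw [evF_single, ev_tmul, tensorMap_single, single_tmul x s y, hh, evF_rt_smul]

end Eval

/-! ### Splitting of bimodule resolutions and exactness after tensoring -/

section Resolution

variable (R : FreeRes (bimod k S))

/-- The differential of a resolution of bimodules, as a `k`-linear map. -/
def kd (i : ℕ) : (R.X (i + 1) →₀ Env k S) →ₗ[k] (R.X i →₀ Env k S) :=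
  (rowMap R.M i).restrictScalars k

theorem isRightLinear_kd (i : ℕ) : IsRightLinear S (kd R i) := fun _ f =>
    (rowMap R.M i).map_smul _ f

/-- The augmentation of a resolution of bimodules, as a `k`-linear map. -/
def kaug : (R.X 0 →₀ Env k S) →ₗ[k] S where
  toFun := R.aug
  map_add' := R.aug.map_add
  map_smul' c f := by
    rw [← algebraMap_smul (Env k S) c f, map_smul, Algebra.TensorProduct.algebraMap_apply]
    refine (bimod_smul' _ _ _).trans ?_
    rw [MulOpposite.unop_one, mul_one]
    exact (Algebra.smul_def c (show S from R.aug f)).symm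

theorem kaug_rt_smul (y : Sᵐᵒᵖ) (f : R.X 0 →₀ Env k S) :
    kaug R (rt (k := k) y • f) = kaug R f * y.unop := by
  refine (R.aug.map_smul _ f).trans ((bimod_smul' _ _ _).trans ?_)
  rw [one_mul]
  rfl

/-- A right `S`-linear contraction of a resolution of bimodules. -/
structure Contraction where
  e : R.X 0 →₀ Env k S
  kaug_e : kaug R e = 1
  h : ∀ i, (R.X i →₀ Env k S) →ₗ[k] (R.X (i + 1) →₀ Env k S)
  isRightLinear : ∀ i, IsRightLinear S (h i)
  zero : ∀ f, kd R 0 (h 0 f) = f + (-1 : k) • rt (k := k) (MulOpposite.op (kaug R f)) • e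
  succ : ∀ i f, kd R (i + 1) (h (i + 1) f) = f + (-1 : k) • h i (kd R i f)

/-- Forgetting the left action, the resolution is made of free right `S`-modules and ends in `S`,
which is free on `1`. Hence it splits: `h 0` lifts the identity minus `f ↦ e · aug f`, and `h (i +
1)` lifts the identity minus `h i ∘ d`. -/
theorem nonempty_contraction : Nonempty (Contraction R) := by
  obtain ⟨e, he⟩ := R.surjective (1 : S)
  have he : kaug R e = 1 := he
  have hdd : ∀ i f, kd R i (kd R (i + 1) f) = 0 := fun i f =>
    (R.exact_succ i).apply_apply_eq_zero f
  let t : (R.X 0 →₀ Env k S) →ₗ[k] (R.X 0 →₀ Env k S) :=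
    { toFun := fun f => rt (k := k) (MulOpposite.op (kaug R f)) • e
      map_add' := fun f f' => by
        rw [map_add, MulOpposite.op_add, rt, TensorProduct.tmul_add, add_smul]
      map_smul' := fun c f => by
        rw [map_smul, MulOpposite.op_smul, rt, TensorProduct.tmul_smul, smul_assoc]
        rfl }
  have ht : IsRightLinear S t := fun y f => by
    change rt (k := k) (MulOpposite.op (kaug R (rt (k := k) y • f))) • e =
      rt (k := k) y • rt (k := k) (MulOpposite.op (kaug R f)) • e
    rw [kaug_rt_smul, rt_smul_smul, MulOpposite.op_mul, MulOpposite.op_unop]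
  have hlin : ∀ {X : Type u} (g : (X →₀ Env k S) →ₗ[k] (X →₀ Env k S)), IsRightLinear S g →
      IsRightLinear S (LinearMap.id + (-1 : k) • g) := fun g hg y f => by
    simp only [LinearMap.add_apply, LinearMap.smul_apply, LinearMap.id_apply]
    rw [hg, smul_add, smul_comm]
  obtain ⟨h₀, hh₀, hh₀'⟩ := exists_rightLinear_lift (kd R 0) (isRightLinear_kd R 0) _ (hlin t ht)
    fun f => (R.exact_zero _).1 (by
      change kaug R (f + (-1 : k) • rt (k := k) (MulOpposite.op (kaug R f)) • e) = 0
      rw [map_add, map_smul, kaug_rt_smul, he, one_mul, MulOpposite.unop_op, add_neg_one_smul])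
  have hstep : ∀ i (h : (R.X i →₀ Env k S) →ₗ[k] (R.X (i + 1) →₀ Env k S)),
      IsRightLinear S h → (∀ f, kd R i (h (kd R i f)) = kd R i f) →
      ∃ h' : (R.X (i + 1) →₀ Env k S) →ₗ[k] (R.X (i + 1 + 1) →₀ Env k S), IsRightLinear S h' ∧
        ∀ f, kd R (i + 1) (h' f) = f + (-1 : k) • h (kd R i f) := fun i h hh hhd =>
    exists_rightLinear_lift (kd R (i + 1)) (isRightLinear_kd R (i + 1)) _
      (hlin (h ∘ₗ kd R i) (fun y f => by
        rw [LinearMap.comp_apply, isRightLinear_kd, hh, LinearMap.comp_apply]))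
      fun f => (R.exact_succ i _).1 (by
        change kd R i (f + (-1 : k) • h (kd R i f)) = 0
        rw [map_add, map_smul, hhd, add_neg_one_smul])
  choose! H hH hH' using hstep
  -- The recursion carries along the identity `d h d = d`, which makes `f - h d f` a cycle and so
  -- liftable at the next stage.
  let P : ℕ → Type u := fun i =>
    {h : (R.X i →₀ Env k S) →ₗ[k] (R.X (i + 1) →₀ Env k S) //
      IsRightLinear S h ∧ ∀ f, kd R i (h (kd R i f)) = kd R i f}
  let h : ∀ i, P i := fun i => Nat.rec (motive := P) ⟨h₀, hh₀, fun f => by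
      have h1 : kaug R (kd R 0 f) = 0 := R.exact_zero.apply_apply_eq_zero f
      have h2 : t (kd R 0 f) = 0 := by
        change rt (k := k) (MulOpposite.op (kaug R (kd R 0 f))) • e = 0
        rw [h1, MulOpposite.op_zero, rt, TensorProduct.tmul_zero]
        exact zero_smul (Env k S) e
      refine (hh₀' _).trans ?_
      rw [LinearMap.add_apply, LinearMap.smul_apply]
      exact (congrArg (fun w => kd R 0 f + (-1 : k) • w) h2).trans (by rw [smul_zero, add_zero])⟩
    (fun i h => ⟨H i h.1, hH i h.1 h.2.1 h.2.2, fun f => by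
      rw [hH' i h.1 h.2.1 h.2.2, hdd, map_zero, smul_zero, add_zero]⟩) i
  exact ⟨{ e := e, kaug_e := he, h := fun i => (h i).1, isRightLinear := fun i => (h i).2.1,
           zero := hh₀', succ := fun i => hH' i (h i).1 (h i).2.1 (h i).2.2 }⟩

variable {N : Type u} [AddCommGroup N] [Module k N] (ρ : S →ₐ[k] Module.End k N)

/-- The differential of the complex `P ⊗_S N`. -/
abbrev tensorD (i : ℕ) : (R.X (i + 1) →₀ S ⊗[k] N) →ₗ[k] (R.X i →₀ S ⊗[k] N) :=
  tensorMap ρ (kd R i)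

/-- The augmentation of the complex `P ⊗_S N`. -/
def tensorAug : (R.X 0 →₀ S ⊗[k] N) →ₗ[k] N :=
  Finsupp.lsum k fun x => TensorProduct.lift
    (ρ.toLinearMap ∘ₗ kaug R ∘ₗ Finsupp.lsingle x ∘ₗ (TensorProduct.mk k S Sᵐᵒᵖ).flip 1)

theorem tensorAug_single (x : R.X 0) (s : S) (n : N) :
    tensorAug R ρ (Finsupp.single x (s ⊗ₜ[k] n)) =
      ρ (kaug R (Finsupp.single x (s ⊗ₜ[k] 1))) n := by
  simp [tensorAug]

theorem tensorAug_evF (n : N) (f : R.X 0 →₀ Env k S) :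
    tensorAug R ρ (evF ρ n f) = ρ (kaug R f) n := by
  induction f using env_finsupp_induction with
  | h0 => simp
  | hadd f g hf hg => rw [map_add, map_add, hf, hg, map_add, map_add]; rfl
  | h x s y =>
    rw [evF_single, ev_tmul, tensorAug_single, single_tmul x s y, kaug_rt_smul, map_mul]
    rfl

theorem tensorAug_surjective : Function.Surjective (tensorAug R ρ) := fun n => by
  obtain ⟨e, he⟩ := R.surjective (1 : S)
  have he : kaug R e = 1 := he
  exact ⟨evF ρ n e, by rw [tensorAug_evF, he, map_one]; rfl⟩

/-- A right linear contraction can be tensored with `N` over `S`, and it then contracts the tensored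
complex onto `N`. The exactness in higher degrees below has the same reason. -/
theorem tensor_exact_zero : Function.Exact (tensorD R ρ 0) (tensorAug R ρ) := by
  obtain ⟨c⟩ := nonempty_contraction R
  refine fun z => ⟨fun hz => ⟨tensorMap ρ (c.h 0) z, ?_⟩, ?_⟩
  · have key : ∀ z : R.X 0 →₀ S ⊗[k] N,
        tensorD R ρ 0 (tensorMap ρ (c.h 0) z) = z + (-1 : k) • evF ρ (tensorAug R ρ z) c.e := by
      intro z
      induction z using tensor_finsupp_induction (ρ := ρ) with
      | hadd f g hf hg => rw [map_add, map_add, hf, hg, map_add, evF_add, smul_add,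
        add_add_add_comm]
      | h n f =>
        rw [tensorMap_evF ρ (c.isRightLinear 0), tensorD, tensorMap_evF ρ (isRightLinear_kd R 0),
          c.zero, map_add, map_smul, evF_rt_smul, tensorAug_evF, MulOpposite.unop_op]
    rw [key, hz]
    have : evF ρ (0 : N) c.e = 0 := by simpa using evF_smul ρ (0 : k) (0 : N) c.e
    rw [this, smul_zero, add_zero]
  · rintro ⟨w, rfl⟩
    induction w using tensor_finsupp_induction (ρ := ρ) with
    | hadd f g hf hg => rw [map_add, map_add, hf, hg, add_zero]
    | h n f =>
      have : kaug R (kd R 0 f) = 0 := R.exact_zero.apply_apply_eq_zero f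
      rw [tensorD, tensorMap_evF ρ (isRightLinear_kd R 0), tensorAug_evF, this, map_zero]
      rfl

theorem tensor_exact_succ (i : ℕ) : Function.Exact (tensorD R ρ (i + 1)) (tensorD R ρ i) := by
  obtain ⟨c⟩ := nonempty_contraction R
  refine fun z => ⟨fun hz => ⟨tensorMap ρ (c.h (i + 1)) z, ?_⟩, ?_⟩
  · have key : ∀ z : R.X (i + 1) →₀ S ⊗[k] N,
        tensorD R ρ (i + 1) (tensorMap ρ (c.h (i + 1)) z) =
          z + (-1 : k) • tensorMap ρ (c.h i) (tensorD R ρ i z) := by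
      intro z
      induction z using tensor_finsupp_induction (ρ := ρ) with
      | hadd f g hf hg => rw [map_add, map_add, hf, hg, map_add, map_add, smul_add,
        add_add_add_comm]
      | h n f =>
        rw [tensorMap_evF ρ (c.isRightLinear _), tensorD, tensorMap_evF ρ (isRightLinear_kd R _),
          c.succ, map_add, map_smul, tensorD, tensorMap_evF ρ (isRightLinear_kd R _),
          tensorMap_evF ρ (c.isRightLinear _)]
    rw [key, hz, map_zero, smul_zero, add_zero]
  · rintro ⟨w, rfl⟩
    induction w using tensor_finsupp_induction (ρ := ρ) with
    | hadd f g hf hg => rw [map_add, map_add, hf, hg, add_zero]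
    | h n f =>
      have : kd R i (kd R (i + 1) f) = 0 := (R.exact_succ i).apply_apply_eq_zero f
      rw [tensorMap_evF ρ (isRightLinear_kd R _), tensorMap_evF ρ (isRightLinear_kd R _), this,
        map_zero]

end Resolution

end Contraction

/-! ### Bounding the global dimension by the length of a resolution of bimodules -/

section GlobalDimension

variable {k S U T : Type u} [Field k] [Ring S] [Algebra k S] [Ring U] [Algebra k U] [Ring T]
  [Algebra k T] (e : S ⊗[k] U ≃ₐ[k] T) (N : Type u) [AddCommGroup N] [Module k N] [Module T N]
  [IsScalarTower k T N]

/-- The action of `S` on a module over `T = S ⊗ U`. -/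
def actL : S →ₐ[k] Module.End k N :=
  (Algebra.lsmul k k N).comp (e.toAlgHom.comp Algebra.TensorProduct.includeLeft)

/-- The action of `U` on a module over `T = S ⊗ U`. -/
def actR : U →ₐ[k] Module.End k N :=
  (Algebra.lsmul k k N).comp (e.toAlgHom.comp Algebra.TensorProduct.includeRight)

theorem actL_apply (s : S) (n : N) : actL e N s n = e (s ⊗ₜ 1) • n := rfl

/-- The module `S ⊗ N` over `T = S ⊗ U`. -/
def IndMod (_ : S ⊗[k] U ≃ₐ[k] T) (N : Type u) [AddCommGroup N] [Module k N] : Type u := S ⊗[k] N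

instance : AddCommGroup (IndMod e N) := inferInstanceAs (AddCommGroup (S ⊗[k] N))

/-- The action of `T = S ⊗ U` on `S ⊗ N`. -/
def indAct : T →ₐ[k] Module.End k (S ⊗[k] N) :=
  (Module.endTensorEndAlgHom.comp
    (Algebra.TensorProduct.map (Algebra.lmul k S) (actR e N))).comp e.symm.toAlgHom

instance : Module T (IndMod e N) :=
  letI : Module T (S ⊗[k] N) := Module.compHom _ (indAct e N).toRingHom
  inferInstanceAs (Module T (S ⊗[k] N))

variable {N}

theorem indMod_smul (t : T) (x : IndMod e N) :
    t • x = (show IndMod e N from indAct e N t (show S ⊗[k] N from x)) := rfl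

theorem indMod_smul_tmul (s s' : S) (r : U) (n : N) :
    (e (s ⊗ₜ r) • (show IndMod e N from s' ⊗ₜ[k] n) : IndMod e N) =
      (show IndMod e N from (s * s') ⊗ₜ[k] (e (1 ⊗ₜ r) • n)) := by
  rw [indMod_smul]
  simp only [indAct, AlgHom.comp_apply]
  have : e.symm.toAlgHom (e (s ⊗ₜ r)) = s ⊗ₜ r := e.symm_apply_apply _
  rw [this, Algebra.TensorProduct.map_tmul]
  rfl

theorem indMod_induction {P : IndMod e N → Prop} (x : IndMod e N)
    (hadd : ∀ x y, P x → P y → P (x + y)) (h : ∀ (s : S) (n : N), P (s ⊗ₜ[k] n : S ⊗[k] N)) :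
    P x := by
  refine TensorProduct.induction_on (motive := P) (x : S ⊗[k] N) ?_ h hadd
  have := h 0 0
  rwa [TensorProduct.zero_tmul] at this

/-- `T`-linearity can be checked on pure tensors. -/
def indLinear {N' : Type u} [AddCommGroup N'] [Module T N'] (f : IndMod e N →+ N')
    (h : ∀ (s s' : S) (r : U) (n : N),
      f (show IndMod e N from (s * s') ⊗ₜ[k] (e (1 ⊗ₜ r) • n)) =
        e (s ⊗ₜ r) • f (show IndMod e N from s' ⊗ₜ[k] n)) : IndMod e N →ₗ[T] N' :=
  { f with
    map_smul' := fun t x => by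
      change f (t • x) = t • f x
      obtain ⟨t, rfl⟩ := e.surjective t
      induction t using TensorProduct.induction_on with
      | zero => rw [map_zero, zero_smul, zero_smul, map_zero]
      | add t t' ht ht' => rw [map_add, add_smul, add_smul, map_add, ht, ht']
      | tmul s r =>
        induction x using indMod_induction with
        | hadd x y hx hy => rw [smul_add, map_add, map_add, smul_add, hx, hy]
        | h s' n =>
          rw [← h]
          exact congrArg f (indMod_smul_tmul e s s' r n) }

/-- Over the semisimple ring `U` the module `N` is a direct summand of the free module `N →₀ U`.
Applying `S ⊗ -` makes `S ⊗ N` a direct summand of the free module `N →₀ T`. -/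
instance [IsSemisimpleRing U] : Module.Projective T (IndMod e N) := by
  let _ : Module U N := Module.compHom N (e.toAlgHom.comp
    (Algebra.TensorProduct.includeRight : U →ₐ[k] S ⊗[k] U)).toRingHom
  have hU : ∀ (r : U) (n : N), r • n = e (1 ⊗ₜ r) • n := fun _ _ => rfl
  obtain ⟨σ, hσ⟩ := (Module.projective_of_isSemisimpleRing U N).out
  have hk : ∀ (c : k) (n : N), σ (c • n) = c • σ n := fun c n => by
    have h1 : c • n = (algebraMap k U c) • n := by
      rw [hU, ← algebraMap_smul T c n, ← e.commutes c]
      congr 2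
      exact Algebra.TensorProduct.algebraMap_apply' c
    rw [h1, map_smul, algebraMap_smul]
  let σk : N →ₗ[k] (N →₀ U) := { σ with map_smul' := hk }
  let j : S ⊗[k] N →ₗ[k] (N →₀ T) := TensorProduct.lift <| LinearMap.mk₂ k
    (fun s n => Finsupp.mapRange.linearMap
      (e.toLinearMap ∘ₗ TensorProduct.mk k S U s) (σk n))
    (fun s s' n => by ext x; simp)
    (fun c s n => by ext x; simp)
    (fun s n n' => by rw [map_add, map_add])
    (fun c s n => by rw [map_smul, map_smul])
  have hj : ∀ s n, j (s ⊗ₜ n) = Finsupp.mapRange.linearMap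
      (e.toLinearMap ∘ₗ TensorProduct.mk k S U s) (σ n) := fun _ _ => rfl
  let i : IndMod e N →ₗ[T] (N →₀ T) := indLinear e j.toAddMonoidHom fun s s' r n => by
    change j ((s * s') ⊗ₜ (e (1 ⊗ₜ r) • n)) = e (s ⊗ₜ r) • j (s' ⊗ₜ n)
    rw [hj, hj, ← hU, map_smul]
    ext x
    simp only [Finsupp.mapRange.linearMap_apply, Finsupp.mapRange_apply, LinearMap.comp_apply,
      Finsupp.smul_apply, smul_eq_mul, TensorProduct.mk_apply, AlgEquiv.toLinearMap_apply]
    rw [← map_mul, Algebra.TensorProduct.tmul_mul_tmul]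
  refine Module.Projective.of_split i (Finsupp.linearCombination T
    fun n => (show IndMod e N from (1 : S) ⊗ₜ[k] n)) (LinearMap.ext fun x => ?_)
  induction x using indMod_induction with
  | hadd x y hx hy => rw [map_add, map_add, hx, hy]
  | h s n =>
    have h1 : ∀ f : N →₀ U, Finsupp.linearCombination T
        (fun n => (show IndMod e N from (1 : S) ⊗ₜ[k] n)) (Finsupp.mapRange.linearMap
          (e.toLinearMap ∘ₗ TensorProduct.mk k S U s) f) =
        (show IndMod e N from s ⊗ₜ[k] (Finsupp.linearCombination U id f)) := fun f => by
      induction f using Finsupp.induction_linear with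
      | zero =>
        rw [map_zero, map_zero, map_zero, TensorProduct.tmul_zero]; rfl
      | add f g hf hg =>
        rw [map_add, map_add, hf, hg, map_add, TensorProduct.tmul_add]; rfl
      | single m r =>
        rw [Finsupp.mapRange.linearMap_apply, Finsupp.mapRange_single,
          Finsupp.linearCombination_single, Finsupp.linearCombination_single]
        exact (indMod_smul_tmul e s 1 r m).trans (by rw [mul_one]; rfl)
    refine (h1 (σ n)).trans ?_
    rw [hσ n]
    rfl

instance {X : Type u} [IsSemisimpleRing U] : Module.Projective T (X →₀ IndMod e N) := by
  classical
  exact Module.Projective.of_equiv (finsuppLequivDFinsupp T (M := IndMod e N)).symm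

variable (R : FreeRes (bimod k S))

/-- The actions of `S` and `U` on `N` commute, so `(S ⊗ S°) ⊗_S N` is a `T`-module: `S` multiplies
the left factor and `U` acts on `N`. Evaluation respects these actions. -/
theorem ev_mul_left (s : S) (r : U) (n : N) (b : Env k S) :
    ev (actL e N) (e (1 ⊗ₜ r) • n) ((s ⊗ₜ 1) * b) =
      (show S ⊗[k] N from e (s ⊗ₜ r) • (show IndMod e N from ev (actL e N) n b)) := by
  induction b using TensorProduct.induction_on with
  | zero =>
    rw [mul_zero, map_zero, map_zero]
    exact (smul_zero (A := IndMod e N) (e (s ⊗ₜ r))).symm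
  | tmul s' y =>
    rw [Algebra.TensorProduct.tmul_mul_tmul, one_mul, ev_tmul, ev_tmul]
    refine Eq.trans ?_ (indMod_smul_tmul e s s' r _).symm
    rw [actL_apply, actL_apply, ← mul_smul, ← mul_smul, ← map_mul, ← map_mul,
      Algebra.TensorProduct.tmul_mul_tmul, Algebra.TensorProduct.tmul_mul_tmul, one_mul, one_mul,
      mul_one, mul_one]
  | add b c hb hc =>
    rw [mul_add, map_add, map_add, hb, hc]
    exact (smul_add (A := IndMod e N) _ _ _).symm

theorem evF_smul_left {X : Type u} (s : S) (r : U) (n : N) (f : X →₀ Env k S) :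
    (show X →₀ IndMod e N from evF (actL e N) (e (1 ⊗ₜ r) • n)
      ((s ⊗ₜ[k] (1 : Sᵐᵒᵖ) : Env k S) • f)) =
      e (s ⊗ₜ r) • (show X →₀ IndMod e N from evF (actL e N) n f) := by
  refine Finsupp.ext fun x => ?_
  exact ev_mul_left e s r n (f x)

/-- The differential of the complex `P ⊗_S N`, as a `T`-linear map. -/
def indD (i : ℕ) : (R.X (i + 1) →₀ IndMod e N) →ₗ[T] (R.X i →₀ IndMod e N) :=
  Finsupp.lsum ℕ fun x => indLinear e
    ((tensorD R (actL e N) i).toAddMonoidHom.comp (Finsupp.singleAddHom x)) fun s s' r n => by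
    change tensorD R (actL e N) i (Finsupp.single x ((s * s') ⊗ₜ _)) =
      e (s ⊗ₜ r) • (show R.X i →₀ IndMod e N from
        tensorD R (actL e N) i (Finsupp.single x (s' ⊗ₜ n)))
    rw [tensorMap_single, tensorMap_single, ← evF_smul_left]
    congr 1
    refine Eq.trans ?_ ((rowMap R.M i).map_smul _ _)
    rw [Finsupp.smul_single, smul_eq_mul, Algebra.TensorProduct.tmul_mul_tmul, one_mul]
    rfl

theorem indD_apply (i : ℕ) (z : R.X (i + 1) →₀ IndMod e N) :
    indD e R i z = (show R.X i →₀ IndMod e N from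
      tensorD R (actL e N) i (show R.X (i + 1) →₀ S ⊗[k] N from z)) := by
  induction z using Finsupp.induction_linear with
  | zero => rw [map_zero]; exact (map_zero (tensorD R (actL e N) i)).symm
  | add f g hf hg =>
    rw [map_add, hf, hg]
    exact (map_add (tensorD R (actL e N) i) _ _).symm
  | single x b =>
    rw [indD, Finsupp.lsum_single]
    rfl

/-- The augmentation of the complex `P ⊗_S N`, as a `T`-linear map. -/
def indAug : (R.X 0 →₀ IndMod e N) →ₗ[T] N :=
  Finsupp.lsum ℕ fun x => indLinear e
    ((tensorAug R (actL e N)).toAddMonoidHom.comp (Finsupp.singleAddHom x)) fun s s' r n => by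
    change tensorAug R (actL e N) (Finsupp.single x ((s * s') ⊗ₜ _)) =
      e (s ⊗ₜ r) • tensorAug R (actL e N) (Finsupp.single x (s' ⊗ₜ n))
    have h : kaug R (Finsupp.single x ((s * s') ⊗ₜ 1)) =
        s * kaug R (Finsupp.single x (s' ⊗ₜ 1)) := by
      have h1 : Finsupp.single x ((s * s') ⊗ₜ[k] (1 : Sᵐᵒᵖ) : Env k S) =
          (s ⊗ₜ[k] (1 : Sᵐᵒᵖ) : Env k S) • Finsupp.single x (s' ⊗ₜ 1) := by
        rw [Finsupp.smul_single, smul_eq_mul, Algebra.TensorProduct.tmul_mul_tmul, one_mul]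
      rw [h1]
      refine (R.aug.map_smul _ _).trans ((bimod_smul' _ _ _).trans ?_)
      rw [MulOpposite.unop_one, mul_one]
      rfl
    rw [tensorAug_single, tensorAug_single, h, actL_apply, actL_apply, ← mul_smul, ← mul_smul,
      ← map_mul, ← map_mul, Algebra.TensorProduct.tmul_mul_tmul,
      Algebra.TensorProduct.tmul_mul_tmul, one_mul, mul_one, mul_one]

theorem indAug_apply (z : R.X 0 →₀ IndMod e N) :
    indAug e R z = tensorAug R (actL e N) (show R.X 0 →₀ S ⊗[k] N from z) := by
  induction z using Finsupp.induction_linear with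
  | zero => rw [map_zero]; exact (map_zero (tensorAug R (actL e N))).symm
  | add f g hf hg =>
    rw [map_add, hf, hg]
    exact (map_add (tensorAug R (actL e N)) _ _).symm
  | single x b =>
    rw [indAug, Finsupp.lsum_single]
    rfl

/-- If `S` has a free resolution of length less than `n` as a bimodule and `U` is semisimple, then
the modules over `S ⊗ U` have projective dimension less than `n`. -/
theorem hasProjectiveDimensionLT_of_freeRes [IsSemisimpleRing U] (e : S ⊗[k] U ≃ₐ[k] T)
    (R : FreeRes (bimod k S)) (n : ℕ) (hn : ∀ i ≥ n, IsEmpty (R.X i)) (N : ModuleCat.{u} T) :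
      HasProjectiveDimensionLT N n := by
  let _ : Module k N := Module.compHom N (algebraMap k T)
  have _ : IsScalarTower k T N := ⟨fun c t x => by
    rw [Algebra.smul_def, mul_smul]; rfl⟩
  -- The complex `P ⊗_S N` resolves `N` and is as long as `R`. Its terms are sums of copies of `S ⊗
  -- N`, which are projective over `T`.
  refine hasProjectiveDimensionLT_of_isZero (ProjRes.ofModules (Y := N)
    (fun i => R.X i →₀ IndMod e N) (indD e R) (indAug e R) ?_ ?_ ?_) n ?_
  · intro x
    obtain ⟨z, hz⟩ := tensorAug_surjective R (actL e N) x
    exact ⟨z, (indAug_apply e R z).trans hz⟩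
  · intro z
    rw [indAug_apply]
    refine (tensor_exact_zero R (actL e N) z).trans (exists_congr fun w => ?_)
    exact ⟨fun h => (indD_apply e R _ w).trans h, fun h => (indD_apply e R _ w).symm.trans h⟩
  · intro i z
    rw [indD_apply]
    refine (tensor_exact_succ R (actL e N) i z).trans (exists_congr fun w => ?_)
    exact ⟨fun h => (indD_apply e R _ w).trans h, fun h => (indD_apply e R _ w).symm.trans h⟩
  · intro i hi
    have := hn i hi
    exact ModuleCat.isZero_of_subsingleton (ModuleCat.of T (R.X i →₀ IndMod e N))

end GlobalDimension

/-! ### Connected graded algebras and their augmentations -/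

section Connected

variable {k A : Type u} [Field k] [Ring A] [Algebra k A] (𝒜 : ℤ → Submodule k A)
  [GradedAlgebra 𝒜]

/-- The projection of a graded algebra to its component of degree `i`. -/
abbrev gproj (i : ℤ) : A →ₗ[k] A := GradedAlgebra.proj 𝒜 i

theorem gproj_mem (i : ℤ) (a : A) : gproj 𝒜 i a ∈ 𝒜 i := SetLike.coe_mem _

variable {𝒜}

theorem gproj_same {i : ℤ} {a : A} (h : a ∈ 𝒜 i) : gproj 𝒜 i a = a :=
  DirectSum.decompose_of_mem_same 𝒜 h

theorem gproj_ne {i j : ℤ} {a : A} (h : a ∈ 𝒜 i) (hij : i ≠ j) : gproj 𝒜 j a = 0 :=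
  DirectSum.decompose_of_mem_ne 𝒜 h hij

variable (𝒜) in
theorem exists_sum_gproj (a : A) : ∃ s : Finset ℤ, ∀ t, s ⊆ t → ∑ i ∈ t, gproj 𝒜 i a = a := by
  classical
  refine ⟨(DirectSum.decompose 𝒜 a).support, fun t ht => ?_⟩
  rw [← Finset.sum_subset ht]
  · exact DirectSum.sum_support_decompose 𝒜 a
  · intro i _ hi
    rw [DFinsupp.notMem_support_iff] at hi
    exact congrArg Subtype.val hi

theorem graded_induction {P : A → Prop} (a : A) (hadd : ∀ a b, P a → P b → P (a + b))
    (h : ∀ i, ∀ a ∈ 𝒜 i, P a) : P a := by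
  refine DirectSum.Decomposition.inductionOn 𝒜 (motive := P) (h 0 0 (zero_mem _)) ?_ ?_ a
  · exact fun m => h _ m m.2
  · exact fun a b => hadd a b

theorem gproj_gproj (i : ℤ) (a : A) : gproj 𝒜 i (gproj 𝒜 i a) = gproj 𝒜 i a :=
  gproj_same (gproj_mem 𝒜 i a)

theorem gproj_mul_left {i : ℤ} {a : A} (h : a ∈ 𝒜 i) (d : ℤ) (b : A) :
    gproj 𝒜 d (a * b) = a * gproj 𝒜 (d - i) b := by
  induction b using graded_induction (𝒜 := 𝒜) with
  | hadd b c hb hc => rw [mul_add, map_add, hb, hc, map_add, mul_add]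
  | h j b hb =>
    have hab : a * b ∈ 𝒜 (i + j) := SetLike.mul_mem_graded h hb
    by_cases hj : j = d - i
    · subst hj
      rw [gproj_same hb]
      rw [add_sub_cancel] at hab
      exact gproj_same hab
    · rw [gproj_ne hb hj, mul_zero]
      exact gproj_ne hab (by omega)

theorem IsConnectedGraded.gproj_neg (h : IsConnectedGraded 𝒜) {i : ℤ} (hi : i < 0) (a : A) :
    gproj 𝒜 i a = 0 := by
  have := gproj_mem 𝒜 i a
  rwa [h.deg_neg i hi, Submodule.mem_bot] at this

theorem IsConnectedGraded.eq_zero_of_neg (h : IsConnectedGraded 𝒜) {i : ℤ} (hi : i < 0) {a : A}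
    (ha : a ∈ 𝒜 i) : a = 0 := by
  rwa [h.deg_neg i hi, Submodule.mem_bot] at ha

theorem IsConnectedGraded.exists_scalar (h : IsConnectedGraded 𝒜) {a : A} (ha : a ∈ 𝒜 0) :
    ∃ c, algebraMap k A c = a := by
  rw [h.deg_zero] at ha
  exact Submodule.mem_one.1 ha

theorem IsConnectedGraded.gproj_zero_mul (h : IsConnectedGraded 𝒜) (a b : A) :
    gproj 𝒜 0 (a * b) = gproj 𝒜 0 a * gproj 𝒜 0 b := by
  induction a using graded_induction (𝒜 := 𝒜) with
  | hadd a c ha hc => rw [add_mul, map_add, ha, hc, map_add, add_mul]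
  | h i a ha =>
    rw [gproj_mul_left ha]
    rcases lt_trichotomy i 0 with hi | rfl | hi
    · rw [h.eq_zero_of_neg hi ha, zero_mul, map_zero, zero_mul]
    · rw [gproj_same ha, sub_zero]
    · rw [gproj_ne ha hi.ne', h.gproj_neg (by omega), mul_zero, zero_mul]

/-- The augmentation of a connected graded algebra. -/
def IsConnectedGraded.augm (h : IsConnectedGraded 𝒜) : A →ₐ[k] k :=
  have hs : ∀ a, ∃ c, algebraMap k A c = gproj 𝒜 0 a := fun a =>
    h.exists_scalar (gproj_mem 𝒜 0 a)
  have hc : ∀ c, gproj 𝒜 0 (algebraMap k A c) = algebraMap k A c := fun c =>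
    gproj_same (SetLike.algebraMap_mem_graded 𝒜 c)
  { toFun := fun a => (hs a).choose
    map_one' := h.algebraMap_injective <| by
      rw [(hs 1).choose_spec, (algebraMap k A).map_one, gproj_same SetLike.GradedOne.one_mem]
    map_mul' := fun a b => h.algebraMap_injective <| by
      rw [(hs (a * b)).choose_spec, (algebraMap k A).map_mul, (hs a).choose_spec,
        (hs b).choose_spec,
        h.gproj_zero_mul]
    map_zero' := h.algebraMap_injective <| by rw [(hs 0).choose_spec, map_zero, map_zero]
    map_add' := fun a b => h.algebraMap_injective <| by
      rw [(hs (a + b)).choose_spec, map_add, map_add, (hs a).choose_spec, (hs b).choose_spec]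
    commutes' := fun c => h.algebraMap_injective <| by
      rw [(hs _).choose_spec, hc]; rfl }

theorem IsConnectedGraded.algebraMap_augm (h : IsConnectedGraded 𝒜) (a : A) :
    algebraMap k A (h.augm a) = gproj 𝒜 0 a :=
  (h.exists_scalar (gproj_mem 𝒜 0 a)).choose_spec

theorem IsConnectedGraded.augm_eq_zero (h : IsConnectedGraded 𝒜) {i : ℤ} (hi : i ≠ 0) {a : A}
    (ha : a ∈ 𝒜 i) : h.augm a = 0 :=
  h.algebraMap_injective (by rw [h.algebraMap_augm, gproj_ne ha hi, map_zero])

theorem IsConnectedGraded.augm_unique (h : IsConnectedGraded 𝒜) (φ : A →ₐ[k] k)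
    (hφ : ∀ i > 0, ∀ a ∈ 𝒜 i, φ a = 0) : φ = h.augm := by
  refine AlgHom.ext fun a => ?_
  induction a using graded_induction (𝒜 := 𝒜) with
  | hadd a b ha hb => rw [map_add, map_add, ha, hb]
  | h i a ha =>
    rcases lt_trichotomy i 0 with hi | rfl | hi
    · rw [h.eq_zero_of_neg hi ha, map_zero, map_zero]
    · obtain ⟨c, rfl⟩ := h.exists_scalar ha
      rw [AlgHom.commutes, AlgHom.commutes]
    · rw [hφ i hi a ha, h.augm_eq_zero hi.ne' ha]

theorem IsConnectedGraded.op (h : IsConnectedGraded 𝒜) : IsConnectedGraded (opGrading 𝒜) where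
  algebraMap_injective := MulOpposite.op_injective.comp h.algebraMap_injective
  deg_neg i hi := by rw [opGrading, h.deg_neg i hi, Submodule.map_bot]
  deg_zero := by
    rw [opGrading, h.deg_zero]
    ext x
    simp only [Submodule.mem_map, Submodule.mem_one]
    constructor
    · rintro ⟨_, ⟨c, rfl⟩, rfl⟩
      exact ⟨c, rfl⟩
    · rintro ⟨c, rfl⟩
      exact ⟨_, ⟨c, rfl⟩, rfl⟩

theorem op_mem_opGrading {i : ℤ} {a : A} : MulOpposite.op a ∈ opGrading 𝒜 i ↔ a ∈ 𝒜 i := by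
  constructor
  · rintro ⟨b, hb, h⟩
    rwa [← MulOpposite.op_injective h]
  · exact fun h => ⟨a, h, rfl⟩

end Connected

/-! ### The total grading of a tensor product -/

section TotalGrading

variable {k A C : Type u} [Field k] [Ring A] [Algebra k A] [Ring C] [Algebra k C]
  (𝒜 : ℤ → Submodule k A) (𝒞 : ℤ → Submodule k C)

/-- The total grading of the tensor product of two graded algebras. -/
def totGrading (d : ℤ) : Submodule k (A ⊗[k] C) :=
  Submodule.span k {x | ∃ i j, i + j = d ∧ ∃ a ∈ 𝒜 i, ∃ c ∈ 𝒞 j, x = a ⊗ₜ c}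

variable {𝒜 𝒞}

theorem tmul_mem_totGrading {i j d : ℤ} {a : A} {c : C} (ha : a ∈ 𝒜 i) (hc : c ∈ 𝒞 j)
    (h : i + j = d) : a ⊗ₜ[k] c ∈ totGrading 𝒜 𝒞 d :=
  Submodule.subset_span ⟨i, j, h, a, ha, c, hc, rfl⟩

theorem totGrading_induction {d : ℤ} {P : (x : A ⊗[k] C) → x ∈ totGrading 𝒜 𝒞 d → Prop}
    (h0 : P 0 (zero_mem _))
    (hadd : ∀ x y hx hy, P x hx → P y hy → P (x + y) (add_mem hx hy))
    (h : ∀ i j (hij : i + j = d) a (ha : a ∈ 𝒜 i) c (hc : c ∈ 𝒞 j),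
      P (a ⊗ₜ c) (tmul_mem_totGrading ha hc hij)) {x : A ⊗[k] C}
    (hx : x ∈ totGrading 𝒜 𝒞 d) : P x hx := by
  -- Treating all scalar multiples at once absorbs the scalars into the pure tensors, so that the
  -- induction principle needs no case for them.
  have key : ∀ r : k, ∃ h, P (r • x) h := by
    induction hx using Submodule.span_induction with
    | mem x hx =>
      intro r
      obtain ⟨i, j, hij, a, ha, c, hc, rfl⟩ := hx
      rw [TensorProduct.smul_tmul']
      exact ⟨_, h i j hij _ ((𝒜 i).smul_mem r ha) c hc⟩
    | zero => intro r; rw [smul_zero]; exact ⟨_, h0⟩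
    | add x y _ _ hx hy =>
      intro r
      obtain ⟨h1, h1'⟩ := hx r
      obtain ⟨h2, h2'⟩ := hy r
      rw [smul_add]
      exact ⟨_, hadd _ _ h1 h2 h1' h2'⟩
    | smul s x _ ih => intro r; rw [smul_smul]; exact ih _
  obtain ⟨_, h1⟩ := key 1
  simpa using h1

variable (𝒜 𝒞) [GradedAlgebra 𝒜] [GradedAlgebra 𝒞]

/-- The projection of a tensor product to its component of total degree `d`. -/
def totProj (d : ℤ) : A ⊗[k] C →ₗ[k] A ⊗[k] C :=
  TensorProduct.lift
    (DirectSum.toModule k ℤ (C →ₗ[k] A ⊗[k] C)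
      (fun i => ((TensorProduct.mk k A C).compl₂ (gproj 𝒞 (d - i))) ∘ₗ (𝒜 i).subtype) ∘ₗ
      (DirectSum.decomposeLinearEquiv 𝒜).toLinearMap)

variable {𝒜 𝒞}

theorem totProj_tmul (d : ℤ) {i : ℤ} {a : A} (ha : a ∈ 𝒜 i) (c : C) :
    totProj 𝒜 𝒞 d (a ⊗ₜ c) = a ⊗ₜ gproj 𝒞 (d - i) c := by
  have h1 : DirectSum.decompose 𝒜 a = DirectSum.lof k ℤ (fun i => 𝒜 i) i ⟨a, ha⟩ :=
    DirectSum.decompose_of_mem 𝒜 ha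
  rw [totProj, TensorProduct.lift.tmul, LinearMap.comp_apply, LinearEquiv.coe_coe,
    DirectSum.decomposeLinearEquiv_apply, h1, DirectSum.toModule_lof]
  rfl

variable (𝒜 𝒞) in
theorem mem_iSup_totGrading (x : A ⊗[k] C) : x ∈ ⨆ d, totGrading 𝒜 𝒞 d := by
  induction x with
  | zero => exact zero_mem _
  | add x y hx hy => exact add_mem hx hy
  | tmul a c =>
    induction a using graded_induction (𝒜 := 𝒜) with
    | hadd a b ha hb => rw [TensorProduct.add_tmul]; exact add_mem ha hb
    | h i a ha =>
      induction c using graded_induction (𝒜 := 𝒞) with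
      | hadd a b ha hb => rw [TensorProduct.tmul_add]; exact add_mem ha hb
      | h j c hc => exact Submodule.mem_iSup_of_mem (i + j) (tmul_mem_totGrading ha hc rfl)

instance : GradedAlgebra (totGrading 𝒜 𝒞) where
  one_mem := tmul_mem_totGrading SetLike.GradedOne.one_mem SetLike.GradedOne.one_mem (add_zero 0)
  mul_mem := by
    intro d e x y hx hy
    induction hx using totGrading_induction with
    | h0 => rw [zero_mul]; exact zero_mem _
    | hadd x y _ _ hx hy => rw [add_mul]; exact add_mem hx hy
    | h i j hij a ha c hc =>
      induction hy using totGrading_induction with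
      | h0 => rw [mul_zero]; exact zero_mem _
      | hadd x y _ _ hx hy => rw [mul_add]; exact add_mem hx hy
      | h i' j' hij' a' ha' c' hc' =>
        rw [Algebra.TensorProduct.tmul_mul_tmul]
        exact tmul_mem_totGrading (SetLike.mul_mem_graded ha ha')
          (SetLike.mul_mem_graded hc hc') (by omega)
  toDecomposition := DirectSum.IsInternal.chooseDecomposition _ (by
    refine isInternal_of_proj (fun d => (totGrading 𝒜 𝒞 d).toAddSubgroup)
      (fun d => (totProj 𝒜 𝒞 d).toAddMonoidHom) ?_ ?_ ?_
    · intro d x hx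
      change x ∈ totGrading 𝒜 𝒞 d at hx
      change totProj 𝒜 𝒞 d x = x
      induction hx using totGrading_induction with
      | h0 => exact map_zero _
      | hadd x y _ _ hx hy => rw [map_add, hx, hy]
      | h i j hij a ha c hc => rw [totProj_tmul d ha, gproj_same
        (by rwa [← hij, add_sub_cancel_left])]
    · intro d e hde x hx
      change x ∈ totGrading 𝒜 𝒞 d at hx
      change totProj 𝒜 𝒞 e x = 0
      induction hx using totGrading_induction with
      | h0 => exact map_zero _
      | hadd x y _ _ hx hy => rw [map_add, hx, hy, add_zero]
      | h i j hij a ha c hc =>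
        rw [totProj_tmul e ha, gproj_ne hc (by omega), TensorProduct.tmul_zero]
    · intro x
      have h := mem_iSup_totGrading 𝒜 𝒞 x
      induction h using Submodule.iSup_induction' with
      | mem d x hx => exact AddSubgroup.mem_iSup_of_mem d hx
      | zero => exact zero_mem _
      | add x y _ _ hx hy => exact add_mem hx hy)

theorem gproj_totGrading (d : ℤ) {i : ℤ} {a : A} (ha : a ∈ 𝒜 i) (c : C) :
    gproj (totGrading 𝒜 𝒞) d (a ⊗ₜ c) = a ⊗ₜ gproj 𝒞 (d - i) c := by
  induction c using graded_induction (𝒜 := 𝒞) with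
  | hadd b c hb hc => rw [TensorProduct.tmul_add, map_add, hb, hc, map_add, TensorProduct.tmul_add]
  | h j c hc =>
    have hac := tmul_mem_totGrading ha hc rfl
    by_cases h : i + j = d
    · rw [gproj_same (h ▸ hac), gproj_same (by rwa [← h, add_sub_cancel_left])]
    · rw [gproj_ne hac h, gproj_ne hc (by omega), TensorProduct.tmul_zero]

theorem IsConnectedGraded.tot (hA : IsConnectedGraded 𝒜) (hC : IsConnectedGraded 𝒞) :
    IsConnectedGraded (totGrading 𝒜 𝒞) where
  algebraMap_injective := by
    have h : Function.LeftInverse (Algebra.TensorProduct.lift hA.augm hC.augm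
        (fun _ _ => Commute.all _ _)) (algebraMap k (A ⊗[k] C)) := fun c => by
      rw [AlgHom.commutes]; rfl
    exact h.injective
  deg_neg d hd := by
    rw [eq_bot_iff]
    intro x hx
    rw [Submodule.mem_bot]
    induction hx using totGrading_induction with
    | h0 => rfl
    | hadd x y _ _ hx hy => rw [hx, hy, add_zero]
    | h i j hij a ha c hc =>
      rcases lt_or_ge i 0 with hi | hi
      · rw [hA.eq_zero_of_neg hi ha, TensorProduct.zero_tmul]
      · rw [hC.eq_zero_of_neg (by omega) hc, TensorProduct.tmul_zero]
  deg_zero := by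
    apply le_antisymm
    · intro x hx
      induction hx using totGrading_induction with
      | h0 => exact zero_mem _
      | hadd x y _ _ hx hy => exact add_mem hx hy
      | h i j hij a ha c hc =>
        rcases lt_trichotomy i 0 with hi | rfl | hi
        · rw [hA.eq_zero_of_neg hi ha, TensorProduct.zero_tmul]; exact zero_mem _
        · obtain rfl : j = 0 := by omega
          obtain ⟨r, rfl⟩ := hA.exists_scalar ha
          obtain ⟨s, rfl⟩ := hC.exists_scalar hc
          refine Submodule.mem_one.2 ⟨r * s, ?_⟩
          rw [map_mul, Algebra.TensorProduct.algebraMap_apply,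
            Algebra.TensorProduct.algebraMap_apply', Algebra.TensorProduct.tmul_mul_tmul, one_mul,
              mul_one]
        · rw [hC.eq_zero_of_neg (by omega) hc, TensorProduct.tmul_zero]; exact zero_mem _
    · intro x hx
      obtain ⟨r, rfl⟩ := Submodule.mem_one.1 hx
      exact SetLike.algebraMap_mem_graded _ r

theorem IsConnectedGraded.augm_tot_tmul (hA : IsConnectedGraded 𝒜) (hC : IsConnectedGraded 𝒞)
    (a : A) (c : C) : (hA.tot hC).augm (a ⊗ₜ c) = hA.augm a * hC.augm c := by
  have h : Algebra.TensorProduct.lift hA.augm hC.augm (fun _ _ => Commute.all _ _) =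
      (hA.tot hC).augm := by
    refine (hA.tot hC).augm_unique _ fun d hd x hx => ?_
    induction hx using totGrading_induction with
    | h0 => exact map_zero _
    | hadd x y _ _ hx hy => rw [map_add, hx, hy, add_zero]
    | h i j hij a ha c hc =>
      rw [Algebra.TensorProduct.lift_tmul]
      by_cases hi : i = 0
      · rw [hC.augm_eq_zero (by omega) hc, mul_zero]
      · rw [hA.augm_eq_zero hi ha, zero_mul]
  rw [← h, Algebra.TensorProduct.lift_tmul]

end TotalGrading

/-! ### Minimal free resolutions over connected graded algebras -/

section FreeGraded

variable {k B : Type u} [Field k] [Ring B] [Algebra k B] (𝓑 : ℤ → Submodule k B)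
  [GradedAlgebra 𝓑] {X X' : Type u} (deg : X → ℤ) {deg' : X' → ℤ}

/-- The projection of a free module on generators of the given degrees to its component of
degree `d`. -/
def finProj (d : ℤ) : (X →₀ B) →ₗ[k] (X →₀ B) :=
  Finsupp.lsum k fun x => Finsupp.lsingle x ∘ₗ gproj 𝓑 (d - deg x)

/-- The component of degree `d` of a free module on generators of the given degrees. -/
def finDeg (d : ℤ) : Submodule k (X →₀ B) where
  carrier := {f | ∀ x, f x ∈ 𝓑 (d - deg x)}
  zero_mem' _ := zero_mem _
  add_mem' hf hg x := add_mem (hf x) (hg x)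
  smul_mem' c _ hf x := Submodule.smul_mem _ c (hf x)

variable {𝓑 deg}

theorem finProj_single (d : ℤ) (x : X) (b : B) :
    finProj 𝓑 deg d (Finsupp.single x b) = Finsupp.single x (gproj 𝓑 (d - deg x) b) := by
  rw [finProj, Finsupp.lsum_single]
  rfl

theorem finProj_apply (d : ℤ) (f : X →₀ B) (x : X) :
    finProj 𝓑 deg d f x = gproj 𝓑 (d - deg x) (f x) := by
  classical
  induction f using Finsupp.induction_linear with
  | zero => simp
  | add f g hf hg => rw [map_add, Finsupp.add_apply, hf, hg, Finsupp.add_apply, map_add]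
  | single y b =>
    rw [finProj_single, Finsupp.single_apply, Finsupp.single_apply]
    split_ifs with h
    · rw [h]
    · rw [map_zero]

theorem finProj_mem (d : ℤ) (f : X →₀ B) : finProj 𝓑 deg d f ∈ finDeg 𝓑 deg d := fun x => by
  rw [finProj_apply]
  exact gproj_mem _ _ _

theorem finProj_same {d : ℤ} {f : X →₀ B} (hf : f ∈ finDeg 𝓑 deg d) : finProj 𝓑 deg d f = f :=
  Finsupp.ext fun x => by rw [finProj_apply, gproj_same (hf x)]

theorem finProj_ne {d e : ℤ} {f : X →₀ B} (hf : f ∈ finDeg 𝓑 deg d) (h : d ≠ e) :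
    finProj 𝓑 deg e f = 0 :=
  Finsupp.ext fun x => by
    rw [finProj_apply, gproj_ne (hf x) (by omega), Finsupp.zero_apply]

theorem smul_mem_finDeg {i d : ℤ} {b : B} (hb : b ∈ 𝓑 i) {f : X →₀ B}
    (hf : f ∈ finDeg 𝓑 deg d) : b • f ∈ finDeg 𝓑 deg (i + d) := fun x => by
  rw [Finsupp.smul_apply, smul_eq_mul, add_sub_assoc]
  exact SetLike.mul_mem_graded hb (hf x)

theorem single_mem_finDeg {i : ℤ} {b : B} (hb : b ∈ 𝓑 i) (x : X) :
    Finsupp.single x b ∈ finDeg 𝓑 deg (i + deg x) := fun y => by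
  classical
  rw [Finsupp.single_apply]
  split_ifs with h
  · rwa [← h, add_sub_cancel_right]
  · exact zero_mem _

theorem exists_sum_finProj (f : X →₀ B) :
    ∃ s : Finset ℤ, ∑ d ∈ s, finProj 𝓑 deg d f = f := by
  classical
  have key : ∃ s : Finset ℤ, ∀ t, s ⊆ t → ∑ d ∈ t, finProj 𝓑 deg d f = f := by
    induction f using Finsupp.induction_linear with
    | zero => exact ⟨∅, fun t _ => by simp⟩
    | add f g hf hg =>
      obtain ⟨s, hs⟩ := hf
      obtain ⟨t, ht⟩ := hg
      refine ⟨s ∪ t, fun r hr => ?_⟩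
      simp only [map_add, Finset.sum_add_distrib]
      rw [hs r (Finset.union_subset_left hr), ht r (Finset.union_subset_right hr)]
    | single x b =>
      obtain ⟨s, hs⟩ := exists_sum_gproj 𝓑 b
      refine ⟨s.image (· + deg x), fun t ht => ?_⟩
      simp only [finProj_single]
      rw [← Finsupp.single_finsetSum]
      have h := hs (t.image (· - deg x)) fun i hi =>
        Finset.mem_image.2 ⟨i + deg x, ht (Finset.mem_image_of_mem _ hi), by simp⟩
      rw [Finset.sum_image (by simp)] at h
      rw [h]
  obtain ⟨s, hs⟩ := key
  exact ⟨s, hs s subset_rfl⟩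

theorem finDeg_induction {P : (X →₀ B) → Prop} (f : X →₀ B) (hadd : ∀ f g, P f → P g → P (f + g))
    (h : ∀ d, ∀ f ∈ finDeg 𝓑 deg d, P f) : P f := by
  obtain ⟨s, hs⟩ := exists_sum_finProj (𝓑 := 𝓑) (deg := deg) f
  rw [← hs]
  exact Finset.sum_induction _ P hadd (h 0 0 (zero_mem _)) fun d _ => h d _ (finProj_mem d f)

theorem linearCombination_mem_finDeg {D : X' → X →₀ B} (hD : ∀ x, D x ∈ finDeg 𝓑 deg (deg' x))
    {d : ℤ} {f : X' →₀ B} (hf : f ∈ finDeg 𝓑 deg' d) :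
    Finsupp.linearCombination B D f ∈ finDeg 𝓑 deg d := by
  rw [Finsupp.linearCombination_apply]
  refine sum_mem fun x _ => ?_
  have := smul_mem_finDeg (hf x) (hD x)
  rwa [sub_add_cancel] at this

theorem finProj_linearCombination {D : X' → X →₀ B} (hD : ∀ x, D x ∈ finDeg 𝓑 deg (deg' x))
    (d : ℤ) (f : X' →₀ B) : finProj 𝓑 deg d (Finsupp.linearCombination B D f) =
      Finsupp.linearCombination B D (finProj 𝓑 deg' d f) := by
  induction f using finDeg_induction (𝓑 := 𝓑) (deg := deg') with
  | hadd f g hf hg => simp only [map_add, hf, hg]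
  | h e f hf =>
    by_cases h : e = d
    · subst h
      rw [finProj_same hf, finProj_same (linearCombination_mem_finDeg hD hf)]
    · rw [finProj_ne hf h, finProj_ne (linearCombination_mem_finDeg hD hf) h, map_zero]

theorem IsConnectedGraded.eq_zero_of_mem_finDeg (hB : IsConnectedGraded 𝓑)
    (hdeg : ∀ x, 0 ≤ deg x) {d : ℤ} (hd : d < 0) {f : X →₀ B} (hf : f ∈ finDeg 𝓑 deg d) : f = 0 :=
  Finsupp.ext fun x => hB.eq_zero_of_neg (by have := hdeg x; omega) (hf x)

/-- Lift to `W` a basis of the image of `W` in `V / N`. -/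
theorem exists_lift_basis {V : Type u} [AddCommGroup V] [Module k V] (N W : Submodule k V) :
    ∃ (J : Type u) (w : J → V), (∀ j, w j ∈ W) ∧
      (∀ f ∈ W, ∃ c, f - Finsupp.linearCombination k w c ∈ N) ∧
      ∀ c, Finsupp.linearCombination k w c ∈ N → c = 0 := by
  let b := Module.Basis.ofVectorSpace k (W.map N.mkQ)
  have hb : ∀ j, ∃ w ∈ W, N.mkQ w = b j := fun j => (b j).2
  choose w hw hwb using hb
  have key : ∀ c, N.mkQ (Finsupp.linearCombination k w c) =
      (Finsupp.linearCombination k b c : W.map N.mkQ) := fun c => by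
    rw [Finsupp.linearCombination_apply, Finsupp.linearCombination_apply, Finsupp.sum,
      Finsupp.sum, map_sum, AddSubmonoidClass.coe_finsetSum]
    exact Finset.sum_congr rfl fun j _ => by rw [map_smul, hwb]; rfl
  refine ⟨_, w, hw, fun f hf => ?_, fun c hc => ?_⟩
  · refine ⟨b.repr ⟨N.mkQ f, Submodule.mem_map_of_mem hf⟩, ?_⟩
    refine (Submodule.Quotient.mk_eq_zero N).1 ?_
    change N.mkQ _ = 0
    rw [map_sub, key, b.linearCombination_repr, sub_self]
  · have h := (key c).symm.trans ((Submodule.Quotient.mk_eq_zero N).2 hc)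
    exact b.linearIndependent (by rw [map_zero]; exact Subtype.ext h)

/-- The space spanned by the products of elements of positive degree and elements of `K`. -/
def decomposables (𝓑 : ℤ → Submodule k B) [GradedAlgebra 𝓑] (deg : X → ℤ) (K : Submodule B (X →₀ B))
    (d : ℤ) : Submodule k (X →₀ B) :=
  Submodule.span k {f | ∃ i > 0, ∃ b ∈ 𝓑 i, ∃ g ∈ K, g ∈ finDeg 𝓑 deg (d - i) ∧ f = b • g}

/-- A homogeneous submodule of a graded free module has a minimal set of generators. -/
theorem IsConnectedGraded.exists_minimal_generators (hB : IsConnectedGraded 𝓑)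
    (hdeg : ∀ x, 0 ≤ deg x) (K : Submodule B (X →₀ B))
    (hK : ∀ f ∈ K, ∀ d, finProj 𝓑 deg d f ∈ K) :
    ∃ (X' : Type u) (deg' : X' → ℤ) (D : X' → X →₀ B), (∀ x, 0 ≤ deg' x) ∧
      (∀ x, D x ∈ finDeg 𝓑 deg (deg' x)) ∧
      LinearMap.range (Finsupp.linearCombination B D) = K ∧
      ∀ f, Finsupp.linearCombination B D f = 0 → ∀ x, hB.augm (f x) = 0 := by
  -- The generators of degree `d` lift a basis of `K_d` modulo decomposable elements. Natural
  -- degrees suffice because `K_d = 0` for `d < 0`.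
  choose J w hw hspan hind using fun d : ℕ =>
    exists_lift_basis (decomposables 𝓑 deg K d) (K.restrictScalars k ⊓ finDeg 𝓑 deg d)
  let D : (Σ d, J d) → X →₀ B := fun x => w x.1 x.2
  let deg' : (Σ d, J d) → ℤ := fun x => x.1
  have hD : ∀ x, D x ∈ finDeg 𝓑 deg (deg' x) := fun x => (hw x.1 x.2).2
  refine ⟨_, deg', D, fun x => Int.natCast_nonneg _, hD, le_antisymm ?_ ?_, ?_⟩
  · rintro _ ⟨f, rfl⟩
    rw [Finsupp.linearCombination_apply]
    exact sum_mem fun x _ => K.smul_mem _ (hw x.1 x.2).1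
  · have key : ∀ d : ℕ, ∀ f ∈ K, f ∈ finDeg 𝓑 deg d →
        f ∈ LinearMap.range (Finsupp.linearCombination B D) := by
      intro d
      induction d using Nat.strong_induction_on with
      | _ d ih =>
        intro f hf hfd
        obtain ⟨c, hc⟩ := hspan d f ⟨hf, hfd⟩
        rw [← sub_add_cancel f (Finsupp.linearCombination k (w d) c)]
        refine add_mem ?_ ?_
        · have hle : decomposables 𝓑 deg K d ≤
              (LinearMap.range (Finsupp.linearCombination B D)).restrictScalars k := by
            refine Submodule.span_le.2 ?_
            rintro _ ⟨i, hi, b, hb, g, hg, hgd, rfl⟩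
            refine Submodule.smul_mem _ b ?_
            rcases lt_or_ge ((d : ℤ) - i) 0 with h | h
            · rw [hB.eq_zero_of_mem_finDeg hdeg h hgd]
              exact zero_mem _
            · obtain ⟨e, he⟩ := Int.eq_ofNat_of_zero_le h
              exact ih e (by omega) g hg (he ▸ hgd)
          exact hle hc
        · rw [Finsupp.linearCombination_apply]
          refine sum_mem fun j _ => ?_
          change c j • w d j ∈ _
          rw [← algebraMap_smul B]
          exact Submodule.smul_mem _ _ ⟨Finsupp.single ⟨d, j⟩ 1, by simp [D]⟩
    intro f hf
    obtain ⟨s, hs⟩ := exists_sum_finProj (𝓑 := 𝓑) (deg := deg) f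
    rw [← hs]
    refine sum_mem fun d _ => ?_
    rcases lt_or_ge d 0 with h | h
    · rw [hB.eq_zero_of_mem_finDeg hdeg h (finProj_mem d f)]
      exact zero_mem _
    · obtain ⟨e, rfl⟩ := Int.eq_ofNat_of_zero_le h
      exact key e _ (hK f hf _) (finProj_mem _ f)
  · rintro f hf ⟨d, j⟩
    -- Minimality: in the part of degree `d` of a relation, the generators of degree `d` have scalar
    -- coefficients and all other terms are decomposable. So the scalars vanish by independence
    -- modulo decomposables.
    have hf' : Finsupp.linearCombination B D (finProj 𝓑 deg' d f) = 0 := by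
      rw [← finProj_linearCombination hD, hf, map_zero]
    have hinj : Function.Injective (Sigma.mk (β := J) d) := sigma_mk_injective
    let c : J d →₀ k := (f.comapDomain (Sigma.mk d) hinj.injOn).mapRange hB.augm (map_zero _)
    suffices h : c = 0 by simpa [c] using DFunLike.congr_fun h j
    refine hind d c ?_
    have h1 : Finsupp.linearCombination B D
        ((c.mapRange (algebraMap k B) (map_zero _)).mapDomain (Sigma.mk d)) =
          Finsupp.linearCombination k (w d) c := by
      rw [Finsupp.linearCombination_mapDomain, Finsupp.linearCombination_apply,
        Finsupp.linearCombination_apply, Finsupp.sum_mapRange_index (by simp)]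
      simp [D]
    have h2 : ∀ g : (Σ d, J d) →₀ B, g ∈ finDeg 𝓑 deg' d → (∀ j, g ⟨d, j⟩ = 0) →
        Finsupp.linearCombination B D g ∈ decomposables 𝓑 deg K d := by
      intro g hg hgj
      rw [Finsupp.linearCombination_apply]
      refine sum_mem ?_
      rintro ⟨e, i⟩ -
      change g ⟨e, i⟩ • w e i ∈ _
      rcases lt_trichotomy e d with h | rfl | h
      · refine Submodule.subset_span ⟨(d : ℤ) - e, by omega, _, hg ⟨e, i⟩, _, (hw e i).1, ?_, rfl⟩
        rw [sub_sub_cancel]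
        exact (hw e i).2
      · rw [hgj, zero_smul]
        exact zero_mem _
      · rw [hB.eq_zero_of_neg (i := d - e) (by omega) (hg ⟨e, i⟩), zero_smul]
        exact zero_mem _
    have h3 : ∀ (e : ℕ) i, ((c.mapRange (algebraMap k B) (map_zero _)).mapDomain (Sigma.mk d))
        ⟨e, i⟩ ∈
        𝓑 (d - e) := by
      intro e i
      by_cases he : e = d
      · subst he
        rw [Finsupp.mapDomain_apply hinj, Finsupp.mapRange_apply, sub_self]
        exact SetLike.algebraMap_mem_graded 𝓑 _
      · rw [Finsupp.mapDomain_of_notMem_range]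
        · exact zero_mem _
        · rintro ⟨i', hi'⟩
          exact he (congrArg Sigma.fst hi').symm
    rw [← h1, ← neg_mem_iff, ← map_neg, ← zero_add (Finsupp.linearCombination B D _), ← hf',
      ← map_add, ← sub_eq_add_neg]
    refine h2 _ (sub_mem (finProj_mem _ _) fun x => h3 _ _) fun i => ?_
    rw [Finsupp.sub_apply, Finsupp.mapDomain_apply hinj, Finsupp.mapRange_apply, finProj_apply,
      sub_eq_zero]
    change gproj 𝓑 (d - d) _ = algebraMap k B (hB.augm _)
    rw [hB.algebraMap_augm, sub_self]
    rfl

end FreeGraded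

/-! ### Iterated syzygies of a homogeneous submodule -/

section MinimalResolution

variable {k B : Type u} [Field k] [Ring B] [Algebra k B] {𝓑 : ℤ → Submodule k B}
  [GradedAlgebra 𝓑]

variable (𝓑) in
/-- A homogeneous submodule of a graded free module on generators of nonnegative degrees. -/
structure HomogSub where
  X : Type u
  deg : X → ℤ
  deg_nonneg : ∀ x, 0 ≤ deg x
  K : Submodule B (X →₀ B)
  homog : ∀ f ∈ K, ∀ d, finProj 𝓑 deg d f ∈ K

namespace HomogSub

variable (hB : IsConnectedGraded 𝓑)

/-- The generators of a homogeneous submodule. -/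
def Gen (S : HomogSub 𝓑) : Type u :=
  (hB.exists_minimal_generators S.deg_nonneg S.K S.homog).choose

/-- The degrees of the generators of a homogeneous submodule. -/
def genDeg (S : HomogSub 𝓑) : S.Gen hB → ℤ :=
  (hB.exists_minimal_generators S.deg_nonneg S.K S.homog).choose_spec.choose

/-- The generators of a homogeneous submodule, as its elements. -/
def gen (S : HomogSub 𝓑) : S.Gen hB → S.X →₀ B :=
  (hB.exists_minimal_generators S.deg_nonneg S.K S.homog).choose_spec.choose_spec.choose

theorem gen_spec (S : HomogSub 𝓑) : (∀ x, 0 ≤ S.genDeg hB x) ∧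
    (∀ x, S.gen hB x ∈ finDeg 𝓑 S.deg (S.genDeg hB x)) ∧
    LinearMap.range (Finsupp.linearCombination B (S.gen hB)) = S.K ∧
    ∀ f, Finsupp.linearCombination B (S.gen hB) f = 0 → ∀ x, hB.augm (f x) = 0 :=
  (hB.exists_minimal_generators S.deg_nonneg S.K S.homog).choose_spec.choose_spec.choose_spec

/-- The relations between the generators of a homogeneous submodule. -/
def next (S : HomogSub 𝓑) : HomogSub 𝓑 where
  X := S.Gen hB
  deg := S.genDeg hB
  deg_nonneg := (S.gen_spec hB).1
  K := LinearMap.ker (Finsupp.linearCombination B (S.gen hB))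
  homog f hf d := by
    rw [LinearMap.mem_ker] at hf ⊢
    rw [← finProj_linearCombination (S.gen_spec hB).2.1, hf, map_zero]

/-- The iterated relations. -/
def syz (S : HomogSub 𝓑) : ℕ → HomogSub 𝓑
  | 0 => S
  | n + 1 => (syz S n).next hB

/-- The matrices of the minimal free resolution. -/
def mat (S : HomogSub 𝓑) (i : ℕ) : (S.syz hB (i + 1)).X → (S.syz hB i).X →₀ B :=
  (S.syz hB i).gen hB

theorem mat_mem (S : HomogSub 𝓑) (i : ℕ) (x : (S.syz hB (i + 1)).X) (y : (S.syz hB i).X) :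
    S.mat hB i x y ∈ 𝓑 ((S.syz hB (i + 1)).deg x - (S.syz hB i).deg y) :=
  ((S.syz hB i).gen_spec hB).2.1 x y

theorem range_mat (S : HomogSub 𝓑) (i : ℕ) :
    LinearMap.range (Finsupp.linearCombination B (S.mat hB i)) = (S.syz hB i).K :=
  ((S.syz hB i).gen_spec hB).2.2.1

theorem mat_apply_mem (S : HomogSub 𝓑) (i : ℕ) (x : (S.syz hB (i + 1)).X) :
    S.mat hB i x ∈ (S.syz hB i).K := by
  rw [← range_mat]
  exact ⟨Finsupp.single x 1, by simp⟩

theorem mat_exact (S : HomogSub 𝓑) (i : ℕ) :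
    Function.Exact (rowMap (X := fun i => (S.syz hB i).X) (S.mat hB) (i + 1))
      (rowMap (X := fun i => (S.syz hB i).X) (S.mat hB) i) :=
  LinearMap.exact_iff.2 (S.range_mat hB (i + 1)).symm

/-- A row of this matrix is a relation between the minimal generators chosen one step before, so its
coefficients have zero augmentation. -/
theorem augm_mat_succ (S : HomogSub 𝓑) (i : ℕ) (x : (S.syz hB (i + 2)).X)
    (y : (S.syz hB (i + 1)).X) : hB.augm (S.mat hB (i + 1) x y) = 0 :=
  ((S.syz hB i).gen_spec hB).2.2.2 _ (S.mat_apply_mem hB (i + 1) x) y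

end HomogSub

end MinimalResolution

/-! ### The minimal bimodule resolution of a connected graded algebra -/

section MinRes

variable {k A : Type u} [Field k] [Ring A] [Algebra k A] {𝒜 : ℤ → Submodule k A}
  [GradedAlgebra 𝒜]

theorem IsConnectedGraded.augm_op (hA : IsConnectedGraded 𝒜) (a : Aᵐᵒᵖ) :
    hA.op.augm a = hA.augm a.unop := by
  refine (AlgHom.congr_fun (hA.op.augm_unique ((AlgHom.fromOpposite hA.augm
    fun _ _ => Commute.all _ _)) fun i hi a ha => ?_) a).symm
  obtain ⟨b, hb, rfl⟩ := ha
  exact hA.augm_eq_zero hi.ne' hb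

theorem IsConnectedGraded.augm_env_tmul (hA : IsConnectedGraded 𝒜) (a : A) (b : Aᵐᵒᵖ) :
    (hA.tot hA.op).augm (a ⊗ₜ[k] b) = hA.augm a * hA.augm b.unop := by
  rw [hA.augm_tot_tmul hA.op, hA.augm_op]

variable (𝒜) in
/-- The total grading of the enveloping algebra. -/
abbrev envGrading : ℤ → Submodule k (Env k A) := totGrading 𝒜 (opGrading 𝒜)

/-- A minimal graded free resolution of a connected graded algebra as a bimodule. -/
structure MinRes (hA : IsConnectedGraded 𝒜) extends FreeRes (bimod k A) where
  deg : ∀ i, X i → ℤ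
  mem : ∀ i x y, M i x y ∈ envGrading 𝒜 (deg (i + 1) x - deg i y)
  augm : ∀ i x y, (hA.tot hA.op).augm (M i x y) = 0
  deg_nonneg : ∀ i x, 0 ≤ deg i x
  deg_zero : ∀ x, deg 0 x = 0
  aug_single : ∀ x, aug (Finsupp.single x 1) = (1 : A)

variable (k A) in
/-- Multiplication, as the augmentation of the resolution. -/
def mulAug : (PUnit.{u + 1} →₀ Env k A) →ₗ[Env k A] bimod k A :=
  Finsupp.linearCombination (Env k A) fun _ => (1 : A)

theorem mulAug_single (x : PUnit) (a : A) (b : Aᵐᵒᵖ) :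
    mulAug k A (Finsupp.single x (a ⊗ₜ b)) = (a * b.unop : A) := by
  refine (Finsupp.linearCombination_single _ _ _).trans ((bimod_smul' _ _ _).trans ?_)
  exact congrArg (· * b.unop) (mul_one a)

theorem mulAug_single_one (x : PUnit) : mulAug k A (Finsupp.single x 1) = (1 : A) := by
  rw [Algebra.TensorProduct.one_def, mulAug_single, MulOpposite.unop_one, mul_one]

variable (k A) in
theorem mulAug_surjective : Function.Surjective (mulAug k A) := fun a =>
  ⟨Finsupp.single PUnit.unit ((show A from a) ⊗ₜ 1),
    (mulAug_single _ _ _).trans (mul_one (show A from a))⟩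

theorem punit_finsupp_induction {P : (PUnit.{u + 1} →₀ Env k A) → Prop}
    (f : PUnit.{u + 1} →₀ Env k A)
    (hadd : ∀ f g, P f → P g → P (f + g))
    (h : ∀ i, ∀ a ∈ 𝒜 i, ∀ b, P (Finsupp.single PUnit.unit (a ⊗ₜ b))) : P f := by
  induction f using env_finsupp_induction with
  | h0 => simpa using h 0 0 (zero_mem _) 0
  | hadd f g hf hg => exact hadd f g hf hg
  | h x a b =>
    induction a using graded_induction (𝒜 := 𝒜) with
    | hadd a a' ha ha' => rw [TensorProduct.add_tmul, Finsupp.single_add]; exact hadd _ _ ha ha'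
    | h i a ha => exact h i a ha b

theorem gproj_op (d : ℤ) (b : Aᵐᵒᵖ) :
    (gproj (opGrading 𝒜) d b).unop = gproj 𝒜 d b.unop := by
  induction b using graded_induction (𝒜 := opGrading 𝒜) with
  | hadd a b ha hb => rw [map_add, MulOpposite.unop_add, ha, hb, MulOpposite.unop_add, map_add]
  | h i b hb =>
    have hb' : b.unop ∈ 𝒜 i := op_mem_opGrading.1 hb
    by_cases h : i = d
    · subst h
      rw [gproj_same hb, gproj_same hb']
    · rw [gproj_ne hb h, gproj_ne hb' h, MulOpposite.unop_zero]

theorem mulAug_finProj (d : ℤ) (f : PUnit.{u + 1} →₀ Env k A) :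
    mulAug k A (finProj (envGrading 𝒜) (fun _ => 0) d f) =
      gproj 𝒜 d (show A from mulAug k A f) := by
  induction f using punit_finsupp_induction (𝒜 := 𝒜) with
  | hadd f g hf hg =>
    rw [map_add, map_add, hf, hg, map_add]
    exact (map_add (gproj 𝒜 d) _ _).symm
  | h i a ha b =>
    rw [finProj_single, gproj_totGrading _ ha, mulAug_single, mulAug_single, gproj_op, sub_zero]
    exact (gproj_mul_left ha d _).symm

theorem IsConnectedGraded.augm_mulAug (hA : IsConnectedGraded 𝒜) (f : PUnit.{u + 1} →₀ Env k A) :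
    hA.augm (show A from mulAug k A f) = (hA.tot hA.op).augm (f PUnit.unit) := by
  induction f using punit_finsupp_induction (𝒜 := 𝒜) with
  | hadd f g hf hg =>
    rw [Finsupp.add_apply, map_add, map_add, ← hf, ← hg]
    exact map_add hA.augm _ _
  | h i a ha b =>
    rw [mulAug_single, Finsupp.single_eq_same, hA.augm_env_tmul]
    exact map_mul hA.augm _ _

/-- Multiplication is compatible with the augmentations, so the first syzygies satisfy the
minimality condition as well. -/
theorem IsConnectedGraded.augm_eq_zero_of_mulAug (hA : IsConnectedGraded 𝒜)
    {f : PUnit.{u + 1} →₀ Env k A} (h : mulAug k A f = 0) :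
    (hA.tot hA.op).augm (f PUnit.unit) = 0 := by
  rw [← hA.augm_mulAug, h]
  exact map_zero hA.augm

variable (𝒜) in
/-- The relations of a graded algebra as a bimodule. -/
def mulKer : HomogSub (envGrading 𝒜) where
  X := PUnit
  deg _ := 0
  deg_nonneg _ := le_rfl
  K := LinearMap.ker (mulAug k A)
  homog f hf d := by
    rw [LinearMap.mem_ker] at hf ⊢
    rw [mulAug_finProj, hf]
    exact map_zero (gproj 𝒜 d)

theorem IsConnectedGraded.nonempty_minRes (hA : IsConnectedGraded 𝒜) : Nonempty (MinRes hA) :=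
  ⟨{ X := fun i => ((mulKer 𝒜).syz (hA.tot hA.op) i).X
     M := (mulKer 𝒜).mat (hA.tot hA.op)
     aug := mulAug k A
     surjective := mulAug_surjective k A
     exact_zero := LinearMap.exact_iff.2 ((mulKer 𝒜).range_mat (hA.tot hA.op) 0).symm
     exact_succ := (mulKer 𝒜).mat_exact (hA.tot hA.op)
     deg := fun i => ((mulKer 𝒜).syz (hA.tot hA.op) i).deg
     mem := (mulKer 𝒜).mat_mem (hA.tot hA.op)
     augm := fun i => by
       cases i with
       | zero =>
         exact fun x y => hA.augm_eq_zero_of_mulAug ((mulKer 𝒜).mat_apply_mem (hA.tot hA.op) 0 x)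
       | succ i => exact (mulKer 𝒜).augm_mat_succ (hA.tot hA.op) i
     deg_nonneg := fun i => ((mulKer 𝒜).syz (hA.tot hA.op) i).deg_nonneg
     deg_zero := fun _ => rfl
     aug_single := mulAug_single_one }⟩

end MinRes

/-! ### The induced resolution of the trivial module -/

section Reduction

variable {k A C : Type u} [Field k] [Ring A] [Algebra k A] [Ring C] [Algebra k C]
  {𝒜 : ℤ → Submodule k A} {𝒞 : ℤ → Submodule k C} [GradedAlgebra 𝒜] [GradedAlgebra 𝒞]

variable (A) in
/-- The homomorphism `A ⊗ C → A` induced by the augmentation of `C`. -/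
def IsConnectedGraded.red (hC : IsConnectedGraded 𝒞) : A ⊗[k] C →ₐ[k] A :=
  Algebra.TensorProduct.lift (AlgHom.id k A) ((Algebra.ofId k A).comp hC.augm)
    fun a c => (Algebra.commute_algebraMap_left (hC.augm c) a).symm

theorem IsConnectedGraded.red_tmul (hC : IsConnectedGraded 𝒞) (a : A) (c : C) :
    hC.red A (a ⊗ₜ c) = hC.augm c • a := by
  refine (Algebra.TensorProduct.lift_tmul _ _ _ _ _).trans ?_
  rw [Algebra.smul_def]
  exact (Algebra.commutes (hC.augm c) a).symm

theorem IsConnectedGraded.red_mem (hC : IsConnectedGraded 𝒞) {d : ℤ} {b : A ⊗[k] C}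
    (hb : b ∈ totGrading 𝒜 𝒞 d) : hC.red A b ∈ 𝒜 d := by
  induction hb using totGrading_induction with
  | h0 => rw [map_zero]; exact zero_mem _
  | hadd x y _ _ hx hy => rw [map_add]; exact add_mem hx hy
  | h i j hij a ha c hc =>
    rw [hC.red_tmul]
    by_cases hj : j = 0
    · obtain rfl : i = d := by omega
      exact Submodule.smul_mem _ _ ha
    · rw [hC.augm_eq_zero hj hc, zero_smul]
      exact zero_mem _

theorem IsConnectedGraded.augm_red (hA : IsConnectedGraded 𝒜) (hC : IsConnectedGraded 𝒞)
    (b : A ⊗[k] C) : hA.augm (hC.red A b) = (hA.tot hC).augm b := by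
  induction b with
  | zero => simp only [map_zero]
  | add x y hx hy => simp only [map_add, hx, hy]
  | tmul a c => rw [hC.red_tmul, hA.augm_tot_tmul hC, map_smul, smul_eq_mul, mul_comm]

end Reduction

/-! ### Reduction of the matrices along `A ⊗ A° → A` -/

section Rows

variable {k A : Type u} [Field k] [Ring A] [Algebra k A] {𝒜 : ℤ → Submodule k A}
  [GradedAlgebra 𝒜] {hA : IsConnectedGraded 𝒜} {X X' : Type u}

variable (hA) in
/-- The map of free modules induced by `A ⊗ A° → A`. -/
def redF : (X →₀ Env k A) →ₗ[k] (X →₀ A) := Finsupp.mapRange.linearMap (hA.op.red A).toLinearMap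

theorem redF_apply (f : X →₀ Env k A) (x : X) : redF hA f x = hA.op.red A (f x) := rfl

theorem redF_single (x : X) (b : Env k A) :
    redF hA (Finsupp.single x b) = Finsupp.single x (hA.op.red A b) := by
  simp [redF]

theorem redF_smul (b : Env k A) (f : X →₀ Env k A) : redF hA (b • f) = hA.op.red A b • redF hA f :=
  Finsupp.ext fun x => by
    rw [redF_apply, Finsupp.smul_apply, smul_eq_mul, map_mul, Finsupp.smul_apply, redF_apply,
      smul_eq_mul]

theorem linearCombination_redF (M : X' → X →₀ Env k A) (f : X' →₀ Env k A) :
    Finsupp.linearCombination A (fun x => redF hA (M x)) (redF hA f) =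
      redF hA (Finsupp.linearCombination (Env k A) M f) := by
  induction f using Finsupp.induction_linear with
  | zero => simp only [map_zero]
  | add f g hf hg => simp only [map_add, hf, hg]
  | single x b =>
    rw [redF_single, Finsupp.linearCombination_single, Finsupp.linearCombination_single, redF_smul]

variable (hA) in
/-- The action on the trivial module. -/
def trivAct : A →ₐ[k] Module.End k k := (Algebra.lmul k k).comp hA.augm

variable (k A X) in
/-- The identification of `A ⊗ k` and `A`, on free modules. -/
def ridF : (X →₀ A ⊗[k] k) ≃ₗ[k] (X →₀ A) :=
  Finsupp.mapRange.linearEquiv (TensorProduct.rid k A)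

theorem rid_ev (c : k) (b : Env k A) :
    TensorProduct.rid k A (ev (trivAct hA) c b) = c • hA.op.red A b := by
  induction b using TensorProduct.induction_on with
  | zero => simp only [map_zero, smul_zero]
  | add x y hx hy => rw [map_add, map_add, hx, hy, map_add, smul_add]
  | tmul a b =>
    rw [ev_tmul, TensorProduct.rid_tmul, hA.op.red_tmul, smul_smul, hA.augm_op, mul_comm]
    rfl

theorem ridF_evF (c : k) (f : X →₀ Env k A) :
    ridF k A X (evF (trivAct hA) c f) = c • redF hA f :=
  Finsupp.ext fun x => rid_ev c (f x)

variable (R : MinRes hA)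

/-- The matrices of the induced resolution of the trivial module. -/
def MinRes.redM (i : ℕ) (x : R.X (i + 1)) : R.X i →₀ A := redF hA (R.M i x)

theorem MinRes.redM_mem (i : ℕ) (x : R.X (i + 1)) (y : R.X i) :
    R.redM i x y ∈ 𝒜 (R.deg (i + 1) x - R.deg i y) := hA.op.red_mem (R.mem i x y)

theorem MinRes.augm_redM (i : ℕ) (x : R.X (i + 1)) (y : R.X i) : hA.augm (R.redM i x y) = 0 :=
  (hA.augm_red hA.op _).trans (R.augm i x y)

theorem MinRes.ridF_tensorD (i : ℕ) (z : R.X (i + 1) →₀ A ⊗[k] k) :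
    ridF k A (R.X i) (tensorD R.toFreeRes (trivAct hA) i z) =
      rowMap R.redM i (ridF k A (R.X (i + 1)) z) := by
  induction z using tensor_finsupp_induction (ρ := trivAct hA) with
  | hadd f g hf hg => rw [map_add, map_add, hf, hg, map_add, map_add]
  | h c f =>
    rw [tensorMap_evF _ (isRightLinear_kd R.toFreeRes i), ridF_evF, ridF_evF]
    refine Eq.trans ?_ (LinearMap.map_smul_of_tower (rowMap R.redM i) c _).symm
    exact congrArg (c • ·) (linearCombination_redF (R.M i) f).symm

/-- The reduced matrices describe `P ⊗_A k`, where `A` acts on `k` through the augmentation and `A ⊗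
k` is identified with `A`. -/
theorem MinRes.redM_exact_succ (i : ℕ) :
    Function.Exact (rowMap R.redM (i + 1)) (rowMap R.redM i) := by
  have h := tensor_exact_succ R.toFreeRes (trivAct hA) i
  intro f
  obtain ⟨z, rfl⟩ := (ridF k A _).surjective f
  rw [← R.ridF_tensorD, LinearEquiv.map_eq_zero_iff, h z]
  constructor
  · rintro ⟨z', rfl⟩
    exact ⟨_, (R.ridF_tensorD _ _).symm⟩
  · rintro ⟨g, hg⟩
    obtain ⟨z', rfl⟩ := (ridF k A _).surjective g
    rw [← R.ridF_tensorD] at hg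
    exact ⟨z', (ridF k A _).injective hg⟩

/-- The sum of the coefficients. -/
abbrev coeffSum (X : Type u) (A : Type u) [Ring A] : (X →₀ A) →ₗ[A] A :=
  Finsupp.linearCombination A fun _ => 1

theorem MinRes.kaug_single (x : R.X 0) (a : A) (b : Aᵐᵒᵖ) :
    kaug R.toFreeRes (Finsupp.single x (a ⊗ₜ b)) = a * b.unop := by
  have h : Finsupp.single x (a ⊗ₜ b : Env k A) = (a ⊗ₜ b : Env k A) • Finsupp.single x 1 := by
    rw [Finsupp.smul_single, smul_eq_mul, mul_one]
  rw [h]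
  refine (R.aug.map_smul _ _).trans ((congrArg _ (R.aug_single x)).trans ?_)
  exact (bimod_smul' _ _ _).trans (congrArg (· * b.unop) (mul_one a))

theorem MinRes.augm_kaug (f : R.X 0 →₀ Env k A) :
    hA.augm (kaug R.toFreeRes f) = hA.augm (coeffSum _ A (redF hA f)) := by
  induction f using env_finsupp_induction with
  | h0 => simp only [map_zero]
  | hadd f g hf hg => simp only [map_add, hf, hg]
  | h x a b =>
    rw [R.kaug_single, redF_single, Finsupp.linearCombination_single, hA.op.red_tmul, smul_eq_mul,
      mul_one, map_mul, map_smul, smul_eq_mul, hA.augm_op, mul_comm]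

theorem MinRes.tensorAug_eq (z : R.X 0 →₀ A ⊗[k] k) :
    tensorAug R.toFreeRes (trivAct hA) z = hA.augm (coeffSum _ A (ridF k A _ z)) := by
  induction z using tensor_finsupp_induction (ρ := trivAct hA) with
  | hadd f g hf hg => simp only [map_add, hf, hg]
  | h c f =>
    rw [tensorAug_evF, ridF_evF, LinearMap.map_smul_of_tower, map_smul, ← R.augm_kaug, smul_eq_mul,
      mul_comm]
    rfl

theorem MinRes.redM_exact_zero (f : R.X 0 →₀ A) :
    hA.augm (coeffSum _ A f) = 0 ↔ f ∈ Set.range (rowMap R.redM 0) := by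
  have h := tensor_exact_zero R.toFreeRes (trivAct hA)
  obtain ⟨z, rfl⟩ := (ridF k A _).surjective f
  rw [← R.tensorAug_eq, h z]
  constructor
  · rintro ⟨z', rfl⟩
    exact ⟨_, (R.ridF_tensorD _ _).symm⟩
  · rintro ⟨g, hg⟩
    obtain ⟨z', rfl⟩ := (ridF k A _).surjective g
    rw [← R.ridF_tensorD] at hg
    exact ⟨z', (ridF k A _).injective hg⟩

theorem MinRes.nonempty_zero : Nonempty (R.X 0) := by
  by_contra h
  rw [not_nonempty_iff] at h
  obtain ⟨f, hf⟩ := R.surjective (1 : A)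
  have h1 : (1 : A) = 0 := by
    rw [← hf, Subsingleton.elim f 0]
    exact map_zero R.aug
  have h2 : hA.augm 1 = 0 := by rw [h1, map_zero]
  rw [map_one] at h2
  exact one_ne_zero h2

end Rows

/-! ### Free graded modules -/

section FreeGrMod

variable {k A : Type u} [Field k] [Ring A] [Algebra k A] {𝒜 : ℤ → Submodule k A}
  [GradedAlgebra 𝒜]

namespace GrMod

variable (𝒜) in
/-- The free graded module on generators of the given degrees. -/
def free {X : Type u} (deg : X → ℤ) : GrMod 𝒜 where
  mod := ModuleCat.of A (X →₀ A)
  deg d := (finDeg 𝒜 deg d).toAddSubgroup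
  isInternal := by
    refine isInternal_of_proj _ (fun d => (finProj 𝒜 deg d).toAddMonoidHom) ?_ ?_ ?_
    · exact fun i m hm => finProj_same hm
    · exact fun i j hij m hm => finProj_ne hm hij.symm
    · intro m
      obtain ⟨s, hs⟩ := exists_sum_finProj (𝓑 := 𝒜) (deg := deg) m
      exact hs ▸ sum_mem fun i _ => AddSubgroup.mem_iSup_of_mem i (finProj_mem i m)
  smul_mem ha hm := smul_mem_finDeg ha hm

variable {X X' : Type u} {deg : X → ℤ} {deg' : X' → ℤ}

/-- The homomorphism from a free graded module with the given values on the generators. -/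
def freeHom {Y : GrMod 𝒜} (v : X → Y.mod) (hv : ∀ x, v x ∈ Y.deg (deg x)) : free 𝒜 deg ⟶ Y :=
  mkHom (X := free 𝒜 deg) (Finsupp.linearCombination A v) fun i f hf => by
    refine sum_mem fun x _ => ?_
    have := Y.smul_mem (hf x) (hv x)
    rwa [sub_add_cancel] at this

theorem freeHom_single {Y : GrMod 𝒜} (v : X → Y.mod) (hv : ∀ x, v x ∈ Y.deg (deg x)) (x : X) :
    lin (freeHom v hv) (Finsupp.single x (1 : A) : X →₀ A) = v x :=
  (Finsupp.linearCombination_single A (v := v) 1 x).trans (one_smul A (v x))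

theorem single_mem_free (x : X) :
    (show (free 𝒜 deg).mod from Finsupp.single x (1 : A)) ∈ (free 𝒜 deg).deg (deg x) := by
  have h := single_mem_finDeg (deg := deg) (SetLike.GradedOne.one_mem (A := 𝒜)) x
  rw [zero_add] at h
  exact h

theorem free_hom_ext {Y : GrMod 𝒜} {f g : free 𝒜 deg ⟶ Y}
    (h : ∀ x, lin f (Finsupp.single x (1 : A) : X →₀ A) =
      lin g (Finsupp.single x (1 : A) : X →₀ A)) : f = g := by
  have h' : (show (X →₀ A) →ₗ[A] Y.mod from lin f) = (show (X →₀ A) →ₗ[A] Y.mod from lin g) :=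
    Finsupp.lhom_ext' fun x => LinearMap.ext_ring (h x)
  exact hom_ext fun m => LinearMap.congr_fun h' m

theorem exists_freeHom {Y : GrMod 𝒜} (f : free 𝒜 deg ⟶ Y) : ∃ v hv, f = freeHom v hv :=
  ⟨fun x => lin f (Finsupp.single x (1 : A) : X →₀ A), fun x => lin_mem f (single_mem_free x),
    free_hom_ext fun x =>
      (freeHom_single (fun y => lin f (Finsupp.single y (1 : A) : X →₀ A))
        (fun y => lin_mem f (single_mem_free y)) x).symm⟩

theorem freeHom_inj {Y : GrMod 𝒜} {v w : X → Y.mod} {hv : ∀ x, v x ∈ Y.deg (deg x)}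
    {hw : ∀ x, w x ∈ Y.deg (deg x)} (h : freeHom v hv = freeHom w hw) : v = w :=
  linearCombination_injective (congrArg lin h)

theorem epi_of_surjective {Y Z : GrMod 𝒜} (f : Y ⟶ Z) (hf : Function.Surjective (lin f)) :
    Epi f :=
  ⟨fun g h hgh => hom_ext fun m => by
    obtain ⟨y, rfl⟩ := hf m
    rw [← lin_comp, hgh, lin_comp]⟩

/-- Preimages of the values on the generators are replaced by their homogeneous components of the
right degree. They are still preimages because morphisms commute with the projections. -/
instance projective_free : Projective (free 𝒜 deg) where
  factors {E Y} f e _ := by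
    obtain ⟨v, hv, rfl⟩ := exists_freeHom f
    choose w hw using fun x => surjective_of_epi e (v x)
    refine ⟨freeHom (fun x => E.proj (deg x) (w x)) fun x => E.proj_mem _ _, free_hom_ext fun x =>
      (lin_comp _ _ _).trans ((congrArg (lin e) (freeHom_single _ _ x)).trans
        (Eq.trans ?_ (freeHom_single v hv x).symm))⟩
    rw [lin_proj, hw, Y.proj_same (hv x)]

theorem exact_of_lin {X₁ X₂ X₃ : GrMod 𝒜} {f : X₁ ⟶ X₂} {g : X₂ ⟶ X₃} (w : f ≫ g = 0)
    (h : ∀ y, lin g y = 0 → ∃ x, lin f x = y) : (ShortComplex.mk f g w).Exact := by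
  rw [ShortComplex.exact_iff_epi_kernel_lift]
  refine epi_of_surjective _ fun z => ?_
  obtain ⟨x, hx⟩ := h (lin (kernel.ι g) z) (by rw [← lin_comp, kernel.condition, lin_zero])
  refine ⟨x, injective_of_mono (kernel.ι g) ?_⟩
  rw [← lin_comp]
  exact (congrArg (fun φ => lin φ x) (kernel.lift_ι g f w)).trans hx

end GrMod

theorem IsConnectedGraded.mem_augIdeal (hA : IsConnectedGraded 𝒜) (a : A) :
    a ∈ GrMod.augIdeal 𝒜 ↔ hA.augm a = 0 := by
  constructor
  · intro h
    induction h using Submodule.span_induction with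
    | mem x hx =>
      obtain ⟨i, hi, hx⟩ := hx
      exact hA.augm_eq_zero hi.ne' hx
    | zero => exact map_zero _
    | add x y _ _ hx hy => rw [map_add, hx, hy, add_zero]
    | smul b x _ hx => rw [smul_eq_mul, map_mul, hx, mul_zero]
  · intro h
    obtain ⟨s, hs⟩ := exists_sum_gproj 𝒜 a
    rw [← hs s subset_rfl]
    refine sum_mem fun i _ => ?_
    rcases lt_trichotomy i 0 with hi | rfl | hi
    · rw [hA.gproj_neg hi]
      exact zero_mem _
    · rw [← hA.algebraMap_augm, h, map_zero]
      exact zero_mem _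
    · exact Submodule.subset_span ⟨i, hi, gproj_mem 𝒜 i a⟩

end FreeGrMod

/-! ### The minimal resolution of the trivial module and the shape of `P` -/

section TrivRes

variable {k A : Type u} [Field k] [Ring A] [Algebra k A] {𝒜 : ℤ → Submodule k A}
  [GradedAlgebra 𝒜] {hA : IsConnectedGraded 𝒜} (R : MinRes hA)

open GrMod

namespace MinRes

theorem cob_mem {Y : GrMod 𝒜} {i : ℕ} {v : R.X i → Y.mod} (hv : ∀ x, v x ∈ Y.deg (R.deg i x))
    (x : R.X (i + 1)) : cob R.redM i v x ∈ Y.deg (R.deg (i + 1) x) := by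
  refine sum_mem fun y _ => ?_
  have := Y.smul_mem (R.redM_mem i x y) (hv y)
  rwa [sub_add_cancel] at this

/-- The differential of the induced resolution. -/
def grD (i : ℕ) : GrMod.free 𝒜 (R.deg (i + 1)) ⟶ GrMod.free 𝒜 (R.deg i) :=
  freeHom (Y := GrMod.free 𝒜 (R.deg i)) (R.redM i) (R.redM_mem i)

/-- The augmentation of the induced resolution. -/
def grAug : GrMod.free 𝒜 (R.deg 0) ⟶ triv 𝒜 :=
  freeHom (fun _ => lin (quotπ _ _ (augIdeal_homogeneous 𝒜)) (1 : A)) fun x => by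
    rw [R.deg_zero]
    exact lin_mem (quotπ _ _ (augIdeal_homogeneous 𝒜))
      (show (1 : A) ∈ 𝒜 0 from SetLike.GradedOne.one_mem)

theorem lin_grAug (f : R.X 0 →₀ A) :
    lin R.grAug f = lin (quotπ _ _ (augIdeal_homogeneous 𝒜)) (coeffSum _ A f) := by
  have h : Finsupp.linearCombination A (fun _ : R.X 0 => (augIdeal 𝒜).mkQ 1) =
      (augIdeal 𝒜).mkQ ∘ₗ coeffSum (R.X 0) A :=
    Finsupp.lhom_ext' fun x => LinearMap.ext_ring (by simp)
  exact LinearMap.congr_fun h f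

theorem grAug_eq_zero_iff (f : R.X 0 →₀ A) :
    lin R.grAug f = 0 ↔ f ∈ Set.range (rowMap R.redM 0) := by
  rw [← R.redM_exact_zero, ← hA.mem_augIdeal]
  exact (Eq.congr_left (R.lin_grAug f)).trans (Submodule.Quotient.mk_eq_zero _)

/-- The induced graded free resolution of the trivial module. -/
def trivRes : ProjRes (triv 𝒜) where
  P i := GrMod.free 𝒜 (R.deg i)
  d := R.grD
  aug := R.grAug
  projective _ := inferInstance
  epi_aug := epi_of_surjective _ fun y => by
    obtain ⟨a, rfl⟩ := quotπ_surjective _ _ (augIdeal_homogeneous 𝒜) y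
    obtain ⟨x⟩ := R.nonempty_zero
    refine ⟨(Finsupp.single x (show A from a) : R.X 0 →₀ A), (R.lin_grAug _).trans ?_⟩
    refine congrArg _ ((Finsupp.linearCombination_single _ _ _).trans (mul_one (show A from a)))
  d_aug := hom_ext fun f => (R.grAug_eq_zero_iff _).2 ⟨f, rfl⟩
  d_d i := hom_ext fun f => (R.redM_exact_succ i).apply_apply_eq_zero f
  exact_zero := exact_of_lin _ fun f hf => (R.grAug_eq_zero_iff f).1 hf
  exact_succ i := exact_of_lin _ fun f hf => (R.redM_exact_succ i f).1 hf

theorem grD_freeHom {Y : GrMod 𝒜} {i : ℕ} (v : R.X i → Y.mod) (hv : ∀ x, v x ∈ Y.deg (R.deg i x)) :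
    R.trivRes.d i ≫ (show R.trivRes.P i ⟶ Y from freeHom v hv) =
      freeHom (cob R.redM i v) (R.cob_mem hv) :=
  hom_ext fun f => LinearMap.congr_fun (linearCombination_comp_rowMap R.redM i v) f

/-- Coboundaries of the complex of homogeneous columns. -/
def IsGrCob (Y : GrMod 𝒜) : ∀ {i : ℕ}, (R.X i → Y.mod) → Prop
  | 0, v => v = 0
  | p + 1, v => ∃ w : R.X p → Y.mod, (∀ y, w y ∈ Y.deg (R.deg p y)) ∧ cob R.redM p w = v

variable {R} in
theorem isGrCob_of_isCob {Y : GrMod 𝒜} {i : ℕ} {v : R.X i → Y.mod}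
    {hv : ∀ x, v x ∈ Y.deg (R.deg i x)}
    (h : R.trivRes.IsCob (show R.trivRes.P i ⟶ Y from freeHom v hv)) : R.IsGrCob Y v := by
  cases i with
  | zero => exact linearCombination_injective ((congrArg lin h).trans
      (Finsupp.linearCombination_zero _ _ _).symm)
  | succ p =>
    obtain ⟨g, hg⟩ := h
    obtain ⟨w, hw, rfl⟩ := exists_freeHom g
    exact ⟨w, hw, freeHom_inj ((R.grD_freeHom w hw).symm.trans hg)⟩

theorem isGrCob_of_ext {Y : GrMod 𝒜} {i : ℕ}
    (h : letI := HasExt.standard (GrMod 𝒜); Subsingleton (Abelian.Ext (triv 𝒜) Y i))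
    {v : R.X i → Y.mod} (hv : ∀ x, v x ∈ Y.deg (R.deg i x)) (hc : cob R.redM i v = 0) :
    R.IsGrCob Y v := by
  let _ := HasExt.standard (GrMod 𝒜)
  refine isGrCob_of_isCob (R.trivRes.isCob_of_subsingleton h (freeHom v hv) ?_)
  rw [grD_freeHom]
  exact hom_ext fun f => (congrArg (fun w => Finsupp.linearCombination A w f) hc).trans
    (LinearMap.congr_fun (Finsupp.linearCombination_zero _ _ _) f)

/-- This is how minimality is used: the entries of the differentials have zero augmentation, so
coboundaries die under every map that kills the multiples by such elements. -/
theorem eq_zero_of_isGrCob {Y : GrMod 𝒜} {V : Type*} [AddCommGroup V] (φ : Y.mod →+ V)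
    (hφ : ∀ a m, hA.augm a = 0 → φ (a • m) = 0) {i : ℕ} {v : R.X i → Y.mod}
    (hv : R.IsGrCob Y v) (x : R.X i) : φ (v x) = 0 := by
  cases i with
  | zero => rw [show v = 0 from hv]; exact map_zero φ
  | succ p =>
    obtain ⟨w, -, rfl⟩ := hv
    rw [cob, Finsupp.linearCombination_apply, Finsupp.sum, map_sum]
    exact Finset.sum_eq_zero fun y _ => hφ _ _ (R.augm_redM p x y)

theorem augm_of_isGrCob {d : ℤ} {i : ℕ} {v : R.X i → A}
    (hv : R.IsGrCob ((self 𝒜).shift d) v) (x : R.X i) : hA.augm (v x) = 0 :=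
  R.eq_zero_of_isGrCob (Y := (self 𝒜).shift d) (V := k)
    (show A →+ k from (hA.augm : A →+ k))
    (fun a m h => (map_mul hA.augm a m).trans (by rw [h, zero_mul])) hv x

theorem cob_single {N : Type*} [AddCommGroup N] [Module A N] {i : ℕ}
    [DecidableEq (R.X i)] (x : R.X i) (m : N) (y : R.X (i + 1)) :
    cob R.redM i (Pi.single x m) y = R.redM i y x • m := by
  rw [cob, Finsupp.linearCombination_apply, Finsupp.sum_eq_single x]
  · rw [Pi.single_eq_same]
  · intro z _ hz
    rw [Pi.single_eq_of_ne hz, smul_zero]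
  · intro _
    rw [zero_smul]

/-- By minimality the differential of the complex of homomorphisms to `k` is zero. So a generator
`x` in homological degree `i` gives a nonzero class in `Ext^i(k, k(-deg x))`, and `i` cannot exceed
the global dimension. -/
theorem isEmpty_of_gt {N : ℕ} (hN : ∀ M : GrMod 𝒜, projectiveDimension M ≤ N) {i : ℕ}
    (hi : N < i) : IsEmpty (R.X i) := by
  classical
  by_contra h
  rw [not_isEmpty_iff] at h
  obtain ⟨x⟩ := h
  let π := quotπ _ _ (augIdeal_homogeneous 𝒜)
  have hπ : ∀ a m, hA.augm a = 0 → a • m = (0 : (triv 𝒜).mod) := by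
    intro a m ha
    obtain ⟨b, rfl⟩ := quotπ_surjective _ _ (augIdeal_homogeneous 𝒜) m
    refine ((lin π).map_smul a b).symm.trans ?_
    refine (Submodule.Quotient.mk_eq_zero _).2 ((hA.mem_augIdeal _).2 ?_)
    exact (map_mul hA.augm a _).trans (by rw [ha, zero_mul])
  have h1 : lin π (1 : A) ∈ (triv 𝒜).deg 0 :=
    lin_mem π (show (1 : A) ∈ 𝒜 0 from SetLike.GradedOne.one_mem)
  let _ := HasExt.standard (GrMod 𝒜)
  have hpd : HasProjectiveDimensionLT (triv 𝒜) (N + 1) := (projectiveDimension_le_iff _ _).1 (hN _)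
  have h2 := R.isGrCob_of_ext (Y := (triv 𝒜).shift (-R.deg i x)) (i := i)
    (HasProjectiveDimensionLT.subsingleton _ (N + 1) i hi _)
    (v := Pi.single x (show ((triv 𝒜).shift (-R.deg i x)).mod from lin π (1 : A))) (fun y => ?_)
    (funext fun y => (R.cob_single x _ y).trans (hπ _ _ (R.augm_redM i y x)))
  · have h3 := R.eq_zero_of_isGrCob (Y := (triv 𝒜).shift (-R.deg i x)) (AddMonoidHom.id _) hπ h2 x
    rw [Pi.single_eq_same] at h3
    have h4 := (hA.mem_augIdeal 1).1 ((Submodule.Quotient.mk_eq_zero (augIdeal 𝒜)).1 h3)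
    rw [map_one] at h4
    exact one_ne_zero h4
  · by_cases hy : y = x
    · subst hy
      rw [Pi.single_eq_same]
      change _ ∈ (triv 𝒜).deg (R.deg i y + -R.deg i y)
      rwa [add_neg_cancel]
    · rw [Pi.single_eq_of_ne hy]
      exact zero_mem _

theorem single_one_mem {i : ℕ} [DecidableEq (R.X i)] (x y : R.X i) :
    (Pi.single x 1 : R.X i → A) y ∈ 𝒜 (R.deg i y + -R.deg i x) := by
  by_cases hy : y = x
  · subst hy
    rw [Pi.single_eq_same, add_neg_cancel]
    exact SetLike.GradedOne.one_mem
  · rw [Pi.single_eq_of_ne hy]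
    exact zero_mem _

variable {n : ℕ} {l : ℤ}

/-- If the column were a cocycle, the vanishing of `Ext` would make it a coboundary. But
coboundaries have entries of zero augmentation, and the entry at `x` is `1`. -/
theorem not_cob_single_eq_zero {i : ℕ} [DecidableEq (R.X i)] (x : R.X i)
    (h : Subsingleton (GrExt 𝒜 i (-R.deg i x))) :
    cob R.redM i (Pi.single x 1 : R.X i → A) ≠ 0 := fun hc => by
  have h1 := R.augm_of_isGrCob (R.isGrCob_of_ext (Y := (self 𝒜).shift (-R.deg i x)) h
    (R.single_one_mem x) hc) x
  rw [Pi.single_eq_same, map_one] at h1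
  exact one_ne_zero h1

/-- In the last degree `m` with a generator every column is a cocycle, so that generator gives a
nonzero class in `Ext^m(k, A)`. The Gorenstein condition then forces `m = n`. -/
theorem top_eq (hG : IsLeftGorenstein 𝒜 n l) (hN : ∃ N : ℕ, ∀ M : GrMod 𝒜,
    projectiveDimension M ≤ N) :
    Nonempty (R.X n) ∧ ∀ i > n, IsEmpty (R.X i) := by
  classical
  obtain ⟨N, hN⟩ := hN
  let P : ℕ → Prop := fun i => Nonempty (R.X i)
  have h0 : P 0 := R.nonempty_zero
  have hle : ∀ i, P i → i ≤ N := fun i hi => by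
    by_contra h
    exact not_isEmpty_iff.2 hi (R.isEmpty_of_gt hN (not_le.1 h))
  let m := Nat.findGreatest P N
  have hm : P m := Nat.findGreatest_spec (Nat.zero_le N) h0
  have hgt : ∀ i > m, IsEmpty (R.X i) := fun i hi => by
    by_contra h
    rw [not_isEmpty_iff] at h
    exact Nat.findGreatest_is_greatest hi (hle i h) h
  suffices m = n by rw [← this]; exact ⟨hm, hgt⟩
  by_contra hmn
  obtain ⟨x⟩ := hm
  have := hgt (m + 1) (Nat.lt_succ_self m)
  exact R.not_cob_single_eq_zero x (hG.ext_ne m hmn _) (Subsingleton.elim _ _)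

/-- A generator of degree `e` in the top term gives a nonzero class in the component of degree `-e`
of `Ext^n(k, A)`, and only the component of degree `-l` is nonzero. -/
theorem deg_top (hG : IsLeftGorenstein 𝒜 n l) (h : IsEmpty (R.X (n + 1))) (x : R.X n) :
    R.deg n x = l := by
  classical
  by_contra hx
  exact R.not_cob_single_eq_zero x (hG.ext_eq_zero _ (by omega)) (Subsingleton.elim _ _)

/-- Distinct generators of the top term give linearly independent classes, as the augmentations of
the entries show, whereas the component of degree `-l` of `Ext^n(k, A)` is one-dimensional. -/
theorem subsingleton_top (hG : IsLeftGorenstein 𝒜 n l) (h : IsEmpty (R.X (n + 1))) :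
    Subsingleton (R.X n) := by
  classical
  refine ⟨fun x y => ?_⟩
  by_contra hxy
  let _ := HasExt.standard (GrMod 𝒜)
  obtain ⟨e⟩ := hG.ext_eq
  let Y := (self 𝒜).shift (-l)
  have hs : ∀ (x y : R.X n), (Pi.single x 1 : R.X n → A) y ∈ 𝒜 (R.deg n y + -l) := fun x y => by
    rw [← R.deg_top hG h x]
    exact R.single_one_mem x y
  let f : R.X n → (R.trivRes.P n ⟶ Y) := fun x => freeHom (Pi.single x (1 : A)) (hs x)
  have hd : ∀ g : R.trivRes.P n ⟶ Y, R.trivRes.d n ≫ g = 0 := fun g => by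
    obtain ⟨w, hw, rfl⟩ := exists_freeHom g
    exact free_hom_ext fun z => h.elim z
  let E : R.X n → GrExt 𝒜 n (-l) := fun x => R.trivRes.ext (f x) (hd _)
  have hsmul : ∀ (c : k) x, c • E x = R.trivRes.ext (c • f x) (hd _) := fun c x => by
    rw [Abelian.Ext.smul_eq_comp_mk₀]
    refine (R.trivRes.ext_comp _ _ _).trans ?_
    congr 1
  have hcob : ∀ g : R.trivRes.P n ⟶ Y, R.trivRes.ext g (hd g) = 0 →
      ∀ z, hA.augm (show A from lin g (Finsupp.single z (1 : A) : R.X n →₀ A)) = 0 := by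
    intro g hg z
    obtain ⟨w, hw, rfl⟩ := exists_freeHom g
    have h1 := R.augm_of_isGrCob (isGrCob_of_isCob ((R.trivRes.ext_eq_zero_iff _ _).1 hg)) z
    rw [← h1]
    exact congrArg hA.augm (freeHom_single w hw z)
  have hval : ∀ x z, (lin (f x) (Finsupp.single z (1 : A) : R.X n →₀ A)) =
      (Pi.single x 1 : R.X n → A) z := fun x z => freeHom_single _ (hs x) z
  -- In a one-dimensional space with coordinate `e`, any two vectors satisfy `e(b) a - e(a) b = 0`.
  have hrel : R.trivRes.ext (e (E y) • f x + (-e (E x)) • f y) (hd _) = 0 := by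
    refine (R.trivRes.ext_add _ _ (hd _) (hd _)).trans ?_
    rw [← hsmul, ← hsmul]
    refine e.injective ?_
    rw [map_add, map_smul, map_smul, map_zero, smul_eq_mul, smul_eq_mul]
    ring
  have hy : e (E y) = 0 := by
    have h1 := hcob _ hrel x
    have h2 : (lin (e (E y) • f x + (-e (E x)) • f y) (Finsupp.single x (1 : A) : R.X n →₀ A)) =
        algebraMap k A (e (E y)) * (Pi.single x 1 : R.X n → A) x +
          algebraMap k A (-e (E x)) * (Pi.single y 1 : R.X n → A) x :=
      congrArg₂ (fun a b : A => algebraMap k A (e (E y)) * a + algebraMap k A (-e (E x)) * b)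
        (hval x x) (hval y x)
    have h3 := (congrArg hA.augm h2).symm.trans h1
    rw [Pi.single_eq_same, Pi.single_eq_of_ne hxy] at h3
    simpa using h3
  have h2 := hcob (f y) (e.injective (hy.trans (map_zero e).symm)) y
  rw [hval, Pi.single_eq_same, map_one] at h2
  exact one_ne_zero h2

/-- Exactness of the complex of homogeneous columns of a given degree. -/
def IsColExact (i : ℕ) (d : ℤ) : Prop :=
  ∀ v : R.X i → A, (∀ x, v x ∈ 𝒜 (R.deg i x + d)) → cob R.redM i v = 0 →
    R.IsGrCob ((self 𝒜).shift d) v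

theorem isColExact_of_ext {i : ℕ} {d : ℤ} (h : Subsingleton (GrExt 𝒜 i d)) : R.IsColExact i d :=
  fun _ hv hc => R.isGrCob_of_ext (Y := (self 𝒜).shift d) h hv hc

/-- Descending induction from the term of rank one. For `i < n` the column supported at a generator
`y` is not a cocycle, so `y` occurs in one of the rows of the next matrix. There are finitely many
rows, each of finite support. -/
theorem finite_X (hG : IsLeftGorenstein 𝒜 n l)
    (hN : ∃ N : ℕ, ∀ M : GrMod 𝒜, projectiveDimension M ≤ N) (i : ℕ) : Finite (R.X i) := by
  classical
  obtain ⟨-, hgt⟩ := R.top_eq hG hN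
  have key : ∀ j i, i + j = n → Finite (R.X i) := by
    intro j
    induction j with
    | zero =>
      rintro i rfl
      have := R.subsingleton_top hG (hgt _ (Nat.lt_succ_self _))
      infer_instance
    | succ j ih =>
      intro i hi
      have := ih (i + 1) (by omega)
      have hs : (⋃ x : R.X (i + 1), ((R.redM i x).support : Set (R.X i))).Finite :=
        Set.finite_iUnion fun x => Finset.finite_toSet _
      refine Set.finite_univ_iff.1 (hs.subset fun y _ => ?_)
      by_contra hy
      refine R.not_cob_single_eq_zero y (hG.ext_ne i (by omega) _) (funext fun x => ?_)
      rw [R.cob_single, smul_eq_mul, mul_one]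
      by_contra hxy
      exact hy (Set.mem_iUnion.2 ⟨x, Finsupp.mem_support_iff.2 hxy⟩)
  rcases le_or_gt i n with h | h
  · exact key (n - i) i (by omega)
  · have := hgt i h
    infer_instance

end MinRes

end TrivRes

/-! ### Columns over the enveloping algebra -/

section Filtration

variable {k A : Type u} [Field k] [Ring A] [Algebra k A] {𝒜 : ℤ → Submodule k A}
  [GradedAlgebra 𝒜]

variable (𝒜) in
/-- The projection of the enveloping algebra to the component of degree `p` with respect to the
grading of the second factor. -/
def rproj (p : ℤ) : Env k A →ₗ[k] Env k A := (gproj (opGrading 𝒜) p).lTensor A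

theorem rproj_tmul (p : ℤ) (a : A) (y : Aᵐᵒᵖ) :
    rproj 𝒜 p (a ⊗ₜ y) = a ⊗ₜ gproj (opGrading 𝒜) p y := LinearMap.lTensor_tmul _ _ _ _

theorem rproj_rproj (p : ℤ) (b : Env k A) : rproj 𝒜 p (rproj 𝒜 p b) = rproj 𝒜 p b := by
  induction b using TensorProduct.induction_on with
  | zero => simp only [map_zero]
  | add x y hx hy => simp only [map_add, hx, hy]
  | tmul a y => rw [rproj_tmul, rproj_tmul, gproj_gproj]

theorem rproj_rproj_ne {p q : ℤ} (h : p ≠ q) (b : Env k A) : rproj 𝒜 q (rproj 𝒜 p b) = 0 := by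
  induction b using TensorProduct.induction_on with
  | zero => simp only [map_zero]
  | add x y hx hy => simp only [map_add, hx, hy, add_zero]
  | tmul a y => rw [rproj_tmul, rproj_tmul, gproj_ne (gproj_mem _ _ _) h, TensorProduct.tmul_zero]

theorem rproj_mem (p : ℤ) {d : ℤ} {b : Env k A} (hb : b ∈ envGrading 𝒜 d) :
    rproj 𝒜 p b ∈ envGrading 𝒜 d := by
  induction hb using totGrading_induction with
  | h0 => rw [map_zero]; exact zero_mem _
  | hadd x y _ _ hx hy => rw [map_add]; exact add_mem hx hy
  | h i j hij a ha c hc =>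
    rw [rproj_tmul]
    by_cases hj : j = p
    · subst hj
      rw [gproj_same hc]
      exact tmul_mem_totGrading ha hc hij
    · rw [gproj_ne hc hj, TensorProduct.tmul_zero]
      exact zero_mem _

theorem IsConnectedGraded.rproj_neg (hA : IsConnectedGraded 𝒜) {p : ℤ} (hp : p < 0)
    (b : Env k A) : rproj 𝒜 p b = 0 := by
  induction b using TensorProduct.induction_on with
  | zero => rw [map_zero]
  | add x y hx hy => rw [map_add, hx, hy, add_zero]
  | tmul a y => rw [rproj_tmul, hA.op.gproj_neg hp, TensorProduct.tmul_zero]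

/-- The first factor would have negative degree. -/
theorem IsConnectedGraded.rproj_of_lt (hA : IsConnectedGraded 𝒜) {p d : ℤ} (hp : d < p)
    {b : Env k A} (hb : b ∈ envGrading 𝒜 d) : rproj 𝒜 p b = 0 := by
  induction hb using totGrading_induction with
  | h0 => rw [map_zero]
  | hadd x y _ _ hx hy => rw [map_add, hx, hy, add_zero]
  | h i j hij a ha c hc =>
    rw [rproj_tmul]
    by_cases hj : j = p
    · rw [hA.eq_zero_of_neg (by omega) ha, TensorProduct.zero_tmul]
    · rw [gproj_ne hc hj, TensorProduct.tmul_zero]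

variable (𝒜) in
theorem exists_sum_rproj (b : Env k A) : ∃ s : Finset ℤ, ∑ p ∈ s, rproj 𝒜 p b = b := by
  classical
  have key : ∃ s : Finset ℤ, ∀ t, s ⊆ t → ∑ p ∈ t, rproj 𝒜 p b = b := by
    induction b using TensorProduct.induction_on with
    | zero => exact ⟨∅, fun t _ => by simp only [map_zero, Finset.sum_const_zero]⟩
    | add x y hx hy =>
      obtain ⟨s, hs⟩ := hx
      obtain ⟨t, ht⟩ := hy
      refine ⟨s ∪ t, fun r hr => ?_⟩
      simp only [map_add, Finset.sum_add_distrib]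
      rw [hs r (Finset.union_subset_left hr), ht r (Finset.union_subset_right hr)]
    | tmul a y =>
      obtain ⟨s, hs⟩ := exists_sum_gproj (opGrading 𝒜) y
      refine ⟨s, fun t ht => ?_⟩
      simp only [rproj_tmul]
      rw [← TensorProduct.tmul_sum, hs t ht]
  obtain ⟨s, hs⟩ := key
  exact ⟨s, hs s subset_rfl⟩

theorem eq_zero_of_rproj {b : Env k A} (h : ∀ p, rproj 𝒜 p b = 0) : b = 0 := by
  obtain ⟨s, hs⟩ := exists_sum_rproj 𝒜 b
  rw [← hs]
  exact Finset.sum_eq_zero fun p _ => h p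

theorem rproj_tmul_mul {j : ℤ} (a : A) {y : Aᵐᵒᵖ} (hy : y ∈ opGrading 𝒜 j) (p : ℤ)
    (b : Env k A) : rproj 𝒜 p ((a ⊗ₜ y : Env k A) * b) = (a ⊗ₜ y : Env k A) * rproj 𝒜
      (p - j) b := by
  induction b using TensorProduct.induction_on with
  | zero => simp only [mul_zero, map_zero]
  | add x y hx hy => simp only [mul_add, map_add, hx, hy]
  | tmul c z =>
    rw [Algebra.TensorProduct.tmul_mul_tmul, rproj_tmul, rproj_tmul,
      Algebra.TensorProduct.tmul_mul_tmul, gproj_mul_left hy]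

/-- The component of lowest degree of a product. -/
theorem IsConnectedGraded.rproj_mul (hA : IsConnectedGraded 𝒜) (m : Env k A) {p : ℤ}
    {b : Env k A} (hb : ∀ q < p, rproj 𝒜 q b = 0) :
    rproj 𝒜 p (m * b) = ((hA.op.red A m) ⊗ₜ 1 : Env k A) * rproj 𝒜 p b := by
  induction m using TensorProduct.induction_on with
  | zero => rw [zero_mul, map_zero, map_zero, TensorProduct.zero_tmul, zero_mul]
  | add x y hx hy => rw [add_mul, map_add, hx, hy, map_add, TensorProduct.add_tmul, add_mul]
  | tmul a y =>
    induction y using graded_induction (𝒜 := opGrading 𝒜) with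
    | hadd y z hy hz =>
      rw [TensorProduct.tmul_add, add_mul, map_add, hy, hz, map_add, TensorProduct.add_tmul,
        add_mul]
    | h j y hy =>
      -- A second factor of positive degree pushes `b` beyond its lowest component and contributes
      -- nothing in degree `p`. One of degree zero is a scalar.
      rw [rproj_tmul_mul a hy, hA.op.red_tmul]
      rcases lt_trichotomy j 0 with hj | rfl | hj
      · rw [hA.op.eq_zero_of_neg hj hy, TensorProduct.tmul_zero, zero_mul, map_zero, zero_smul,
          TensorProduct.zero_tmul, zero_mul]
      · obtain ⟨c, rfl⟩ := hA.op.exists_scalar hy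
        rw [sub_zero, AlgHom.commutes, Algebra.algebraMap_eq_smul_one, TensorProduct.tmul_smul,
          TensorProduct.smul_tmul']
        rfl
      · rw [hb _ (by omega), hA.op.augm_eq_zero hj.ne' hy, mul_zero, zero_smul,
          TensorProduct.zero_tmul, zero_mul]

theorem IsConnectedGraded.rproj_mul_eq_zero (hA : IsConnectedGraded 𝒜) (m : Env k A) {p : ℤ}
    {b : Env k A} (hb : ∀ q < p, rproj 𝒜 q b = 0) (q : ℤ) (hq : q < p) :
    rproj 𝒜 q (m * b) = 0 := by
  rw [hA.rproj_mul m fun r hr => hb r (hr.trans hq), hb q hq, mul_zero]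

variable (A) in
/-- Evaluation of a linear form on the second factor of the enveloping algebra. -/
def coeffMap (f : Aᵐᵒᵖ →ₗ[k] k) : Env k A →ₗ[k] A := TensorProduct.rid k A ∘ₗ f.lTensor A

theorem coeffMap_tmul (f : Aᵐᵒᵖ →ₗ[k] k) (a : A) (y : Aᵐᵒᵖ) :
    coeffMap A f (a ⊗ₜ[k] y) = f y • a := by
  simp [coeffMap]

theorem coeffMap_mul (f : Aᵐᵒᵖ →ₗ[k] k) (a : A) (b : Env k A) :
    coeffMap A f ((a ⊗ₜ 1 : Env k A) * b) = a * coeffMap A f b := by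
  induction b using TensorProduct.induction_on with
  | zero => simp only [mul_zero, map_zero]
  | add x y hx hy => simp only [mul_add, map_add, hx, hy]
  | tmul c z =>
    rw [Algebra.TensorProduct.tmul_mul_tmul, coeffMap_tmul, coeffMap_tmul, one_mul,
      mul_smul_comm]

theorem coeffMap_mem (f : Aᵐᵒᵖ →ₗ[k] k) {d p : ℤ} {b : Env k A} (hb : b ∈ envGrading 𝒜 d) :
    coeffMap A f (rproj 𝒜 p b) ∈ 𝒜 (d - p) := by
  induction hb using totGrading_induction with
  | h0 => rw [map_zero, map_zero]; exact zero_mem _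
  | hadd x y _ _ hx hy => rw [map_add, map_add]; exact add_mem hx hy
  | h i j hij a ha c hc =>
    rw [rproj_tmul, coeffMap_tmul]
    by_cases hj : j = p
    · obtain rfl : i = d - p := by omega
      exact Submodule.smul_mem _ _ ha
    · rw [gproj_ne hc hj, map_zero, zero_smul]
      exact zero_mem _

/-- The expansion of `b` along a basis of `A°`. The sum may run over any larger finite set, so that
finitely many elements can be expanded over the same index set. -/
theorem exists_sum_coeffMap {J : Type*} (c : Module.Basis J k Aᵐᵒᵖ) (b : Env k A) :
    ∃ s : Finset J, ∀ t, s ⊆ t → ∑ j ∈ t, coeffMap A (c.coord j) b ⊗ₜ[k] c j = b := by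
  classical
  induction b using TensorProduct.induction_on with
  | zero => exact ⟨∅, fun t _ => by
      simp only [map_zero, TensorProduct.zero_tmul, Finset.sum_const_zero]⟩
  | add x y hx hy =>
    obtain ⟨s, hs⟩ := hx
    obtain ⟨t, ht⟩ := hy
    refine ⟨s ∪ t, fun r hr => ?_⟩
    simp only [map_add, TensorProduct.add_tmul, Finset.sum_add_distrib]
    rw [hs r (Finset.union_subset_left hr), ht r (Finset.union_subset_right hr)]
  | tmul a y =>
    refine ⟨(c.repr y).support, fun t ht => ?_⟩
    have h : ∑ j ∈ t, c.coord j y • c j = y := by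
      have h1 := c.linearCombination_repr y
      rw [Finsupp.linearCombination_apply,
        Finsupp.sum_of_support_subset _ ht _ fun j _ => zero_smul k (c j)] at h1
      exact h1
    conv_rhs => rw [← h, TensorProduct.tmul_sum]
    refine Finset.sum_congr rfl fun j _ => ?_
    rw [coeffMap_tmul, TensorProduct.smul_tmul]

end Filtration

/-! ### Formal properties of coboundaries of columns -/

section CobFin

variable {B : Type u} [Ring B] {X : ℕ → Type u} {M : ∀ i, X (i + 1) → X i →₀ B} {N : Type*}
  [AddCommGroup N] [Module B N]

theorem cob_eq_sum (i : ℕ) [Fintype (X i)] (v : X i → N) (x : X (i + 1)) :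
    cob M i v x = ∑ y, M i x y • v y :=
  (Finsupp.linearCombination_apply _ _).trans (Finsupp.sum_fintype _ _ fun _ => zero_smul _ _)

theorem cob_neg (i : ℕ) (v : X i → N) : cob M i (-v) = -cob M i v := by
  rw [eq_neg_iff_add_eq_zero, ← cob_add, neg_add_cancel, cob_zero]

theorem cob_sub (i : ℕ) (v w : X i → N) : cob M i (v - w) = cob M i v - cob M i w := by
  rw [sub_eq_add_neg, cob_add, cob_neg, sub_eq_add_neg]

theorem IsCobdry.zero {i : ℕ} : IsCobdry M (0 : X i → N) := by
  cases i with
  | zero => exact (rfl : (0 : X 0 → N) = 0)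
  | succ p => exact ⟨0, cob_zero M p⟩

theorem IsCobdry.add {i : ℕ} {v w : X i → N} (hv : IsCobdry M v) (hw : IsCobdry M w) :
    IsCobdry M (v + w) := by
  cases i with
  | zero => exact (congrArg₂ (· + ·) hv hw).trans (add_zero _)
  | succ p =>
    obtain ⟨v', rfl⟩ := hv
    obtain ⟨w', rfl⟩ := hw
    exact ⟨v' + w', cob_add M p v' w'⟩

theorem IsCobdry.neg {i : ℕ} {v : X i → N} (hv : IsCobdry M v) : IsCobdry M (-v) := by
  cases i with
  | zero => exact (congrArg (- ·) hv).trans neg_zero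
  | succ p =>
    obtain ⟨v', rfl⟩ := hv
    exact ⟨-v', cob_neg p v'⟩

theorem IsCobdry.sum {i : ℕ} {J : Type*} (s : Finset J) {v : J → X i → N}
    (hv : ∀ j ∈ s, IsCobdry M (v j)) : IsCobdry M (∑ j ∈ s, v j) :=
  Finset.sum_induction _ (IsCobdry M) (fun _ _ => IsCobdry.add) IsCobdry.zero hv

theorem FreeRes.cob_cob {Y : ModuleCat.{u} B} (R : FreeRes Y) (i : ℕ) (v : R.X i → N) :
    cob R.M (i + 1) (cob R.M i v) = 0 := by
  have h : Finsupp.linearCombination B (cob R.M (i + 1) (cob R.M i v)) = 0 := by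
    rw [← linearCombination_comp_rowMap, ← linearCombination_comp_rowMap, LinearMap.comp_assoc,
      (R.exact_succ i).linearMap_comp_eq_zero, LinearMap.comp_zero]
  exact linearCombination_injective (h.trans (Finsupp.linearCombination_zero _ _ _).symm)

theorem FreeRes.cob_of_isCobdry {Y : ModuleCat.{u} B} (R : FreeRes Y) {i : ℕ} {v : R.X i → N}
    (hv : IsCobdry R.M v) : cob R.M i v = 0 := by
  cases i with
  | zero => rw [show v = 0 from hv, cob_zero]
  | succ p =>
    obtain ⟨w, rfl⟩ := hv
    exact R.cob_cob p w

theorem cob_mul (M : ∀ i, X (i + 1) → X i →₀ B) (i : ℕ) (v : X i → B) (c : B) :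
    cob M i (fun y => v y * c) = fun x => cob M i v x * c := funext fun x => by
  rw [cob, cob, Finsupp.linearCombination_apply, Finsupp.linearCombination_apply, Finsupp.sum,
    Finsupp.sum, Finset.sum_mul]
  exact Finset.sum_congr rfl fun y _ => (smul_mul_assoc _ _ _).symm

theorem IsCobdry.mul {i : ℕ} {v : X i → B}
    (hv : IsCobdry M v) (c : B) : IsCobdry M (fun y => v y * c) := by
  cases i with
  | zero =>
    refine funext fun x => ?_
    rw [congrFun (show v = 0 from hv) x]
    exact zero_mul c
  | succ i =>
    obtain ⟨w, rfl⟩ := hv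
    exact ⟨fun y => w y * c, cob_mul M i w c⟩

/-- The coboundaries of degree `n` that are constant columns, as a right ideal. -/
def FreeRes.topIdeal {Y : ModuleCat.{u} B} (R : FreeRes Y) (n : ℕ) : AddSubgroup B where
  carrier := {b | IsCobdry R.M (fun _ : R.X n => b)}
  zero_mem' := IsCobdry.zero
  add_mem' := IsCobdry.add
  neg_mem' := IsCobdry.neg

theorem FreeRes.mem_topIdeal {Y : ModuleCat.{u} B} (R : FreeRes Y) {n : ℕ} {b : B} :
    b ∈ R.topIdeal n ↔ IsCobdry R.M (fun _ : R.X n => b) := Iff.rfl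

theorem FreeRes.mul_mem_topIdeal {Y : ModuleCat.{u} B} (R : FreeRes Y) {n : ℕ} {b : B}
    (hb : b ∈ R.topIdeal n) (c : B) : b * c ∈ R.topIdeal n :=
  IsCobdry.mul (show IsCobdry R.M (fun _ : R.X n => b) from hb) c

end CobFin

/-! ### Exactness of the dual complex over the enveloping algebra -/

section EnvColumns

variable {k A : Type u} [Field k] [Ring A] [Algebra k A] {𝒜 : ℤ → Submodule k A}
  [GradedAlgebra 𝒜] {hA : IsConnectedGraded 𝒜} (R : MinRes hA)

namespace MinRes

variable {i : ℕ} {d : ℤ}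

/-- Homogeneous columns over the enveloping algebra. -/
def IsHom (d : ℤ) {i : ℕ} (v : R.X i → Env k A) : Prop :=
  ∀ x, v x ∈ envGrading 𝒜 (R.deg i x + d)

theorem IsHom.sub {R : MinRes hA} {v w : R.X i → Env k A} (hv : R.IsHom d v) (hw : R.IsHom d w) :
    R.IsHom d (v - w) := fun x => sub_mem (hv x) (hw x)

theorem isHom_cob {v : R.X i → Env k A} (hv : R.IsHom d v) : R.IsHom d (cob R.M i v) := fun x => by
  rw [cob, Finsupp.linearCombination_apply]
  refine sum_mem fun y _ => ?_
  have h := SetLike.mul_mem_graded (R.mem i x y) (hv y)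
  rw [← add_assoc, sub_add_cancel] at h
  exact h

variable (d) in
/-- The homogeneous component of a column. -/
def homProj {i : ℕ} (v : R.X i → Env k A) (x : R.X i) : Env k A :=
  gproj (envGrading 𝒜) (R.deg i x + d) (v x)

theorem isHom_homProj (v : R.X i → Env k A) : R.IsHom d (R.homProj d v) := fun _ => gproj_mem _ _ _

theorem homProj_cob (v : R.X i → Env k A) : R.homProj d (cob R.M i v) = cob R.M i
    (R.homProj d v) := by
  funext x
  rw [homProj, cob, cob, Finsupp.linearCombination_apply, Finsupp.linearCombination_apply,
    map_finsuppSum]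
  refine Finsupp.sum_congr fun y _ => ?_
  rw [smul_eq_mul, gproj_mul_left (R.mem i x y), smul_eq_mul, homProj]
  congr 2
  congr 1
  ring_nf

theorem exists_sum_homProj [Finite (R.X i)] (v : R.X i → Env k A) :
    ∃ s : Finset ℤ, ∑ d ∈ s, R.homProj d v = v := by
  classical
  have := Fintype.ofFinite (R.X i)
  choose s hs using fun x => exists_sum_gproj (envGrading 𝒜) (v x)
  refine ⟨Finset.univ.biUnion fun x => (s x).image (· - R.deg i x), funext fun x => ?_⟩
  rw [Finset.sum_apply]
  simp only [homProj]
  have h := hs x ((Finset.univ.biUnion fun x => (s x).image (· - R.deg i x)).image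
    (R.deg i x + ·)) fun e he => Finset.mem_image.2 ⟨e - R.deg i x,
      Finset.mem_biUnion.2 ⟨x, Finset.mem_univ x, Finset.mem_image_of_mem _ he⟩, by simp⟩
  rwa [Finset.sum_image (by simp)] at h

/-- The matrices of the induced resolution, with entries in the enveloping algebra. -/
def redE (i : ℕ) (x : R.X (i + 1)) : R.X i →₀ Env k A :=
  (R.redM i x).mapRange (fun a => a ⊗ₜ 1) (TensorProduct.zero_tmul _ _)

theorem redE_apply (i : ℕ) (x : R.X (i + 1)) (y : R.X i) : R.redE i x y = R.redM i x y ⊗ₜ 1 := rfl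

/-- On lowest components with respect to the second factor, the differential only sees the matrices
reduced modulo the positive part of `A°`. -/
theorem rproj_cob [Finite (R.X i)] {v : R.X i → Env k A} {p : ℤ}
    (hv : ∀ x, ∀ q < p, rproj 𝒜 q (v x) = 0) (x : R.X (i + 1)) :
    rproj 𝒜 p (cob R.M i v x) = cob R.redE i (fun y => rproj 𝒜 p (v y)) x := by
  have := Fintype.ofFinite (R.X i)
  rw [cob_eq_sum, cob_eq_sum, map_sum]
  exact Finset.sum_congr rfl fun y _ => hA.rproj_mul _ (hv y)

theorem rproj_cob_eq_zero {v : R.X i → Env k A} {p : ℤ}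
    (hv : ∀ x, ∀ q < p, rproj 𝒜 q (v x) = 0) (x : R.X (i + 1)) (q : ℤ) (hq : q < p) :
    rproj 𝒜 q (cob R.M i v x) = 0 := by
  rw [cob, Finsupp.linearCombination_apply, map_finsuppSum]
  exact Finset.sum_eq_zero fun y _ => hA.rproj_mul_eq_zero _ (hv y) q hq

theorem coeffMap_cob [Finite (R.X i)] (f : Aᵐᵒᵖ →ₗ[k] k) (u : R.X i → Env k A) (x : R.X (i + 1)) :
    coeffMap A f (cob R.redE i u x) = cob R.redM i (fun y => coeffMap A f (u y)) x := by
  have := Fintype.ofFinite (R.X i)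
  rw [cob_eq_sum, cob_eq_sum, map_sum]
  exact Finset.sum_congr rfl fun y _ => coeffMap_mul f _ _

theorem cob_redE_tmul [Finite (R.X i)] (w : R.X i → A) (c : Aᵐᵒᵖ) (x : R.X (i + 1)) :
    cob R.redE i (fun y => w y ⊗ₜ[k] c) x = cob R.redM i w x ⊗ₜ c := by
  have := Fintype.ofFinite (R.X i)
  rw [cob_eq_sum, cob_eq_sum, TensorProduct.sum_tmul]
  refine Finset.sum_congr rfl fun y _ => ?_
  rw [redE_apply, smul_eq_mul, Algebra.TensorProduct.tmul_mul_tmul, one_mul, smul_eq_mul]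

variable (d) in
/-- Coboundaries of homogeneous columns which are of degree `p` with respect to the second
factor. -/
def IsPureCob (p : ℤ) : ∀ {i : ℕ}, (R.X i → Env k A) → Prop
  | 0, u => u = 0
  | j + 1, u => ∃ t : R.X j → Env k A,
      R.IsHom d t ∧ (∀ y, rproj 𝒜 p (t y) = t y) ∧ cob R.redE j t = u

/-- Expand `u` along a basis of `A°`. The coefficients are cocycles over `A`, homogeneous of degree
`d - p`, hence coboundaries over `A`. Their primitives are reassembled with the same basis. -/
theorem isPureCob_of_isColExact (p : ℤ) (hex : R.IsColExact i (d - p)) [∀ i, Finite (R.X i)]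
    {u : R.X i → Env k A} (hu : R.IsHom d u) (hup : ∀ x, rproj 𝒜 p (u x) = u x)
    (hc : cob R.redE i u = 0) : R.IsPureCob d p u := by
  classical
  have := Fintype.ofFinite (R.X i)
  let c := Module.Basis.ofVectorSpace k Aᵐᵒᵖ
  choose s hs using fun x => exists_sum_coeffMap c (u x)
  let J := Finset.univ.biUnion s
  have hJ : ∀ x, ∑ j ∈ J, coeffMap A (c.coord j) (u x) ⊗ₜ[k] c j = u x := fun x =>
    hs x J (Finset.subset_biUnion_of_mem s (Finset.mem_univ x))
  have h1 : ∀ j, R.IsGrCob ((GrMod.self 𝒜).shift (d - p)) fun x => coeffMap A (c.coord j) (u x) :=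
    fun j => hex _ (fun x => by
      have h := coeffMap_mem (c.coord j) (p := p) (hu x)
      rwa [hup, add_sub_assoc] at h) (funext fun x => by
      rw [← R.coeffMap_cob, hc]
      exact map_zero _)
  cases i with
  | zero =>
    refine funext fun x => ?_
    rw [← hJ x]
    refine Finset.sum_eq_zero fun j _ => ?_
    rw [congrFun (h1 j) x]
    exact TensorProduct.zero_tmul _ _
  | succ i =>
    choose w hw hwc using h1
    -- The basis need not be homogeneous, so its elements are projected to degree `p`. This does not
    -- affect `u`, which is purely of degree `p` in the second factor.
    refine ⟨∑ j ∈ J, fun y => (show A from w j y) ⊗ₜ[k] gproj (opGrading 𝒜) p (c j),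
      fun y => ?_, fun y => ?_, ?_⟩
    · rw [Finset.sum_apply]
      exact sum_mem fun j _ => tmul_mem_totGrading (hw j y) (gproj_mem _ _ _)
        (by rw [add_assoc, sub_add_cancel])
    · rw [Finset.sum_apply, map_sum]
      exact Finset.sum_congr rfl fun j _ => by rw [rproj_tmul, gproj_gproj]
    · rw [cob_sum]
      funext x
      rw [Finset.sum_apply, ← hup x]
      conv_rhs => rw [← hJ x, map_sum]
      refine Finset.sum_congr rfl fun j _ => ?_
      rw [rproj_tmul]
      refine (R.cob_redE_tmul _ _ x).trans ?_
      exact congrArg (fun a : A => a ⊗ₜ[k] gproj (opGrading 𝒜) p (c j)) (congrFun (hwc j) x)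

/-- A column can be modified by a coboundary so that its components of lowest degree vanish. -/
theorem exists_sub_isCobdry [∀ i, Finite (R.X i)] (p : ℤ) (hex : R.IsColExact i (d - p))
    {w : R.X i → Env k A} (hw : R.IsHom d w) (hwp : ∀ x, ∀ q < p, rproj 𝒜 q (w x) = 0)
    (hc : ∀ x, rproj 𝒜 p (cob R.M i w x) = 0) :
    ∃ w' : R.X i → Env k A, R.IsHom d w' ∧ IsCobdry R.M (w - w') ∧
      ∀ x, ∀ q < p + 1, rproj 𝒜 q (w' x) = 0 := by
  have h := R.isPureCob_of_isColExact p hex (u := fun x => rproj 𝒜 p (w x))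
    (fun x => rproj_mem p (hw x)) (fun x => rproj_rproj p _)
    (funext fun x => (R.rproj_cob hwp x).symm.trans (hc x))
  cases i with
  | zero =>
    refine ⟨w, hw, by rw [sub_self]; exact IsCobdry.zero, fun x q hq => ?_⟩
    rcases (Int.lt_add_one_iff.1 hq).lt_or_eq with hq | rfl
    · exact hwp x q hq
    · exact congrFun h x
  | succ i =>
    obtain ⟨t, ht, htp, htc⟩ := h
    have htq : ∀ x, ∀ q < p, rproj 𝒜 q (t x) = 0 := fun x q hq => by
      rw [← htp, rproj_rproj_ne hq.ne']
    -- A primitive `t` of the lowest component for the reduced matrix is used with the full matrix.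
    -- The difference between the two only affects components of degree greater than `p`.
    refine ⟨w - cob R.M i t, hw.sub (R.isHom_cob ht), ?_, fun x q hq => ?_⟩
    · rw [sub_sub_cancel]
      exact ⟨t, rfl⟩
    · rw [Pi.sub_apply, map_sub]
      rcases (Int.lt_add_one_iff.1 hq).lt_or_eq with hq | rfl
      · rw [hwp x q hq, R.rproj_cob_eq_zero htq x q hq, sub_zero]
      · rw [R.rproj_cob htq, sub_eq_zero, ← congrFun htc x]
        congr 1
        exact funext fun y => (htp y).symm

/-- Induction on `p`, starting at `0`, below which all components vanish. Changing the column by a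
coboundary leaves its differential unchanged, so the hypothesis persists. -/
theorem exists_sub_isCobdry_nat [∀ i, Finite (R.X i)] (p : ℕ) (hex : ∀ d, R.IsColExact i d)
    {w : R.X i → Env k A} (hw : R.IsHom d w)
    (hc : ∀ x, ∀ q < (p : ℤ), rproj 𝒜 q (cob R.M i w x) = 0) :
    ∃ w' : R.X i → Env k A, R.IsHom d w' ∧ IsCobdry R.M (w - w') ∧
      ∀ x, ∀ q < (p : ℤ), rproj 𝒜 q (w' x) = 0 := by
  induction p with
  | zero => exact ⟨w, hw, by rw [sub_self]; exact IsCobdry.zero, fun x q hq => hA.rproj_neg hq _⟩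
  | succ p ih =>
    obtain ⟨w', hw', hww', hp⟩ := ih fun x q hq => hc x q (by push_cast; omega)
    have hcc : cob R.M i w' = cob R.M i w := by
      have h := R.cob_of_isCobdry hww'
      rw [cob_sub, sub_eq_zero] at h
      exact h.symm
    obtain ⟨w'', hw'', h1, h2⟩ := R.exists_sub_isCobdry p (hex _) hw' hp fun x => by
      rw [hcc]
      exact hc x p (by push_cast; omega)
    refine ⟨w'', hw'', ?_, by exact_mod_cast h2⟩
    have := hww'.add h1
    rwa [sub_add_sub_cancel] at this

/-- The entry at `x` has degree at most `deg x + d` in the second factor. The sum over the finitely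
many generators exceeds all these bounds at once. -/
theorem eq_zero_of_isHom [Finite (R.X i)] (d : ℤ) : ∃ p : ℕ, ∀ w : R.X i → Env k A,
    R.IsHom d w → (∀ x, ∀ q < (p : ℤ), rproj 𝒜 q (w x) = 0) → w = 0 := by
  have := Fintype.ofFinite (R.X i)
  refine ⟨∑ x, (R.deg i x + d + 1).toNat, fun w hw h => funext fun x => ?_⟩
  refine eq_zero_of_rproj (𝒜 := 𝒜) fun q => ?_
  have h1 : (R.deg i x + d + 1).toNat ≤ ∑ x, (R.deg i x + d + 1).toNat :=
    Finset.single_le_sum (f := fun x => (R.deg i x + d + 1).toNat) (fun _ _ => Nat.zero_le _)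
      (Finset.mem_univ x)
  rcases lt_or_ge q (∑ x, (R.deg i x + d + 1).toNat : ℕ) with hq | hq
  · exact h x q hq
  · exact hA.rproj_of_lt (by omega) (hw x)

/-- Exactness of the complex of columns over the enveloping algebra. -/
theorem isCobdry_of_cob_eq_zero [∀ i, Finite (R.X i)] (hex : ∀ d, R.IsColExact i d)
    {v : R.X i → Env k A} (hv : cob R.M i v = 0) : IsCobdry R.M v := by
  obtain ⟨s, hs⟩ := R.exists_sum_homProj v
  rw [← hs]
  refine IsCobdry.sum s fun d _ => ?_
  -- In a fixed total degree the filtration is finite, so pushing the lowest component up to degree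
  -- `p` by coboundaries leaves zero.
  obtain ⟨p, hp⟩ := R.eq_zero_of_isHom (i := i) d
  have hc : cob R.M i (R.homProj d v) = 0 := by
    rw [← homProj_cob, hv]
    exact funext fun x => map_zero _
  obtain ⟨w', hw', h1, h2⟩ := R.exists_sub_isCobdry_nat p hex (R.isHom_homProj (d := d) v)
    fun x q _ => by rw [hc]; exact map_zero _
  rwa [hp w' hw' h2, sub_zero] at h1

section Top

variable {n : ℕ} {l : ℤ}

/-- When the second factor takes up the whole degree, the first one has degree zero and is a scalar.
-/
theorem exists_tmul_eq_rproj {e : ℤ} {b : Env k A} (hA : IsConnectedGraded 𝒜)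
    (hb : b ∈ envGrading 𝒜 e) :
    ∃ c ∈ opGrading 𝒜 e, rproj 𝒜 e b = 1 ⊗ₜ c := by
  induction hb using totGrading_induction with
  | h0 => exact ⟨0, zero_mem _, by rw [map_zero, TensorProduct.tmul_zero]⟩
  | hadd x y _ _ hx hy =>
    obtain ⟨c, hc, hx⟩ := hx
    obtain ⟨c', hc', hy⟩ := hy
    exact ⟨c + c', add_mem hc hc', by rw [map_add, hx, hy, TensorProduct.tmul_add]⟩
  | h i j hij a ha c hc =>
    rw [rproj_tmul]
    by_cases hj : j = e
    · subst hj
      obtain rfl : i = 0 := by omega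
      obtain ⟨r, rfl⟩ := hA.exists_scalar ha
      rw [gproj_same hc]
      exact ⟨r • c, Submodule.smul_mem _ _ hc, by
        rw [TensorProduct.tmul_smul, TensorProduct.smul_tmul', Algebra.algebraMap_eq_smul_one]⟩
    · exact ⟨0, zero_mem _, by rw [gproj_ne hc hj, TensorProduct.tmul_zero,
        TensorProduct.tmul_zero]⟩

/-- Induction on the lowest degree `p` in the second factor. For `p ≠ e` the component of degree `p`
is removed by a coboundary, by exactness over `A` in degree `e - l - p ≠ -l`. For `p = e` that
component has the form `1 ⊗ c` and is split off. -/
theorem exists_sub_mem_topIdeal_hom [∀ i, Finite (R.X i)] [Nonempty (R.X n)]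
    [Subsingleton (R.X n)] (hn : IsEmpty (R.X (n + 1))) (hl : ∀ x : R.X n, R.deg n x = l)
    (hex : ∀ d ≠ -l, R.IsColExact n d) {e : ℤ} {b : Env k A} (hb : b ∈ envGrading 𝒜 e)
    (p : ℕ) : ∃ c, ∃ b' ∈ envGrading 𝒜 e, b - 1 ⊗ₜ c - b' ∈ R.topIdeal n ∧
      ∀ q < (p : ℤ), rproj 𝒜 q b' = 0 := by
  obtain ⟨x₀⟩ := ‹Nonempty (R.X n)›
  induction p with
  | zero => exact ⟨0, b, hb, by
      rw [TensorProduct.tmul_zero, sub_zero, sub_self]; exact zero_mem _,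
      fun q hq => hA.rproj_neg hq _⟩
  | succ p ih =>
    obtain ⟨c, b', hb', hI, hp⟩ := ih
    by_cases hpe : (p : ℤ) = e
    · obtain ⟨c', hc', h⟩ := exists_tmul_eq_rproj hA hb'
      have hcc : (1 ⊗ₜ c' : Env k A) ∈ envGrading 𝒜 e :=
        tmul_mem_totGrading SetLike.GradedOne.one_mem hc' (zero_add e)
      refine ⟨c + c', b' - 1 ⊗ₜ c', sub_mem hb' hcc, ?_, fun q hq => ?_⟩
      · rw [TensorProduct.tmul_add]
        convert hI using 1
        abel
      · rw [map_sub, rproj_tmul]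
        by_cases hq' : q = e
        · subst hq'
          rw [gproj_same hc', h, sub_self]
        · rw [gproj_ne hc' (Ne.symm hq'), hp q (by push_cast at hq; omega), TensorProduct.tmul_zero,
            sub_zero]
    · obtain ⟨w', hw', h1, h2⟩ := R.exists_sub_isCobdry (i := n) (d := e - l) p
        (hex _ (by omega)) (w := fun _ => b') (fun x => by
          rw [hl]; convert hb' using 1; ring_nf) (fun _ => hp) (fun x => hn.elim x)
      refine ⟨c, w' x₀, by
        have := hw' x₀; rwa [hl, add_sub_cancel] at this, ?_, fun q hq => h2 _ q (by
          push_cast at hq; exact hq)⟩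
      have h3 : (fun _ => b' - w' x₀ : R.X n → Env k A) = (fun _ => b') - w' :=
        funext fun x => by rw [Pi.sub_apply, Subsingleton.elim x x₀]
      have h4 : b' - w' x₀ ∈ R.topIdeal n := by rw [FreeRes.mem_topIdeal, h3]; exact h1
      have := add_mem hI h4
      rwa [sub_add_sub_cancel] at this

theorem exists_sub_mem_topIdeal [∀ i, Finite (R.X i)] [Nonempty (R.X n)]
    [Subsingleton (R.X n)] (hn : IsEmpty (R.X (n + 1))) (hl : ∀ x : R.X n, R.deg n x = l)
    (hex : ∀ d ≠ -l, R.IsColExact n d) (b : Env k A) : ∃ c, b - 1 ⊗ₜ c ∈ R.topIdeal n := by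
  induction b using graded_induction (𝒜 := envGrading 𝒜) with
  | hadd x y hx hy =>
    obtain ⟨c, hc⟩ := hx
    obtain ⟨c', hc'⟩ := hy
    refine ⟨c + c', ?_⟩
    rw [TensorProduct.tmul_add, add_sub_add_comm]
    exact add_mem hc hc'
  | h e b hb =>
    -- In total degree `e` the second factor has degree at most `e`, so nothing is left once all
    -- components below `e + 1` vanish.
    obtain ⟨c, b', hb', hI, hp⟩ := R.exists_sub_mem_topIdeal_hom hn hl hex hb (e + 1).toNat
    have h0 : b' = 0 := eq_zero_of_rproj (𝒜 := 𝒜) fun q => by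
      rcases lt_or_ge q (e + 1).toNat with hq | hq
      · exact hp q hq
      · exact hA.rproj_of_lt (by omega) hb'
    rw [h0, sub_zero] at hI
    exact ⟨c, hI⟩

/-- Let `1 ⊗ c`, with `c` of degree `p`, be a coboundary. Exactness in degree `n - 1` allows a
primitive without components of degree below `p` in the second factor. In degree `p` its
differential is then given by the reduced matrix, whose entries have zero augmentation, so
augmenting the first factor yields `c = 0`. -/
theorem tmul_mem_topIdeal [∀ i, Finite (R.X i)] [Nonempty (R.X n)]
    (hl : ∀ x : R.X n, R.deg n x = l) (hex : ∀ i < n, ∀ d, R.IsColExact i d) {c : Aᵐᵒᵖ}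
    (hc : (1 ⊗ₜ c : Env k A) ∈ R.topIdeal n) : c = 0 := by
  obtain ⟨x₀⟩ := ‹Nonempty (R.X n)›
  let ε : Env k A →ₐ[k] Aᵐᵒᵖ := Algebra.TensorProduct.lift
    ((Algebra.ofId k Aᵐᵒᵖ).comp hA.augm) (AlgHom.id k Aᵐᵒᵖ)
    fun a y => Algebra.commute_algebraMap_left (hA.augm a) y
  have hε : ∀ a y, ε (a ⊗ₜ y) = algebraMap k Aᵐᵒᵖ (hA.augm a) * y := fun a y =>
    Algebra.TensorProduct.lift_tmul _ _ _ _ _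
  obtain ⟨s, hs⟩ := exists_sum_gproj (opGrading 𝒜) c
  rw [← hs s subset_rfl]
  refine Finset.sum_eq_zero fun e _ => ?_
  rcases lt_or_ge e 0 with he | he
  · exact hA.op.gproj_neg he c
  obtain ⟨p, rfl⟩ := Int.eq_ofNat_of_zero_le he
  cases n with
  | zero =>
    have h0 := congrArg ε (congrFun (show (fun _ : R.X 0 => (1 ⊗ₜ c : Env k A)) = 0 from hc) x₀)
    rw [hε, map_one, map_one, one_mul, Pi.zero_apply, map_zero] at h0
    rw [h0, map_zero]
  | succ n =>
    obtain ⟨w, hw⟩ := hc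
    have h1 := R.isHom_homProj (d := p - l) w
    have h2 : cob R.M n (R.homProj (p - l) w) = fun _ => 1 ⊗ₜ gproj (opGrading 𝒜) p c := by
      rw [← homProj_cob, hw]
      funext x
      rw [homProj, hl, add_sub_cancel, gproj_totGrading _ SetLike.GradedOne.one_mem, sub_zero]
    obtain ⟨w', hw', h3, h4⟩ := R.exists_sub_isCobdry_nat p (hex n (Nat.lt_succ_self n)) h1
      fun x q hq => by rw [h2, rproj_tmul, gproj_ne (gproj_mem _ _ _) hq.ne',
        TensorProduct.tmul_zero]
    have h5 := R.cob_of_isCobdry h3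
    rw [cob_sub, sub_eq_zero, h2] at h5
    have h6 := congrArg (fun b => ε (rproj 𝒜 p b)) (congrFun h5 x₀)
    have := Fintype.ofFinite (R.X n)
    change ε (rproj 𝒜 p _) = ε (rproj 𝒜 p _) at h6
    rw [rproj_tmul, gproj_gproj, hε, map_one, map_one, one_mul, R.rproj_cob h4, cob_eq_sum,
      map_sum] at h6
    rw [h6]
    refine Finset.sum_eq_zero fun y _ => ?_
    rw [redE_apply, smul_eq_mul, map_mul, hε, R.augm_redM, map_zero, zero_mul, zero_mul]

end Top

end MinRes

end EnvColumns

/-! ### Change of rings for free resolutions -/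

section Transport

variable {B B' : Type u} [Ring B] [Ring B'] (J : B →+* B') {X X' : Type u}

/-- The map of free modules induced by a ring homomorphism. -/
def mapF : (X →₀ B) →+ (X →₀ B') := Finsupp.mapRange.addMonoidHom J.toAddMonoidHom

theorem mapF_single (x : X) (b : B) :
    mapF J (Finsupp.single x b) = Finsupp.single x (J b) :=
  Finsupp.mapRange_single (hf := map_zero J)

theorem mapF_smul (b : B) (f : X →₀ B) : mapF J (b • f) = J b • mapF J f :=
  Finsupp.ext fun x => map_mul J b (f x)

theorem mapF_injective (hJ : Function.Injective J) :
    Function.Injective (mapF J : (X →₀ B) → (X →₀ B')) :=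
  Finsupp.mapRange_injective _ (map_zero J) hJ

theorem linearCombination_mapF (M : X' → X →₀ B) (f : X' →₀ B) :
    Finsupp.linearCombination B' (fun x => mapF J (M x)) (mapF J f) =
      mapF J (Finsupp.linearCombination B M f) := by
  induction f using Finsupp.induction_linear with
  | zero => simp only [map_zero]
  | add f g hf hg => simp only [map_add, hf, hg]
  | single x b =>
    rw [mapF_single, Finsupp.linearCombination_single, Finsupp.linearCombination_single, mapF_smul]

theorem cob_mapF {X : ℕ → Type u} (M : ∀ i, X (i + 1) → X i →₀ B) (i : ℕ) (v : X i → B)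
    (x : X (i + 1)) : cob (fun i x => mapF J (M i x)) i (fun y => J (v y)) x = J (cob M i v x) := by
  rw [cob, cob, Finsupp.linearCombination_apply, Finsupp.linearCombination_apply, map_finsuppSum]
  refine (Finsupp.sum_mapRange_index (hf := map_zero J) fun y => zero_smul B' (J (v y))).trans ?_
  exact Finsupp.sum_congr fun y _ => (map_mul J _ _).symm

/-- Transport of a free resolution along an isomorphism of rings. -/
def FreeRes.transport (e : B ≃+* B') {Y : ModuleCat.{u} B} {Y' : ModuleCat.{u} B'} (φ : Y ≃+ Y')
    (hφ : ∀ b y, φ (b • y) = e b • φ y) (R : FreeRes Y) : FreeRes Y' :=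
  have hs : ∀ {X : Type u} (f : X →₀ B'), mapF (e : B →+* B') (mapF (e.symm : B' →+* B) f) = f :=
    fun f => Finsupp.ext fun x => e.apply_symm_apply (f x)
  have hr : ∀ i f, rowMap (fun i x => mapF (e : B →+* B') (R.M i x)) i (mapF (e : B →+* B') f) =
      mapF (e : B →+* B') (rowMap R.M i f) := fun i f => linearCombination_mapF _ _ _
  have hinj : ∀ X : Type u, Function.Injective (mapF (e : B →+* B') : (X →₀ B) → (X →₀ B')) :=
    fun _ => mapF_injective (e : B →+* B') e.injective
  { X := R.X
    M := fun i x => mapF (e : B →+* B') (R.M i x)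
    aug :=
      { toFun := fun f => φ (R.aug (mapF (e.symm : B' →+* B) f))
        map_add' := fun f g => by rw [map_add, map_add, map_add]
        map_smul' := fun b f => by
          rw [mapF_smul, map_smul, hφ]
          exact congrArg (· • _) (e.apply_symm_apply b) }
    surjective := fun y => by
      obtain ⟨f, hf⟩ := R.surjective (φ.symm y)
      refine ⟨mapF (e : B →+* B') f, ?_⟩
      change φ (R.aug (mapF (e.symm : B' →+* B) (mapF (e : B →+* B') f))) = y
      rw [show mapF (e.symm : B' →+* B) (mapF (e : B →+* B') f) = f from
        Finsupp.ext fun x => e.symm_apply_apply (f x), hf, φ.apply_symm_apply]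
    exact_zero := fun f => by
      change φ (R.aug (mapF (e.symm : B' →+* B) f)) = 0 ↔ _
      rw [EmbeddingLike.map_eq_zero_iff, R.exact_zero]
      constructor
      · rintro ⟨g, hg⟩
        exact ⟨mapF (e : B →+* B') g, by rw [hr, hg, hs]⟩
      · rintro ⟨g, hg⟩
        refine ⟨mapF (e.symm : B' →+* B) g, hinj _ ?_⟩
        rw [← hr, hs, hs, hg]
    exact_succ := fun i f => by
      rw [← hs f, hr, map_eq_zero_iff _ (hinj _), R.exact_succ]
      constructor
      · rintro ⟨g, hg⟩
        exact ⟨mapF (e : B →+* B') g, by rw [hr, hg]⟩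
      · rintro ⟨g, hg⟩
        refine ⟨mapF (e.symm : B' →+* B) g, hinj _ ?_⟩
        rw [← hr, hs, hg] }

theorem isCobdry_mapF {X : ℕ → Type u} {M : ∀ i, X (i + 1) → X i →₀ B} {i : ℕ} {v : X i → B}
    (hv : IsCobdry M v) : IsCobdry (fun i x => mapF J (M i x)) (fun y => J (v y)) := by
  cases i with
  | zero =>
    refine funext fun x => ?_
    rw [congrFun (show v = 0 from hv) x]
    exact map_zero J
  | succ i =>
    obtain ⟨w, rfl⟩ := hv
    exact ⟨fun y => J (w y), funext fun x => cob_mapF J M i w x⟩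

theorem isCobdry_mapF_equiv (e : B ≃+* B') {X : ℕ → Type u} {M : ∀ i, X (i + 1) → X i →₀ B} {i : ℕ}
    {v : X i → B} : IsCobdry (fun i x => mapF (e : B →+* B') (M i x)) (fun y => e (v y)) ↔
      IsCobdry M v := by
  refine ⟨fun h => ?_, isCobdry_mapF (e : B →+* B')⟩
  have h1 := isCobdry_mapF (e.symm : B' →+* B) h
  have h2 : (fun i x => mapF (e.symm : B' →+* B) (mapF (e : B →+* B') (M i x))) = M :=
    funext fun i => funext fun x => Finsupp.ext fun y => e.symm_apply_apply _
  have h3 : (fun y => (e.symm : B' →+* B) (e (v y))) = v := funext fun y => e.symm_apply_apply _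
  rwa [h2, h3] at h1

end Transport

/-! ### The same resolution over the opposite algebra -/

section Symmetry

variable {k A : Type u} [Field k] [Ring A] [Algebra k A]

variable (k A) in
/-- The enveloping algebras of an algebra and of its opposite are isomorphic. -/
def envOp : Env k A ≃ₐ[k] Env k Aᵐᵒᵖ :=
  (Algebra.TensorProduct.comm k A Aᵐᵒᵖ).trans
    (Algebra.TensorProduct.congr AlgEquiv.refl (AlgEquiv.opOp k A))

theorem envOp_tmul (a : A) (y : Aᵐᵒᵖ) :
    envOp k A (a ⊗ₜ y) = y ⊗ₜ MulOpposite.op (MulOpposite.op a) := rfl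

theorem op_smul_bimod (b : Env k A) (s : bimod k A) :
    (MulOpposite.op (show A from b • s) : Aᵐᵒᵖ) =
      (show Aᵐᵒᵖ from envOp k A b • (show bimod k Aᵐᵒᵖ from MulOpposite.op (show A from s))) := by
  induction b using TensorProduct.induction_on with
  | zero =>
    rw [map_zero]
    refine (congrArg (fun s : A => MulOpposite.op s) (zero_smul (Env k A) s)).trans ?_
    exact (zero_smul (Env k Aᵐᵒᵖ) (show bimod k Aᵐᵒᵖ from MulOpposite.op (show A from s))).symm
  | add x y hx hy =>
    rw [map_add]
    refine (congrArg (fun s : A => MulOpposite.op s) (add_smul x y s)).trans ?_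
    refine Eq.trans ?_ (add_smul (envOp k A x) (envOp k A y)
      (show bimod k Aᵐᵒᵖ from MulOpposite.op (show A from s))).symm
    exact congrArg₂ (fun a b : Aᵐᵒᵖ => a + b) hx hy
  | tmul a y =>
    rw [envOp_tmul]
    refine (congrArg (fun s : A => MulOpposite.op s) (bimod_smul' a y s)).trans ?_
    refine Eq.trans ?_ (bimod_smul' y _ (show bimod k Aᵐᵒᵖ from MulOpposite.op
      (show A from s))).symm
    change _ = y * MulOpposite.op (show A from s) * MulOpposite.op a
    rw [MulOpposite.op_mul, MulOpposite.op_mul, MulOpposite.op_unop, mul_assoc]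

variable {𝒜 : ℤ → Submodule k A} [GradedAlgebra 𝒜] {hA : IsConnectedGraded 𝒜}

theorem envOp_mem {d : ℤ} {b : Env k A} (hb : b ∈ envGrading 𝒜 d) :
    envOp k A b ∈ envGrading (opGrading 𝒜) d := by
  induction hb using totGrading_induction with
  | h0 => rw [map_zero]; exact zero_mem _
  | hadd x y _ _ hx hy => rw [map_add]; exact add_mem hx hy
  | h i j hij a ha c hc =>
    exact tmul_mem_totGrading hc (op_mem_opGrading.2 (op_mem_opGrading.2 ha))
      ((add_comm j i).trans hij)

theorem IsConnectedGraded.augm_envOp (hA : IsConnectedGraded 𝒜) (b : Env k A) :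
    (hA.op.tot hA.op.op).augm (envOp k A b) = (hA.tot hA.op).augm b := by
  induction b using TensorProduct.induction_on with
  | zero => simp only [map_zero]
  | add x y hx hy => simp only [map_add, hx, hy]
  | tmul a y =>
    rw [envOp_tmul, hA.op.augm_env_tmul, hA.augm_env_tmul, hA.augm_op, MulOpposite.unop_op,
      hA.augm_op, MulOpposite.unop_op, mul_comm]

/-- The minimal resolution of the opposite algebra. -/
def MinRes.op (R : MinRes hA) : MinRes hA.op where
  toFreeRes := R.toFreeRes.transport (envOp k A).toRingEquiv
    (show bimod k A ≃+ bimod k Aᵐᵒᵖ from MulOpposite.opAddEquiv) op_smul_bimod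
  deg := R.deg
  mem i x y := envOp_mem (R.mem i x y)
  augm i x y := (hA.augm_envOp _).trans (R.augm i x y)
  deg_nonneg := R.deg_nonneg
  deg_zero := R.deg_zero
  aug_single x := by
    have h : mapF ((envOp k A).toRingEquiv.symm : Env k Aᵐᵒᵖ →+* Env k A)
        (Finsupp.single x (1 : Env k Aᵐᵒᵖ)) = Finsupp.single x 1 := by
      rw [mapF_single, map_one]
    exact congrArg (fun s : A => MulOpposite.op s) ((congrArg R.aug h).trans (R.aug_single x))

theorem MinRes.envOp_mem_topIdeal (R : MinRes hA) {n : ℕ} {b : Env k A} :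
    envOp k A b ∈ R.op.topIdeal n ↔ b ∈ R.topIdeal n :=
  isCobdry_mapF_equiv (envOp k A).toRingEquiv (M := R.M) (v := fun _ => b)

end Symmetry

/-! ### The twisting automorphism -/

section Twist

variable {k S : Type u} [Field k] [Ring S] [Algebra k S]

/-- A right ideal of the enveloping algebra which is a complement of each of the two tensor
factors. -/
structure IsTwistIdeal (I : AddSubgroup (Env k S)) : Prop where
  mul_mem : ∀ b ∈ I, ∀ c, b * c ∈ I
  exists_left : ∀ b, ∃ a : S, b - a ⊗ₜ 1 ∈ I
  exists_right : ∀ b, ∃ c : S, b - 1 ⊗ₜ MulOpposite.op c ∈ I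
  left_eq_zero : ∀ a : S, (a ⊗ₜ 1 : Env k S) ∈ I → a = 0
  right_eq_zero : ∀ c : S, (1 ⊗ₜ MulOpposite.op c : Env k S) ∈ I → c = 0

/-- Modulo `I` each `1 ⊗ c` agrees with a unique `σ(c) ⊗ 1`, and the right ideal property gives `x ⊗
y ≡ σ(y)x ⊗ 1`. Since `1 ⊗ ab` is the product of `1 ⊗ b` and `1 ⊗ a`, it reduces to `σ(a)σ(b) ⊗ 1`,
so `σ` is multiplicative. It is bijective because `1 ⊗ S°` is a complement too. -/
theorem IsTwistIdeal.exists_automorphism {I : AddSubgroup (Env k S)} (h : IsTwistIdeal I) :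
    ∃ σ : S ≃ₐ[k] S, ∀ (b : Env k S) (x y : S), b = x ⊗ₜ MulOpposite.op y →
      b - (σ y * x) ⊗ₜ 1 ∈ I := by
  choose σ hσ using fun c : S => h.exists_left (1 ⊗ₜ MulOpposite.op c)
  have huniq : ∀ {b : Env k S} {a a' : S}, b - a ⊗ₜ 1 ∈ I → b - a' ⊗ₜ 1 ∈ I → a = a' := by
    intro b a a' ha ha'
    have h1 := sub_mem ha' ha
    rw [sub_sub_sub_cancel_left, ← TensorProduct.sub_tmul] at h1
    exact sub_eq_zero.1 (h.left_eq_zero _ h1)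
  have hmul : ∀ x y : S, (x ⊗ₜ MulOpposite.op y : Env k S) - (σ y * x) ⊗ₜ 1 ∈ I := fun x y => by
    have h1 := h.mul_mem _ (hσ y) (x ⊗ₜ 1)
    rwa [sub_mul, Algebra.TensorProduct.tmul_mul_tmul, Algebra.TensorProduct.tmul_mul_tmul, one_mul,
      mul_one, mul_one] at h1
  let f : S →ₐ[k] S :=
    { toFun := σ
      map_one' := huniq (hσ 1) (by
        rw [MulOpposite.op_one, sub_self]; exact zero_mem _)
      map_mul' := fun a b => huniq (hσ (a * b)) (by
        have h1 := h.mul_mem _ (hσ b) (1 ⊗ₜ MulOpposite.op a)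
        rw [sub_mul, Algebra.TensorProduct.tmul_mul_tmul, Algebra.TensorProduct.tmul_mul_tmul,
          one_mul, mul_one, one_mul, ← MulOpposite.op_mul] at h1
        have h2 := add_mem h1 (hmul (σ b) a)
        rwa [sub_add_sub_cancel] at h2)
      map_zero' := huniq (hσ 0) (by
        rw [MulOpposite.op_zero, TensorProduct.tmul_zero, TensorProduct.zero_tmul, sub_self]
        exact zero_mem _)
      map_add' := fun a b => huniq (hσ (a + b)) (by
        rw [MulOpposite.op_add, TensorProduct.tmul_add, TensorProduct.add_tmul, add_sub_add_comm]
        exact add_mem (hσ a) (hσ b))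
      commutes' := fun c => huniq (hσ _) (by
        rw [Algebra.algebraMap_eq_smul_one, MulOpposite.op_smul, MulOpposite.op_one,
          TensorProduct.tmul_smul, TensorProduct.smul_tmul', sub_self]
        exact zero_mem _) }
  have hf : Function.Bijective f := by
    constructor
    · rw [injective_iff_map_eq_zero]
      intro c hc
      have h1 := hσ c
      rw [show σ c = 0 from hc, TensorProduct.zero_tmul, sub_zero] at h1
      exact h.right_eq_zero c h1
    · intro a
      obtain ⟨c, hc⟩ := h.exists_right (a ⊗ₜ 1)
      refine ⟨c, huniq (hσ c) ?_⟩
      rw [← neg_mem_iff, neg_sub]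
      exact hc
  exact ⟨AlgEquiv.ofBijective f hf, by rintro _ x y rfl; exact hmul x y⟩

/-- The projection of the enveloping algebra given by an automorphism. -/
def twistProj (σ : S ≃ₐ[k] S) : Env k S →ₗ[k] S :=
  TensorProduct.lift (LinearMap.mk₂ k (fun x y => σ y.unop * x)
    (fun x x' y => mul_add _ _ _) (fun c x y => mul_smul_comm _ _ _)
    (fun x y y' => by rw [MulOpposite.unop_add, map_add, add_mul])
    (fun c x y => by rw [MulOpposite.unop_smul, map_smul, smul_mul_assoc]))

theorem twistProj_tmul (σ : S ≃ₐ[k] S) (x : S) (y : Sᵐᵒᵖ) :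
    twistProj σ (x ⊗ₜ y) = σ y.unop * x := rfl

theorem twistProj_mul (σ : S ≃ₐ[k] S) (b : Env k S) (s t : S) :
    twistProj σ (b * (t ⊗ₜ MulOpposite.op s)) = σ s * twistProj σ b * t := by
  induction b using TensorProduct.induction_on with
  | zero => simp only [zero_mul, map_zero, mul_zero]
  | add x y hx hy => simp only [add_mul, map_add, hx, hy, mul_add]
  | tmul x y =>
    rw [Algebra.TensorProduct.tmul_mul_tmul, twistProj_tmul, twistProj_tmul, MulOpposite.unop_mul,
      MulOpposite.unop_op, map_mul, mul_assoc, mul_assoc, mul_assoc]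

/-- As `b ≡ twistProj σ b ⊗ 1` modulo `I` and `I` meets `S ⊗ 1` trivially, `I` is the kernel of the
projection. -/
theorem IsTwistIdeal.exists_twistProj {I : AddSubgroup (Env k S)} (h : IsTwistIdeal I) :
    ∃ σ : S ≃ₐ[k] S, (∀ b, b - twistProj σ b ⊗ₜ 1 ∈ I) ∧ ∀ b, b ∈ I ↔ twistProj σ b = 0 := by
  obtain ⟨σ, hσ⟩ := h.exists_automorphism
  have h1 : ∀ b, b - twistProj σ b ⊗ₜ 1 ∈ I := fun b => by
    induction b using TensorProduct.induction_on with
    | zero => rw [map_zero, TensorProduct.zero_tmul, sub_zero]; exact zero_mem _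
    | add x y hx hy =>
      rw [map_add, TensorProduct.add_tmul, add_sub_add_comm]
      exact add_mem hx hy
    | tmul x y => exact hσ _ x y.unop rfl
  refine ⟨σ, h1, fun b => ⟨fun hb => h.left_eq_zero _ ?_, fun hb => ?_⟩⟩
  · have := sub_mem hb (h1 b)
    rwa [sub_sub_cancel] at this
  · have := h1 b
    rwa [hb, TensorProduct.zero_tmul, sub_zero] at this

end Twist

/-! ### Rings of fractions of enveloping algebras -/

section Fractions

/-- Every finite family of elements of `B'` has a common left denominator from `D`. -/
structure IsRingOfFractions {B B' : Type u} [Ring B] [Ring B'] (J : B →+* B') (D : Submonoid B) :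
    Prop where
  injective : Function.Injective J
  isUnit : ∀ d ∈ D, IsUnit (J d)
  exists_left : ∀ q, ∃ d ∈ D, ∃ b, J d * q = J b
  exists_right : ∀ q, ∃ d ∈ D, ∃ b, q * J d = J b

variable {B B' : Type u} [Ring B] [Ring B'] {J : B →+* B'} {D : Submonoid B}

theorem IsRingOfFractions.common_left (h : IsRingOfFractions J D) {X : Type*} (s : Finset X)
    (q : X → B') : ∃ d ∈ D, ∀ x ∈ s, ∃ b, J d * q x = J b := by
  classical
  induction s using Finset.induction_on with
  | empty => exact ⟨1, D.one_mem, by simp⟩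
  | insert x s _ ih =>
    obtain ⟨d, hd, hs⟩ := ih
    obtain ⟨e, he, b, hb⟩ := h.exists_left (J d * q x)
    refine ⟨e * d, D.mul_mem he hd, fun y hy => ?_⟩
    rw [map_mul, mul_assoc]
    rcases Finset.mem_insert.1 hy with rfl | hy
    · exact ⟨b, hb⟩
    · obtain ⟨c, hc⟩ := hs y hy
      exact ⟨e * c, by rw [hc, map_mul]⟩

theorem IsRingOfFractions.common_right (h : IsRingOfFractions J D) {X : Type*} (s : Finset X)
    (q : X → B') : ∃ d ∈ D, ∀ x ∈ s, ∃ b, q x * J d = J b := by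
  classical
  induction s using Finset.induction_on with
  | empty => exact ⟨1, D.one_mem, by simp⟩
  | insert x s _ ih =>
    obtain ⟨d, hd, hs⟩ := ih
    obtain ⟨e, he, b, hb⟩ := h.exists_right (q x * J d)
    refine ⟨d * e, D.mul_mem hd he, fun y hy => ?_⟩
    rw [map_mul, ← mul_assoc]
    rcases Finset.mem_insert.1 hy with rfl | hy
    · exact ⟨b, hb⟩
    · obtain ⟨c, hc⟩ := hs y hy
      exact ⟨c * e, by rw [hc, map_mul]⟩

/-- Exactness of the rows over a ring of fractions. -/
theorem IsRingOfFractions.exists_mapF (h : IsRingOfFractions J D) {X : Type u} (f : X →₀ B') :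
    ∃ d ∈ D, ∃ g : X →₀ B, J d • f = mapF J g := by
  classical
  obtain ⟨d, hd, hs⟩ := h.common_left f.support f
  have hs' : ∀ x, ∃ b, J d * f x = J b := fun x => by
    by_cases hx : x ∈ f.support
    · exact hs x hx
    · exact ⟨0, by rw [Finsupp.notMem_support_iff.1 hx, mul_zero, map_zero]⟩
  choose b hb using hs'
  refine ⟨d, hd, Finsupp.onFinset f.support b fun x hx => ?_, Finsupp.ext fun x => hb x⟩
  rw [Finsupp.mem_support_iff]
  intro h0
  have h1 := hb x
  rw [h0, mul_zero] at h1
  exact hx (h.injective (h1.symm.trans (map_zero J).symm))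

/-- Multiplying by a denominator, which is a unit of `B'`, brings an element of the kernel into the
image of the free module over `B`, where exactness is known. -/
theorem IsRingOfFractions.exists_of_map_eq_zero (h : IsRingOfFractions J D) {X : Type u}
    {N N' : Type u} [AddCommGroup N] [Module B N] [AddCommGroup N'] [Module B' N']
    (p : (X →₀ B) →ₗ[B] N) (p' : (X →₀ B') →ₗ[B'] N') (φ : N →+ N') (hφ : Function.Injective φ)
    (hp : ∀ g, p' (mapF J g) = φ (p g)) {X' : Type u} (M : X' → X →₀ B)
    (hM : Function.Exact (Finsupp.linearCombination B M) p) :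
    Function.Exact (Finsupp.linearCombination B' fun x => mapF J (M x)) p' := by
  intro f
  constructor
  · intro hf
    obtain ⟨d, hd, g, hg⟩ := h.exists_mapF f
    have h1 : p g = 0 := hφ (by rw [← hp, ← hg, map_smul, hf, smul_zero, map_zero])
    obtain ⟨g', rfl⟩ := (hM g).1 h1
    obtain ⟨u, hu⟩ := h.isUnit d hd
    refine ⟨(↑u⁻¹ : B') • mapF J g', ?_⟩
    rw [map_smul, linearCombination_mapF, ← hg, ← hu, smul_smul, Units.inv_mul, one_smul]
  · rintro ⟨f', rfl⟩
    obtain ⟨d, hd, g, hg⟩ := h.exists_mapF f'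
    obtain ⟨u, hu⟩ := h.isUnit d hd
    have h1 : J d • p' (Finsupp.linearCombination B' (fun x => mapF J (M x)) f') = 0 := by
      rw [← map_smul, ← map_smul, hg, linearCombination_mapF, hp, hM.apply_apply_eq_zero, map_zero]
    rw [← one_smul B' (p' _), ← u.inv_mul, mul_smul, hu, h1, smul_zero]

/-- The free resolution over a ring of fractions. -/
def FreeRes.localize (h : IsRingOfFractions J D) {Y : ModuleCat.{u} B} {Y' : ModuleCat.{u} B'}
    (φ : Y →+ Y') (hφ : ∀ b y, φ (b • y) = J b • φ y) (hinj : Function.Injective φ)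
    (hsurj : ∀ y, ∃ d ∈ D, ∃ y', J d • y = φ y') (R : FreeRes Y) : FreeRes Y' :=
  have ha : ∀ g, Finsupp.linearCombination B' (fun x => φ (R.aug (Finsupp.single x 1)))
      (mapF J g) = φ (R.aug g) := fun g => by
    induction g using Finsupp.induction_linear with
    | zero => simp only [map_zero]
    | add f g hf hg => simp only [map_add, hf, hg]
    | single x b =>
      rw [mapF_single, Finsupp.linearCombination_single, ← hφ, ← map_smul, Finsupp.smul_single,
        smul_eq_mul, mul_one]
  { X := R.X
    M := fun i x => mapF J (R.M i x)
    aug := Finsupp.linearCombination B' fun x => φ (R.aug (Finsupp.single x 1))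
    surjective := fun y => by
      obtain ⟨d, hd, y', hy⟩ := hsurj y
      obtain ⟨g, rfl⟩ := R.surjective y'
      obtain ⟨u, hu⟩ := h.isUnit d hd
      refine ⟨(↑u⁻¹ : B') • mapF J g, ?_⟩
      rw [map_smul, ha, ← hy, ← hu, smul_smul, Units.inv_mul, one_smul]
    exact_zero := h.exists_of_map_eq_zero R.aug _ φ hinj ha (R.M 0) R.exact_zero
    exact_succ := fun i => h.exists_of_map_eq_zero (rowMap R.M i) _ (mapF J)
      (mapF_injective J h.injective) (linearCombination_mapF J (R.M i)) (R.M (i + 1))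
      (R.exact_succ i) }

/-- A finite column has a common right denominator, and right multiplication commutes with the
differential. -/
theorem IsRingOfFractions.isCobdry_iff (h : IsRingOfFractions J D) {X : ℕ → Type u}
    [∀ i, Finite (X i)] (M : ∀ i, X (i + 1) → X i →₀ B) {i : ℕ} (v : X i → B') :
    IsCobdry (fun i x => mapF J (M i x)) v ↔
      ∃ d ∈ D, ∃ v' : X i → B, (∀ x, v x * J d = J (v' x)) ∧ IsCobdry M v' := by
  constructor
  · intro hv
    cases i with
    | zero =>
      refine ⟨1, D.one_mem, 0, fun x => ?_, IsCobdry.zero⟩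
      rw [congrFun (show v = 0 from hv) x]
      exact (zero_mul _).trans (map_zero J).symm
    | succ i =>
      obtain ⟨w, rfl⟩ := hv
      have := Fintype.ofFinite (X i)
      obtain ⟨d, hd, hs⟩ := h.common_right Finset.univ w
      choose w' hw' using fun x => hs x (Finset.mem_univ x)
      refine ⟨d, hd, cob M i w', fun x => ?_, w', rfl⟩
      rw [← cob_mapF, ← congrFun (cob_mul _ i w (J d)) x]
      congr 1
      exact funext hw'
  · rintro ⟨d, hd, v', hv, hv'⟩
    obtain ⟨u, hu⟩ := h.isUnit d hd
    have h1 := (isCobdry_mapF J hv').mul (↑u⁻¹ : B')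
    convert h1 using 1
    refine funext fun x => ?_
    rw [← hv, ← hu, mul_assoc, Units.mul_inv, mul_one]

theorem IsRingOfFractions.isCobdry_of_cob_eq_zero (h : IsRingOfFractions J D) {X : ℕ → Type u}
    [∀ i, Finite (X i)] (M : ∀ i, X (i + 1) → X i →₀ B) {i : ℕ}
    (hM : ∀ v : X i → B, cob M i v = 0 → IsCobdry M v) (v : X i → B')
    (hv : cob (fun i x => mapF J (M i x)) i v = 0) : IsCobdry (fun i x => mapF J (M i x)) v := by
  have := Fintype.ofFinite (X i)
  obtain ⟨d, hd, hs⟩ := h.common_right Finset.univ v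
  choose v' hv' using fun x => hs x (Finset.mem_univ x)
  refine (h.isCobdry_iff M v).2 ⟨d, hd, v', hv', hM v' (funext fun x => h.injective ?_)⟩
  rw [← cob_mapF, ← funext hv', congrFun (cob_mul _ i v (J d)) x, hv]
  exact (zero_mul _).trans (map_zero J).symm

end Fractions

/-! ### The enveloping algebra of `Q(A)` as a ring of fractions -/

section EnvFractions

variable {k A Q : Type u} [Field k] [Ring A] [Algebra k A] [Ring Q] [Algebra k Q]

/-- The submonoid of regular elements. -/
def regularElements (A : Type u) [Ring A] : Submonoid A where
  carrier := {s | IsRegular s}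
  one_mem' := isRegular_one
  mul_mem' := fun h h' => h.mul h'

theorem IsGoldieQuotientRing.isFractionRing {ι : A →ₐ[k] Q} (h : IsGoldieQuotientRing ι) :
    IsRingOfFractions (ι : A →+* Q) (regularElements A) where
  injective := h.injective
  isUnit := h.isUnit
  exists_left q := by
    obtain ⟨s, a, hs, h⟩ := h.exists_left q
    exact ⟨s, hs, a, h⟩
  exists_right q := by
    obtain ⟨s, a, hs, h⟩ := h.exists_right q
    exact ⟨s, hs, a, h⟩

/-- The homomorphism of enveloping algebras. -/
def envMap (ι : A →ₐ[k] Q) : Env k A →ₐ[k] Env k Q := Algebra.TensorProduct.map ι (AlgHom.op ι)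

theorem envMap_tmul (ι : A →ₐ[k] Q) (a : A) (y : Aᵐᵒᵖ) :
    envMap ι (a ⊗ₜ y) = ι a ⊗ₜ MulOpposite.op (ι y.unop) := rfl

variable (k A) in
/-- The tensors of pairs of regular elements. -/
def envRegular : Submonoid (Env k A) where
  carrier := {b | ∃ s t : A, IsRegular s ∧ IsRegular t ∧ b = s ⊗ₜ MulOpposite.op t}
  one_mem' := ⟨1, 1, isRegular_one, isRegular_one, rfl⟩
  mul_mem' := by
    rintro _ _ ⟨s, t, hs, ht, rfl⟩ ⟨s', t', hs', ht', rfl⟩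
    exact ⟨s * s', t' * t, hs.mul hs', ht'.mul ht, Algebra.TensorProduct.tmul_mul_tmul _ _ _ _⟩

theorem envMap_injective {ι : A →ₐ[k] Q} (hι : Function.Injective ι) :
    Function.Injective (envMap ι) :=
  TensorProduct.map_injective_of_flat_flat ι.toLinearMap (AlgHom.op ι).toLinearMap hι
    (fun _ _ h => MulOpposite.unop_injective (hι (MulOpposite.op_injective h)))

theorem isUnit_tmul_op (u v : Qˣ) : IsUnit ((u : Q) ⊗ₜ MulOpposite.op (v : Q) : Env k Q) := by
  refine ⟨⟨(u : Q) ⊗ₜ MulOpposite.op (v : Q), (↑u⁻¹ : Q) ⊗ₜ MulOpposite.op (↑v⁻¹ : Q), ?_, ?_⟩, rfl⟩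
  · rw [Algebra.TensorProduct.tmul_mul_tmul, ← MulOpposite.op_mul, Units.mul_inv, Units.inv_mul]
    rfl
  · rw [Algebra.TensorProduct.tmul_mul_tmul, ← MulOpposite.op_mul, Units.mul_inv, Units.inv_mul]
    rfl

/-- The second factor is an opposite ring, so left denominators in the tensor product combine left
denominators for the first entries with right denominators for the second ones, and conversely. -/
theorem IsGoldieQuotientRing.env {ι : A →ₐ[k] Q} (h : IsGoldieQuotientRing ι) :
    IsRingOfFractions (envMap ι : Env k A →+* Env k Q) (envRegular k A) where
  injective := envMap_injective h.injective
  isUnit := by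
    rintro _ ⟨s, t, hs, ht, rfl⟩
    obtain ⟨u, hu⟩ := h.isUnit s hs
    obtain ⟨v, hv⟩ := h.isUnit t ht
    have h1 : (envMap ι : Env k A →+* Env k Q) (s ⊗ₜ MulOpposite.op t) =
        (u : Q) ⊗ₜ MulOpposite.op (v : Q) := by
      rw [hu, hv]
      rfl
    rw [h1]
    exact isUnit_tmul_op u v
  exists_left q := by
    obtain ⟨S, rfl⟩ := TensorProduct.exists_finset q
    obtain ⟨s, hs, hs'⟩ := h.isFractionRing.common_left S fun x => x.1
    obtain ⟨t, ht, ht'⟩ := h.isFractionRing.common_right S fun x => x.2.unop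
    refine ⟨_, ⟨s, t, hs, ht, rfl⟩, ?_⟩
    suffices hS : (envMap ι : Env k A →+* Env k Q) (s ⊗ₜ MulOpposite.op t) *
        ∑ x ∈ S, x.1 ⊗ₜ[k] x.2 ∈ (envMap ι).range from
      Exists.imp (fun _ => Eq.symm) hS
    rw [Finset.mul_sum]
    refine sum_mem fun x hx => ?_
    obtain ⟨a, ha⟩ := hs' x hx
    obtain ⟨b, hb⟩ := ht' x hx
    refine ⟨a ⊗ₜ MulOpposite.op b, ?_⟩
    refine Eq.trans ?_ (Algebra.TensorProduct.tmul_mul_tmul (ι s) x.1 _ x.2).symm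
    exact congrArg₂ (fun (a b : Q) => a ⊗ₜ[k] MulOpposite.op b) ha.symm hb.symm
  exists_right q := by
    obtain ⟨S, rfl⟩ := TensorProduct.exists_finset q
    obtain ⟨s, hs, hs'⟩ := h.isFractionRing.common_right S fun x => x.1
    obtain ⟨t, ht, ht'⟩ := h.isFractionRing.common_left S fun x => x.2.unop
    refine ⟨_, ⟨s, t, hs, ht, rfl⟩, ?_⟩
    suffices hS : (∑ x ∈ S, x.1 ⊗ₜ[k] x.2) * (envMap ι : Env k A →+* Env k Q)
        (s ⊗ₜ MulOpposite.op t) ∈ (envMap ι).range from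
      Exists.imp (fun _ => Eq.symm) hS
    rw [Finset.sum_mul]
    refine sum_mem fun x hx => ?_
    obtain ⟨a, ha⟩ := hs' x hx
    obtain ⟨b, hb⟩ := ht' x hx
    refine ⟨a ⊗ₜ MulOpposite.op b, ?_⟩
    refine Eq.trans ?_ (Algebra.TensorProduct.tmul_mul_tmul x.1 (ι s) x.2 _).symm
    exact congrArg₂ (fun (a b : Q) => a ⊗ₜ[k] MulOpposite.op b) ha.symm hb.symm

theorem bimod_map_smul (ι : A →ₐ[k] Q) (b : Env k A) (s : bimod k A) :
    ι (show A from b • s) = (show Q from envMap ι b • (show bimod k Q from ι (show A from s))) := by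
  induction b using TensorProduct.induction_on with
  | zero =>
    rw [map_zero]
    refine (congrArg (fun s : A => ι s) (zero_smul (Env k A) s)).trans ((map_zero ι).trans ?_)
    exact (zero_smul (Env k Q) (show bimod k Q from ι (show A from s))).symm
  | add x y hx hy =>
    rw [map_add]
    refine (congrArg (fun s : A => ι s) (add_smul x y s)).trans ((map_add ι _ _).trans ?_)
    refine Eq.trans ?_ (add_smul (envMap ι x) (envMap ι y)
      (show bimod k Q from ι (show A from s))).symm
    exact congrArg₂ (fun a b : Q => a + b) hx hy
  | tmul a y =>
    refine (congrArg (fun s : A => ι s) (bimod_smul' a y s)).trans ?_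
    refine Eq.trans ?_ (bimod_smul' (ι a) _ (show bimod k Q from ι (show A from s))).symm
    change ι (a * (show A from s) * y.unop) = ι a * ι (show A from s) * ι y.unop
    rw [map_mul, map_mul]

/-- The free resolution of the bimodule `Q(A)` induced by one of `A`. -/
def FreeRes.quotientRing {ι : A →ₐ[k] Q} (h : IsGoldieQuotientRing ι) (R : FreeRes (bimod k A)) :
    FreeRes (bimod k Q) :=
  R.localize h.env (show bimod k A →+ bimod k Q from (ι : A →+ Q)) (bimod_map_smul ι) h.injective
    fun q => by
      obtain ⟨s, a, hs, ha⟩ := h.exists_left q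
      refine ⟨_, ⟨s, 1, hs, isRegular_one, rfl⟩, (show A from a), ?_⟩
      refine (bimod_smul' (ι s) _ q).trans ?_
      change ι s * (show Q from q) * ι 1 = ι a
      rw [map_one, mul_one]
      exact ha

end EnvFractions

/-! ### Extension of the twist to the quotient ring -/

section TwistLocalization

variable {k A Q : Type u} [Field k] [Ring A] [Algebra k A] [Ring Q] [Algebra k Q]

theorem IsRegular.map_algEquiv (σ : A ≃ₐ[k] A) {t : A} (ht : IsRegular t) : IsRegular (σ t) := by
  constructor
  · intro a b h
    have h1 := congrArg σ.symm h
    simp only [map_mul, AlgEquiv.symm_apply_apply] at h1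
    exact σ.symm.injective (ht.left h1)
  · intro a b h
    have h1 := congrArg σ.symm h
    simp only [map_mul, AlgEquiv.symm_apply_apply] at h1
    exact σ.symm.injective (ht.right h1)

theorem mem_topIdeal_quotientRing {ι : A →ₐ[k] Q} (h : IsGoldieQuotientRing ι)
    (R : FreeRes (bimod k A)) [∀ i, Finite (R.X i)] {n : ℕ} [Subsingleton (R.X n)]
    [Nonempty (R.X n)] (q : Env k Q) : q ∈ (R.quotientRing h).topIdeal n ↔
      ∃ d ∈ envRegular k A, ∃ b ∈ R.topIdeal n, q * envMap ι d = envMap ι b := by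
  refine (h.env.isCobdry_iff R.M (fun _ : R.X n => q)).trans ?_
  constructor
  · rintro ⟨d, hd, v, hv, hv'⟩
    obtain ⟨x⟩ := ‹Nonempty (R.X n)›
    refine ⟨d, hd, v x, ?_, hv x⟩
    have : v = fun _ => v x := funext fun y => by rw [Subsingleton.elim y x]
    rwa [this] at hv'
  · rintro ⟨d, hd, b, hb, hb'⟩
    exact ⟨d, hd, fun _ => b, fun _ => hb', hb⟩

theorem IsTwistIdeal.quotientRing {ι : A →ₐ[k] Q} (h : IsGoldieQuotientRing ι)
    (R : FreeRes (bimod k A)) [∀ i, Finite (R.X i)] {n : ℕ} [Subsingleton (R.X n)]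
    [Nonempty (R.X n)] (hI : IsTwistIdeal (R.topIdeal n)) :
    IsTwistIdeal ((R.quotientRing h).topIdeal n) := by
  obtain ⟨σ, hσ, hker⟩ := hI.exists_twistProj
  have hmem := fun q => mem_topIdeal_quotientRing h R (n := n) q
  have hmul : ∀ b ∈ (R.quotientRing h).topIdeal n, ∀ c, b * c ∈ (R.quotientRing h).topIdeal n :=
    fun b hb c => (R.quotientRing h).mul_mem_topIdeal hb c
  have hmap : ∀ b ∈ R.topIdeal n, envMap ι b ∈ (R.quotientRing h).topIdeal n := fun b hb =>
    (hmem _).2 ⟨1, one_mem _, b, hb, by rw [map_one, mul_one]⟩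
  have hmap' : ∀ a c : A, (ι (σ c * a) ⊗ₜ 1 : Env k Q) - ι a ⊗ₜ MulOpposite.op (ι c) ∈
      (R.quotientRing h).topIdeal n := fun a c => by
    have h1 := neg_mem (hmap _ (hσ (a ⊗ₜ MulOpposite.op c)))
    rw [map_sub, neg_sub, envMap_tmul, envMap_tmul, twistProj_tmul, MulOpposite.unop_op,
      MulOpposite.unop_one, map_one, MulOpposite.op_one] at h1
    exact h1
  have hleft : ∀ q, ∃ a : Q, q - a ⊗ₜ 1 ∈ (R.quotientRing h).topIdeal n := by
    intro q
    obtain ⟨_, ⟨s, t, hs, ht, rfl⟩, b, hb⟩ := h.env.exists_right q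
    obtain ⟨u, hu⟩ := h.isUnit s hs
    obtain ⟨v, hv⟩ := h.isUnit t ht
    obtain ⟨w, hw⟩ := h.isUnit _ (IsRegular.map_algEquiv σ ht)
    let z := ι (twistProj σ b) * (↑u⁻¹ : Q)
    have hb' : q * ((u : Q) ⊗ₜ MulOpposite.op (v : Q)) = envMap ι b := by
      rw [hu, hv]
      exact hb
    -- From `q(s ⊗ t) = b ≡ τ(b) ⊗ 1`, with `τ` the twisted projection, one gets `q ≡ τ(b)s⁻¹ ⊗ t⁻¹
    -- ≡ σ(t)⁻¹τ(b)s⁻¹ ⊗ 1`.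
    refine ⟨(↑w⁻¹ : Q) * z, ?_⟩
    have h1 := hmul _ (hmap _ (hσ b)) ((↑u⁻¹ : Q) ⊗ₜ MulOpposite.op (↑v⁻¹ : Q))
    rw [map_sub, sub_mul, ← hb', mul_assoc, Algebra.TensorProduct.tmul_mul_tmul,
      ← MulOpposite.op_mul, Units.mul_inv, Units.inv_mul, MulOpposite.op_one,
      ← Algebra.TensorProduct.one_def, mul_one, envMap_tmul, Algebra.TensorProduct.tmul_mul_tmul,
      MulOpposite.unop_one, map_one, MulOpposite.op_one, one_mul] at h1
    have h2 := hmul _ (hmap' 1 t) (((↑w⁻¹ : Q) * z) ⊗ₜ MulOpposite.op (↑v⁻¹ : Q))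
    rw [sub_mul, mul_one, Algebra.TensorProduct.tmul_mul_tmul, Algebra.TensorProduct.tmul_mul_tmul,
      ← MulOpposite.op_mul, ← hv, Units.inv_mul, map_one, one_mul, ← hw, ← mul_assoc,
      Units.mul_inv, one_mul, one_mul, MulOpposite.op_one] at h2
    have h3 := add_mem h1 h2
    rwa [sub_add_sub_cancel] at h3
  refine ⟨hmul, hleft, fun q => ?_, fun a ha => ?_, fun c hc => ?_⟩
  · obtain ⟨x, hx⟩ := hleft q
    obtain ⟨s, a, hs, ha⟩ := h.exists_right x
    obtain ⟨u, hu⟩ := h.isUnit s hs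
    obtain ⟨v, hv⟩ := h.isUnit _ (IsRegular.map_algEquiv σ.symm hs)
    let w := ι (σ.symm a) * (↑v⁻¹ : Q)
    -- For `x = as⁻¹` one has `x ⊗ 1 ≡ s⁻¹ ⊗ σ⁻¹(a) ≡ 1 ⊗ σ⁻¹(a)σ⁻¹(s)⁻¹`.
    refine ⟨w, ?_⟩
    have h1 := hmul _ (hmap' 1 (σ.symm a)) ((↑u⁻¹ : Q) ⊗ₜ 1)
    rw [mul_one, σ.apply_symm_apply, ← ha, ← hu, sub_mul, Algebra.TensorProduct.tmul_mul_tmul,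
      Algebra.TensorProduct.tmul_mul_tmul, map_one, one_mul, one_mul, mul_one, mul_assoc,
      Units.mul_inv, mul_one] at h1
    have h2 := hmul _ (hmap' 1 (σ.symm s)) ((↑u⁻¹ : Q) ⊗ₜ MulOpposite.op w)
    rw [mul_one, σ.apply_symm_apply, ← hu, sub_mul, Algebra.TensorProduct.tmul_mul_tmul,
      Algebra.TensorProduct.tmul_mul_tmul, map_one, one_mul, one_mul, Units.mul_inv,
      ← MulOpposite.op_mul, ← hv, mul_assoc, Units.inv_mul, mul_one] at h2
    have h3 := sub_mem (add_mem hx h1) h2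
    rwa [sub_add_sub_cancel, sub_sub_sub_cancel_right] at h3
  -- Clearing denominators puts some `a' ⊗ t` with `a' = ass'` into the ideal over `A`. Then `σ(t)a'
  -- = 0`, and `σ(t)` is regular. The case of the right factor is similar, with the regular element
  -- on the other side.
  · obtain ⟨_, ⟨s, t, hs, ht, rfl⟩, b, hb, he⟩ := (hmem _).1 ha
    obtain ⟨s', a', hs', ha'⟩ := h.exists_right (a * ι s)
    have h1 : envMap ι (b * (s' ⊗ₜ 1)) = envMap ι (a' ⊗ₜ MulOpposite.op t) := by
      rw [map_mul, ← he, envMap_tmul, envMap_tmul, envMap_tmul,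
        Algebra.TensorProduct.tmul_mul_tmul, Algebra.TensorProduct.tmul_mul_tmul, ha',
        MulOpposite.unop_one, map_one, MulOpposite.op_one, mul_one, one_mul]
    have h2 := hI.mul_mem b hb (s' ⊗ₜ 1)
    rw [envMap_injective h.injective h1, hker, twistProj_tmul, MulOpposite.unop_op] at h2
    have h3 : a' = 0 := (IsRegular.map_algEquiv σ ht).left (h2.trans (mul_zero _).symm)
    rw [h3, map_zero] at ha'
    exact (h.isUnit s hs).mul_left_eq_zero.1 ((h.isUnit s' hs').mul_left_eq_zero.1 ha')
  · obtain ⟨_, ⟨s, t, hs, ht, rfl⟩, b, hb, he⟩ := (hmem _).1 hc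
    obtain ⟨t', c', ht', hc'⟩ := h.exists_left (ι t * c)
    have h1 : envMap ι (b * (1 ⊗ₜ MulOpposite.op t')) = envMap ι (s ⊗ₜ MulOpposite.op c') := by
      rw [map_mul, ← he, envMap_tmul, envMap_tmul, envMap_tmul,
        Algebra.TensorProduct.tmul_mul_tmul, Algebra.TensorProduct.tmul_mul_tmul,
        MulOpposite.unop_op, MulOpposite.unop_op, MulOpposite.unop_op, ← MulOpposite.op_mul,
        ← MulOpposite.op_mul, hc', map_one, mul_one, one_mul]
    have h2 := hI.mul_mem b hb (1 ⊗ₜ MulOpposite.op t')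
    rw [envMap_injective h.injective h1, hker, twistProj_tmul, MulOpposite.unop_op] at h2
    have h3 : c' = 0 := σ.injective ((hs.right (h2.trans (zero_mul _).symm)).trans
        (map_zero σ).symm)
    rw [h3, map_zero] at hc'
    exact (h.isUnit t ht).mul_right_eq_zero.1 ((h.isUnit t' ht').mul_right_eq_zero.1 hc')

end TwistLocalization

/-! ### The twist of an Artin–Schelter regular algebra -/

section TwistRegular

variable {k A : Type u} [Field k] [Ring A] [Algebra k A] {𝒜 : ℤ → Submodule k A}
  [GradedAlgebra 𝒜] {hA : IsConnectedGraded 𝒜}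

/-- The left Gorenstein condition makes `1 ⊗ A°` a complement. The right one, applied to the same
resolution read over `A°`, makes `A ⊗ 1` a complement. It matters that both conditions hold with the
same `n` and `l`. -/
theorem MinRes.isTwistIdeal (R : MinRes hA) {n : ℕ} {l : ℤ}
    (hG : IsLeftGorenstein 𝒜 n l) (hG' : IsLeftGorenstein (opGrading 𝒜) n l)
    (hN : ∃ N : ℕ, ∀ M : GrMod 𝒜, projectiveDimension M ≤ N) :
    IsTwistIdeal (R.topIdeal n) := by
  obtain ⟨h1, h2⟩ := R.top_eq hG hN
  have h3 := h2 (n + 1) (Nat.lt_succ_self n)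
  have h4 := R.finite_X hG hN
  have h5 := R.subsingleton_top hG h3
  have hl := R.deg_top hG h3
  -- The opposite resolution has the same generators and degrees by definition, so what the left
  -- condition says about them carries over.
  have h1' : Nonempty (R.op.X n) := h1
  have h4' : ∀ i, Finite (R.op.X i) := h4
  have h5' : Subsingleton (R.op.X n) := h5
  have hl' : ∀ x : R.op.X n, R.op.deg n x = l := hl
  have hex : ∀ i < n, ∀ d, R.IsColExact i d := fun i hi d => R.isColExact_of_ext
      (hG.ext_ne i hi.ne d)
  have hex' : ∀ i < n, ∀ d, R.op.IsColExact i d := fun i hi d =>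
    R.op.isColExact_of_ext (hG'.ext_ne i hi.ne d)
  refine ⟨fun b hb c => R.mul_mem_topIdeal hb c, fun b => ?_, fun b => ?_, fun a ha => ?_,
    fun c hc => ?_⟩
  · obtain ⟨c, hc⟩ := R.op.exists_sub_mem_topIdeal h3 hl'
      (fun d hd => R.op.isColExact_of_ext (hG'.ext_eq_zero d hd)) (envOp k A b)
    refine ⟨c.unop.unop, R.envOp_mem_topIdeal.1 ?_⟩
    rw [map_sub, envOp_tmul]
    exact hc
  · obtain ⟨c, hc⟩ := R.exists_sub_mem_topIdeal h3 hl
      (fun d hd => R.isColExact_of_ext (hG.ext_eq_zero d hd)) b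
    exact ⟨c.unop, hc⟩
  · have h := R.envOp_mem_topIdeal.2 ha
    rw [envOp_tmul] at h
    have h' := R.op.tmul_mem_topIdeal hl' hex' h
    exact MulOpposite.op_injective (MulOpposite.op_injective h')
  · exact MulOpposite.op_injective (R.tmul_mem_topIdeal hl hex hc)

end TwistRegular

theorem hasInjectiveDimensionLT_of_forall {T : Type u} [Ring T] {n : ℕ}
    (h : ∀ N : ModuleCat.{u} T, HasProjectiveDimensionLT N n) (N : ModuleCat.{u} T) :
    HasInjectiveDimensionLT N n := by
  rw [hasInjectiveDimensionLT_iff]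
  intro i hi Y e
  have := h Y
  exact e.eq_zero_of_hasProjectiveDimensionLT n hi

theorem FreeRes.ext_congr {B : Type u} [Ring B] {Y N : ModuleCat.{u} B} {R : FreeRes Y} {i : ℕ}
    {v w : R.X i → N} (h : v = w) (hv : cob R.M i v = 0) (hw : cob R.M i w = 0) :
    R.ext v hv = R.ext w hw := by
  subst h
  rfl

theorem rightMul_apply {B : Type u} [Ring B] (c b : B) : (rightMul c).hom b = b * c := rfl

/-! ### Algebras with a twisted duality -/

section TwistedDuality

variable {k S : Type u} [Field k] [Ring S] [Algebra k S]

/-- A finite free resolution of the bimodule `S` whose last term, in degree `n`, has rank one, such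
that the dual complex is a resolution of a twist of `S`. -/
structure FreeRes.IsTwistedDual (R : FreeRes (bimod k S)) (n : ℕ) : Prop where
  nonempty : Nonempty (R.X n)
  subsingleton : Subsingleton (R.X n)
  isEmpty : ∀ i > n, IsEmpty (R.X i)
  isCobdry : ∀ i < n, ∀ v : R.X i → Env k S, cob R.M i v = 0 → IsCobdry R.M v
  isTwistIdeal : IsTwistIdeal (R.topIdeal n)

namespace FreeRes.IsTwistedDual

variable {R : FreeRes (bimod k S)} {n : ℕ}

theorem subsingleton_extEnv (h : R.IsTwistedDual n) {i : ℕ} (hi : i ≠ n) :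
    Subsingleton (ExtEnv k S i) := by
  refine subsingleton_of_forall_eq 0 fun α => ?_
  obtain ⟨v, hv, rfl⟩ := FreeRes.ext_surjective (R := R) α
  refine (FreeRes.ext_eq_zero_iff v hv).2 ?_
  obtain hi | hi := hi.lt_or_gt
  · exact h.isCobdry i hi v hv
  · have := h.isEmpty i hi
    rw [Subsingleton.elim v 0]
    exact IsCobdry.zero

theorem cob_eq_zero (h : R.IsTwistedDual n) (v : R.X n → Env k S) : cob R.M n v = 0 :=
  have := h.isEmpty (n + 1) n.lt_succ_self
  Subsingleton.elim _ _

/-- The class in `Ext` of a constant column. -/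
def topExt (h : R.IsTwistedDual n) : Env k S →+ ExtEnv k S n :=
  AddMonoidHom.mk' (fun b => R.ext (N := ModuleCat.of (Env k S) (Env k S)) (fun _ => b)
      (h.cob_eq_zero _)) fun b c =>
    FreeRes.ext_add (R := R) (N := ModuleCat.of (Env k S) (Env k S)) (fun _ => b) (fun _ => c)
      (h.cob_eq_zero _) (h.cob_eq_zero _)

theorem topExt_eq_zero_iff (h : R.IsTwistedDual n) (b : Env k S) :
    h.topExt b = 0 ↔ b ∈ R.topIdeal n :=
  FreeRes.ext_eq_zero_iff (R := R) (N := ModuleCat.of (Env k S) (Env k S)) (fun _ => b)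
    (h.cob_eq_zero _)

theorem topExt_surjective (h : R.IsTwistedDual n) : Function.Surjective h.topExt := fun α => by
  obtain ⟨v, hv, rfl⟩ := FreeRes.ext_surjective (R := R) α
  obtain ⟨x⟩ := h.nonempty
  have := h.subsingleton
  have hx : v = fun _ => v x := funext fun y => by rw [Subsingleton.elim y x]
  exact ⟨v x, FreeRes.ext_congr hx.symm (h.cob_eq_zero _) hv⟩

theorem bimodAct_topExt (h : R.IsTwistedDual n) (s t : S) (b : Env k S) :
    bimodAct s (h.topExt b) t = h.topExt (b * (t ⊗ₜ MulOpposite.op s)) := by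
  have h1 := FreeRes.ext_comp (R := R) (N := ModuleCat.of (Env k S) (Env k S)) (fun _ => b)
    (h.cob_eq_zero _) (rightMul (B := Env k S) (t ⊗ₜ[k] MulOpposite.op s))
  have h2 := FreeRes.ext_congr (R := R) (N := ModuleCat.of (Env k S) (Env k S)) (i := n)
    (funext fun _ => rightMul_apply (t ⊗ₜ[k] MulOpposite.op s) b)
    (h.cob_eq_zero _) (h.cob_eq_zero _)
  exact h1.trans h2

/-- The maps `topExt` and `twistProj σ` are surjective with the same kernel, so `Ext^n` is
identified with `S`. Under `twistProj σ` the left action is twisted by `σ`; composing with `σ⁻¹`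
moves the twist to the right action. -/
theorem exists_addEquiv (h : R.IsTwistedDual n) : ∃ (σ : S ≃ₐ[k] S) (e : ExtEnv k S n ≃+ S),
    ∀ s x t, e (bimodAct s x t) = s * e x * σ t := by
  obtain ⟨σ, -, hσ⟩ := h.isTwistIdeal.exists_twistProj
  have hs : Function.Surjective (twistProj σ : Env k S → S) := fun a =>
    ⟨a ⊗ₜ 1, by rw [twistProj_tmul, MulOpposite.unop_one, map_one, one_mul]⟩
  have hk : h.topExt.ker = (twistProj σ : Env k S →ₗ[k] S).toAddMonoidHom.ker :=
    AddSubgroup.ext fun b => (h.topExt_eq_zero_iff b).trans (hσ b)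
  let e : ExtEnv k S n ≃+ S :=
    (QuotientAddGroup.quotientKerEquivOfSurjective _ h.topExt_surjective).symm.trans <|
      (QuotientAddGroup.quotientAddEquivOfEq hk).trans <|
        (QuotientAddGroup.quotientKerEquivOfSurjective
          (twistProj σ : Env k S →ₗ[k] S).toAddMonoidHom hs).trans σ.symm.toAddEquiv
  have he : ∀ b, e (h.topExt b) = σ.symm (twistProj σ b) := fun b => by
    have : (QuotientAddGroup.quotientKerEquivOfSurjective _ h.topExt_surjective).symm
        (h.topExt b) = (b : Env k S ⧸ h.topExt.ker) :=
      (AddEquiv.symm_apply_eq _).2 rfl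
    simp only [e, AddEquiv.trans_apply, this]
    rfl
  refine ⟨σ.symm, e, fun s x t => ?_⟩
  obtain ⟨b, rfl⟩ := h.topExt_surjective x
  rw [h.bimodAct_topExt, he, he, twistProj_mul, map_mul, map_mul, AlgEquiv.symm_apply_apply]

theorem isRigid (h : R.IsTwistedDual n) (hS : IsSimpleArtinian S) : IsRigid k S := by
  obtain ⟨σ, e, he⟩ := h.exists_addEquiv
  exact ⟨hS, n, σ, fun i hi => h.subsingleton_extEnv hi, e, he⟩

theorem isSmooth (h : R.IsTwistedDual n) (hS : IsSimpleArtinian S) : IsSmooth k S := by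
  refine ⟨hS, lt_of_lt_of_le ((projectiveDimension_lt_iff (n := n + 1)).2
    (hasProjectiveDimensionLT_of_isZero R.toProjRes (n + 1) fun i hi => ?_)) le_top⟩
  have := h.isEmpty i hi
  exact ModuleCat.isZero_of_subsingleton (ModuleCat.of (Env k S) (R.X i →₀ Env k S))

theorem nontrivial_extEnv (h : R.IsTwistedDual n) [Nontrivial S] : Nontrivial (ExtEnv k S n) := by
  obtain ⟨-, e, -⟩ := h.exists_addEquiv
  exact e.toEquiv.nontrivial

theorem fhtr_eq (h : R.IsTwistedDual n) [Nontrivial S] : fhtr k S = n := by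
  refine le_antisymm (iSup₂_le fun i hi => ?_) (le_iSup₂_of_le n h.nontrivial_extEnv le_rfl)
  by_contra hlt
  exact not_nontrivial_iff_subsingleton.2
    (h.subsingleton_extEnv (i := i) fun he => hlt (by rw [he])) hi

/-- All modules over `S ⊗ U` have projective dimension at most `n`, so all of them have injective
dimension at most `n`. -/
theorem selfInjDim_le (h : R.IsTwistedDual n) (U : Type u) [Ring U] [Algebra k U]
    [IsSemisimpleRing U] : selfInjDim (S ⊗[k] U) ≤ n :=
  (injectiveDimension_le_iff _ n).2 <| hasInjectiveDimensionLT_of_forall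
    (fun N => hasProjectiveDimensionLT_of_freeRes AlgEquiv.refl R (n + 1)
      (fun i hi => h.isEmpty i hi) N) _

/-- The resolution gives the upper bound with `U = S°`, and the lower bound holds because `Ext^n(S,
S ⊗ S°)` is nonzero. -/
theorem htr_eq (h : R.IsTwistedDual n) [IsSemisimpleRing S] [Nontrivial S] : htr k S = n := by
  refine le_antisymm (h.selfInjDim_le Sᵐᵒᵖ) ((injectiveDimension_ge_iff _ n).2 fun hlt => ?_)
  exact not_nontrivial_iff_subsingleton.2
    (HasInjectiveDimensionLT.subsingleton _ n n le_rfl (bimod k S)) h.nontrivial_extEnv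

theorem one_notMem (h : R.IsTwistedDual n) [Nontrivial S] : (1 : Env k S) ∉ R.topIdeal n :=
  fun h1 => one_ne_zero (h.isTwistIdeal.left_eq_zero 1 h1)

end FreeRes.IsTwistedDual

end TwistedDuality

/-! ### Injective dimension of matrix rings -/

section Matrices

variable {T : Type u} [Ring T] {r : ℕ}

/-- The ring of square matrices. -/
abbrev SqMat (r : ℕ) (T : Type u) : Type u := Matrix (Fin r) (Fin r) T

/-- A column over a matrix ring is a coboundary if the columns made of the entries of its rows
are coboundaries over the coefficient ring. -/
theorem isCobdry_of_hasInjectiveDimensionLT [NeZero r]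
    {Y : ModuleCat.{u} (SqMat r T)} (R : FreeRes Y) {n : ℕ}
    (hT : HasInjectiveDimensionLT (ModuleCat.of T T) n) (v : R.X n → SqMat r T)
    (hv : cob R.M n v = 0) : IsCobdry R.M v := by
  let _ : Module T Y := Module.compHom Y (Matrix.scalar (Fin r) : T →+* SqMat r T)
  have hY : IsScalarTower T (SqMat r T) Y := ⟨fun t b y => by
    have h1 : t • b = Matrix.scalar (Fin r) t * b := by
      rw [Matrix.scalar_apply]; exact Matrix.smul_eq_diagonal_mul b t
    rw [h1, mul_smul]
    rfl⟩
  let P : ProjRes (ModuleCat.of T Y) := ProjRes.ofModules (fun i => R.X i →₀ SqMat r T)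
    (fun i => (rowMap R.M i).restrictScalars T) (R.aug.restrictScalars T) R.surjective
    R.exact_zero R.exact_succ
  let entry (p q : Fin r) : SqMat r T →ₗ[T] T :=
    { toFun := fun b => b p q
      map_add' := fun _ _ => rfl
      map_smul' := fun _ _ => rfl }
  -- A map to the matrix ring is determined by the entries of its row `0`, which are `T`-linear
  -- forms, because matrix units move every row to row `0`.
  let φ (q : Fin r) : (R.X n →₀ SqMat r T) →ₗ[T] T :=
    entry 0 q ∘ₗ (Finsupp.linearCombination (SqMat r T) v).restrictScalars T
  -- Free modules over the matrix ring are projective over `T`, so `P` is also a projective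
  -- resolution over `T`. These forms are then coboundaries by the vanishing of `Ext^n_T(Y, T)`.
  have hφ : ∀ q, P.IsCob (N := ModuleCat.of T T) (ModuleCat.ofHom (φ q)) := fun q => by
    refine P.isCob_of_subsingleton
      (HasInjectiveDimensionLT.subsingleton _ n n le_rfl _) _ (ModuleCat.hom_ext ?_)
    refine LinearMap.ext fun f => ?_
    have h1 := LinearMap.congr_fun (linearCombination_comp_rowMap R.M n v) f
    rw [hv, Finsupp.linearCombination_zero] at h1
    exact congrArg (entry 0 q) h1
  have hrow : ∀ (b : SqMat r T) (i q : Fin r),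
      ((Matrix.single 0 i 1 : SqMat r T) * b) 0 q = b i q := fun b i q => by
    rw [Matrix.single_mul_apply_same, one_mul]
  have hv' : ∀ x i q, Finsupp.linearCombination (SqMat r T) v
      (Finsupp.single x (Matrix.single 0 i 1)) 0 q = v x i q := fun x i q => by
    rw [Finsupp.linearCombination_single]
    exact hrow _ _ _
  cases n with
  | zero =>
    refine funext fun x => Matrix.ext fun i q => ?_
    have h1 : φ q = 0 := congrArg ModuleCat.Hom.hom (hφ q)
    have h2 := LinearMap.congr_fun h1 (Finsupp.single x (Matrix.single 0 i 1))
    exact (hv' x i q).symm.trans h2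
  | succ p =>
    choose g hg using hφ
    let χ (q : Fin r) : (R.X p →₀ SqMat r T) →ₗ[T] T := (g q).hom
    have hχ : ∀ q f, χ q (rowMap R.M p f) = Finsupp.linearCombination (SqMat r T) v f 0 q :=
        fun q f =>
      LinearMap.congr_fun (congrArg ModuleCat.Hom.hom (hg q)) f
    -- The forms are reassembled into a column of matrices: row `i` at `x` is obtained by applying
    -- them to the matrix unit `e_{0i}` placed at `x`.
    let w : R.X p → SqMat r T := fun x => Matrix.of fun i q =>
      χ q (Finsupp.single x (Matrix.single 0 i 1))
    have hw : ∀ f i q, Finsupp.linearCombination (SqMat r T) w f i q =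
        χ q ((Matrix.single 0 i (1 : T) : SqMat r T) • f) := fun f i q => by
      induction f using Finsupp.induction_linear with
      | zero => rw [map_zero, smul_zero, map_zero]; rfl
      | add f g hf hg => rw [map_add, smul_add, map_add, ← hf, ← hg]; rfl
      | single x b =>
        -- Expanding `e_{0i} b` over the matrix units `e_{0j}` reduces linearity over the matrix
        -- ring to linearity over `T`.
        have hb : (Matrix.single 0 i (1 : T) * b : SqMat r T) =
            ∑ j, b i j • (Matrix.single 0 j (1 : T) : SqMat r T) := by
          refine Matrix.ext fun a c => ?_
          rw [Matrix.sum_apply]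
          by_cases ha : a = 0
          · subst ha
            refine (hrow _ _ _).trans ?_
            rw [Finset.sum_eq_single c]
            · simp
            · intro j _ hj
              simp [hj]
            · simp
          · rw [Matrix.single_mul_apply_of_ne _ _ _ _ _ ha]
            exact (Finset.sum_eq_zero fun j _ => by
              simp [Ne.symm ha]).symm
        rw [Finsupp.linearCombination_single, smul_eq_mul, Finsupp.smul_single, smul_eq_mul, hb,
          Finsupp.single_finsetSum, map_sum, Matrix.mul_apply]
        refine Finset.sum_congr rfl fun j _ => ?_
        rw [← Finsupp.smul_single, map_smul]
        rfl
    refine ⟨w, funext fun x => Matrix.ext fun i q => ?_⟩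
    have h1 : (Matrix.single 0 i (1 : T) : SqMat r T) • R.M p x =
        rowMap R.M p (Finsupp.single x (Matrix.single 0 i 1)) := by
      rw [Finsupp.linearCombination_single]
    rw [cob, hw, h1, hχ, hv']

end Matrices

/-! ### The second modification of the homological transcendence degree -/

section SecondModification

variable {k S : Type u} [Field k] [Ring S] [Algebra k S]

/-- The enveloping algebra of a matrix algebra over `D` as a matrix ring over `S ⊗ D°`. -/
def envMatrix {D : Type u} [Ring D] [Algebra k D] {r : ℕ} (e : S ≃ₐ[k] SqMat r D) :
    Env k S ≃ₐ[k] SqMat r (S ⊗[k] Dᵐᵒᵖ) :=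
  ((Algebra.TensorProduct.congr AlgEquiv.refl
    (((AlgEquiv.op e).trans AlgEquiv.mopMatrix.symm).trans
      (matrixEquivTensor (Fin r) k Dᵐᵒᵖ))).trans
    (Algebra.TensorProduct.assoc k k k S Dᵐᵒᵖ (SqMat r k)).symm).trans
    (matrixEquivTensor (Fin r) k (S ⊗[k] Dᵐᵒᵖ)).symm

namespace FreeRes.IsTwistedDual

variable {R : FreeRes (bimod k S)} {n : ℕ}

/-- The enveloping algebra is a matrix ring over `S ⊗ D°`. If the latter had injective dimension
less than `n`, all columns in degree `n` would be coboundaries, including the constant column `1`,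
which is not in the top ideal. -/
theorem le_selfInjDim (h : R.IsTwistedDual n) [Nontrivial S] {D : Type u} [Ring D] [Algebra k D]
    {r : ℕ} [NeZero r] (e : S ≃ₐ[k] SqMat r D) : n ≤ selfInjDim (S ⊗[k] Dᵐᵒᵖ) := by
  refine (injectiveDimension_ge_iff _ n).2 fun hlt => h.one_notMem ?_
  let θ : Env k S ≃+* SqMat r (S ⊗[k] Dᵐᵒᵖ) := (envMatrix e).toRingEquiv
  let _ : Module (SqMat r (S ⊗[k] Dᵐᵒᵖ)) (bimod k S) :=
    Module.compHom _ (θ.symm : SqMat r (S ⊗[k] Dᵐᵒᵖ) →+* Env k S)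
  have hθ : ∀ (b : Env k S) (y : bimod k S), b • y = θ b • y := fun b y =>
    congrArg (fun b : Env k S => b • y) (θ.symm_apply_apply b).symm
  let R' : FreeRes (ModuleCat.of (SqMat r (S ⊗[k] Dᵐᵒᵖ)) (bimod k S)) :=
    R.transport θ (Y' := ModuleCat.of (SqMat r (S ⊗[k] Dᵐᵒᵖ)) (bimod k S)) (AddEquiv.refl _) hθ
  have hempty : IsEmpty (R'.X (n + 1)) := h.isEmpty (n + 1) n.lt_succ_self
  exact (isCobdry_mapF_equiv θ (M := R.M) (v := fun _ : R.X n => (1 : Env k S))).1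
    (isCobdry_of_hasInjectiveDimensionLT R' hlt (fun _ => θ 1) (Subsingleton.elim _ _))

/-- The supremum is attained at `U = D°`, where `S` is a matrix algebra over the division algebra
`D`. -/
theorem shtr_eq (h : R.IsTwistedDual n) (hS : IsSimpleArtinian S) : shtr k S = n := by
  have := hS.1
  have := hS.2
  refine le_antisymm (sSup_le ?_) ?_
  · rintro _ ⟨U, _, _, rfl⟩
    exact h.selfInjDim_le U
  · obtain ⟨r, _, D, _, _, ⟨e⟩⟩ := IsSimpleRing.exists_algEquiv_matrix_divisionRing k S
    exact (h.le_selfInjDim e).trans (le_sSup ⟨Dᵐᵒᵖ, inferInstance, inferInstance, rfl⟩)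

theorem isHomologicallyUniform (h : R.IsTwistedDual n) (hS : IsSimpleArtinian S) :
    IsHomologicallyUniform k S := by
  have := hS.1
  have := hS.2
  have : IsSemisimpleRing S := inferInstance
  refine ⟨hS, h.htr_eq.trans h.fhtr_eq.symm, h.fhtr_eq.trans (h.shtr_eq hS).symm, ?_⟩
  rw [h.shtr_eq hS]
  exact WithBot.coe_lt_coe.2 (ENat.natCast_lt_top n)

end FreeRes.IsTwistedDual

end SecondModification

/-! ### Artin–Schelter regular algebras -/

section Regular

variable {k A : Type u} [Field k] [Ring A] [Algebra k A] {𝒜 : ℤ → Submodule k A}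
  [GradedAlgebra 𝒜] {hA : IsConnectedGraded 𝒜}

namespace MinRes

variable (R : MinRes hA)

/-- The resolution of the trivial module, without its grading. -/
def trivFreeRes : FreeRes (ModuleCat.of A (A ⧸ GrMod.augIdeal 𝒜)) where
  X := R.X
  M := R.redM
  aug := (GrMod.augIdeal 𝒜).mkQ ∘ₗ coeffSum _ A
  surjective y := by
    obtain ⟨a, rfl⟩ := (GrMod.augIdeal 𝒜).mkQ_surjective y
    obtain ⟨x⟩ := R.nonempty_zero
    exact ⟨Finsupp.single x a, by simp⟩
  exact_zero f := by
    rw [← R.redM_exact_zero, ← hA.mem_augIdeal]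
    exact Submodule.Quotient.mk_eq_zero _
  exact_succ := R.redM_exact_succ

/-- The upper bound is the case `U = k` of the bound for `S ⊗ U`. For the lower bound, minimality
makes the differential of the complex of homomorphisms to `k` zero, so a generator in degree `n`
shows that `Ext^n_A(k, k) ≠ 0`. -/
theorem gldim_eq {n : ℕ} (h : Nonempty (R.X n)) (h' : ∀ i > n, IsEmpty (R.X i)) :
    gldim A = n := by
  refine le_antisymm (iSup_le fun N => (projectiveDimension_le_iff N n).2 ?_) ?_
  · exact hasProjectiveDimensionLT_of_freeRes (Algebra.TensorProduct.rid k k A) R.toFreeRes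
      (n + 1) (fun i hi => h' i hi) N
  let Y := ModuleCat.of A (A ⧸ GrMod.augIdeal 𝒜)
  refine le_trans ((projectiveDimension_ge_iff Y n).2 fun hlt => ?_)
    (le_iSup (fun M : ModuleCat.{u} A => projectiveDimension M) Y)
  have hempty : IsEmpty (R.trivFreeRes.X (n + 1)) := h' (n + 1) n.lt_succ_self
  let y : Y := (GrMod.augIdeal 𝒜).mkQ 1
  have hy : y ≠ 0 := fun h0 => by
    have h1 := (hA.mem_augIdeal 1).1 ((Submodule.Quotient.mk_eq_zero _).1 h0)
    rw [map_one] at h1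
    exact one_ne_zero h1
  have hcob : IsCobdry R.redM (fun _ : R.X n => y) :=
    (FreeRes.ext_eq_zero_iff (R := R.trivFreeRes) (fun _ => y) (Subsingleton.elim _ _)).1
      (@Subsingleton.elim _ (HasProjectiveDimensionLT.subsingleton Y n n le_rfl Y) _ _)
  obtain ⟨x⟩ := h
  cases n with
  | zero => exact hy (congrFun (show (fun _ : R.X 0 => y) = 0 from hcob) x)
  | succ p =>
    obtain ⟨w, hw⟩ := hcob
    refine hy ((congrFun hw x).symm.trans ?_)
    refine Finset.sum_eq_zero fun z _ => ?_
    obtain ⟨a, ha⟩ := (GrMod.augIdeal 𝒜).mkQ_surjective (w z)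
    change R.redM p x z • w z = 0
    rw [← ha, ← map_smul]
    refine (Submodule.Quotient.mk_eq_zero _).2 ((hA.mem_augIdeal _).2 ?_)
    rw [smul_eq_mul, map_mul, R.augm_redM, zero_mul]

/-- The resolution of the bimodule `Q(A)` induced by the minimal resolution of `A`. -/
theorem isTwistedDual {Q : Type u} [Ring Q] [Algebra k Q] {ι : A →ₐ[k] Q}
    (hQ : IsGoldieQuotientRing ι) {n : ℕ} {l : ℤ} (hG : IsLeftGorenstein 𝒜 n l)
    (hG' : IsLeftGorenstein (opGrading 𝒜) n l)
    (hN : ∃ N : ℕ, ∀ M : GrMod 𝒜, projectiveDimension M ≤ N) :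
    (R.toFreeRes.quotientRing hQ).IsTwistedDual n := by
  obtain ⟨h1, h2⟩ := R.top_eq hG hN
  have h3 := R.subsingleton_top hG (h2 (n + 1) n.lt_succ_self)
  have h4 := R.finite_X hG hN
  refine ⟨h1, h3, h2, fun i hi => ?_, (R.isTwistIdeal hG hG' hN).quotientRing hQ R.toFreeRes⟩
  exact hQ.env.isCobdry_of_cob_eq_zero R.M fun v hv =>
    R.isCobdry_of_cob_eq_zero (fun d => R.isColExact_of_ext (hG.ext_ne i hi.ne d)) hv

end MinRes

end Regular

end HomTrDeg

end

theorem theorem5p3 {k A Q : Type u} [Field k] [Ring A] [Algebra k A] [Ring Q] [Algebra k Q]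
    (𝒜 : ℤ → Submodule k A) [GradedAlgebra 𝒜]
    (hA : HomTrDeg.IsASRegular 𝒜) (hG : HomTrDeg.IsGoldiePrime A)
    (ι : A →ₐ[k] Q) (hQ : HomTrDeg.IsGoldieQuotientRing ι) :
    HomTrDeg.IsRigid k Q ∧ HomTrDeg.IsSmooth k Q ∧ HomTrDeg.IsHomologicallyUniform k Q ∧
      HomTrDeg.htr k Q = HomTrDeg.selfInjDim (Q ⊗[k] Qᵐᵒᵖ) ∧
      HomTrDeg.selfInjDim (Q ⊗[k] Qᵐᵒᵖ) = HomTrDeg.gldim A := by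
  obtain ⟨⟨hconn, n, l, hl, hr⟩, hN⟩ := hA
  obtain ⟨R⟩ := hconn.nonempty_minRes
  have hS := HomTrDeg.isSimpleArtinian_quotient hQ hG
  have h := R.isTwistedDual hQ hl hr hN
  have := hS.1
  have := hS.2
  have : IsSemisimpleRing Q := inferInstance
  obtain ⟨h1, h2⟩ := R.top_eq hl hN
  exact ⟨h.isRigid hS, h.isSmooth hS, h.isHomologicallyUniform hS, rfl,
    h.htr_eq.trans (R.gldim_eq h1 h2).symm⟩
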